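/- Fix an integer $L\ge 1$ and reals $\alpha>2$, $\beta>0$, $\lambda>0$, $0<p<1$. Consider a slotted-Aloha network of node density $\lambda$ and transmission probability $p$ in the plane, seen from a typical emitter $X_o$ at the origin whose final destination lies in the direction of a fixed vector $d\neq 0$. The other emitters $\Phi_t=\{X_i\}$ and the receivers $\Phi_r=\{Y_k\}$ form independent homogeneous Poisson point processes of densities $\lambda p$ and $\lambda(1-p)$. All channel vectors $\mathbf h_{ok},\mathbf h_{ik}\in\mathbb C^L$ (from $X_o$, resp. $X_i$, to $Y_k$) are independent standard complex normal vectors, independent of the positions. Noise is neglected, and with optimum combining the signal-to-interference ratio at $Y_k$ is $$\mathrm{SIR}_k=|Y_k|^{-\alpha}\,\mathbf h_{ok}^{*}\mathbf R_k^{-1}\mathbf h_{ok},\qquad \mathbf R_k=\sum_i |X_i-Y_k|^{-\alpha}\,\mathbf h_{ik}\mathbf h_{ik}^{*}.$$ Let $\mathcal D=\{Y_k:\mathrm{SIR}_k\ge\beta\}\cup\{X_o\}$ be the set of feasible receivers, let the progress of a point $y$ be $|y|\cos\theta_y$, where $\theta_y$ is the angle between $y$ and $d$, and let the MSR-Aloha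 relay $Y^*$ be an element of $\mathcal D$ of maximal progress. Almost surely such an element exists, and the mean progress $\mathrm{prog}_{MSR}(\lambda,p)=\mathrm E\big[|Y^*|\cos\theta_{Y^*}\big]$ is finite and satisfies $$\mathrm{prog}_{MSR}(\lambda,p)\le\frac{1}{\beta^{1/\alpha}\sqrt{\lambda p\Delta}}\,H(p,L,\beta),\qquad \Delta=\frac{2\pi}{\alpha}\Gamma(2/\alpha)\Gamma(1-2/\alpha),$$ where the function $$H(p,L,\beta)=\int_0^\infty\Big[1-\exp\Big(-\frac{1-p}{p}\,\frac{F(z)}{\beta^{2/\alpha}\Delta}\Big)\Big]dz$$ is given by a convergent integral and does not depend on $\lambda$, with $$F(z)=\sum_{i=0}^{L-1}\sum_{k=0}^{i}\frac{\Gamma(\tfrac12+k)\,\Gamma_{inc}(\tfrac12+i-k,z^2)}{2\,k!\,(i-k)!},\qquad \Gamma_{inc}(s,z)=\int_z^\infty t^{s-1}e^{-t}\,dt.$$ Moreover, the spatial density of progress $\lambda p\,\mathrm{prog}_{MSR}$ scales as $\sqrt\lambda$: for every $\lambda'>0$, multiplying all positions by $\sqrt{\lambda/\lambda'}$ turns the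 network into such a network of density $\lambda'$ (with the same $p$), and its spatial density of progress is $\sqrt{\lambda'/\lambda}$ times that of the original network. -/

import Mathlib

open MeasureTheory ProbabilityTheory

namespace MSRAloha

noncomputable section

/-- The Euclidean plane in which the nodes live. -/
abbrev Plane : Type := EuclideanSpace ℝ (Fin 2)

/-- The number of points of the configuration `x` that lie in `A` (counted with multiplicity). -/
def pointCount (x : ℕ → Plane) (A : Set Plane) : ENNReal :=
  Measure.sum (fun i => Measure.dirac (x i)) A

/-- The random points `X 0, X 1, …` enumerate a homogeneous Poisson point process of density `ρ`
(points per unit area): the number of points in a Borel set of finite area is Poisson distributed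
with mean `ρ` times the area, and the numbers of points in disjoint Borel sets are independent. -/
structure IsPoissonProcess {Ω : Type*} [MeasurableSpace Ω] (P : Measure Ω) (ρ : ℝ)
    (X : ℕ → Ω → Plane) : Prop where
  measurable : ∀ i, Measurable (X i)
  count_law : ∀ A : Set Plane, MeasurableSet A → volume A < ⊤ →
    HasLaw (fun ω => pointCount (fun i => X i ω) A)
      ((poissonMeasure (ρ * (volume A).toReal).toNNReal).map (fun n : ℕ => (n : ENNReal))) P
  count_indep : ∀ (n : ℕ) (A : Fin n → Set Plane), (∀ j, MeasurableSet (A j)) →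
    Pairwise (fun j l => Disjoint (A j) (A l)) →
    iIndepFun (fun (j : Fin n) (ω : Ω) => pointCount (fun i => X i ω) (A j)) P

/-- The standard complex normal law `CN(0, 1)`: independent real and imaginary parts,
each centred with variance `1 / 2`. -/
def complexNormal : Measure ℂ :=
  ((gaussianReal 0 (1 / 2)).prod (gaussianReal 0 (1 / 2))).map
    (fun q : ℝ × ℝ => (⟨q.1, q.2⟩ : ℂ))

/-- The standard complex normal law `CN(0, I_L)` on `ℂ^L`. -/
def complexNormalVec (L : ℕ) : Measure (Fin L → ℂ) :=
  Measure.pi (fun _ => complexNormal)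

/-- The slotted Aloha network of node density `lam` and transmission probability `p`, seen from a
typical emitter located at the origin. `X i` are the positions of the other emitters, `Y k` those
of the receivers, `h none k` is the channel vector from the typical emitter to `Y k`, and
`h (some i) k` the one from `X i` to `Y k`. -/
structure IsNetwork {Ω : Type*} [MeasurableSpace Ω] (P : Measure Ω) (lam p : ℝ) (L : ℕ)
    (X Y : ℕ → Ω → Plane) (h : Option ℕ → ℕ → Ω → Fin L → ℂ) : Prop where
  emitters : IsPoissonProcess P (lam * p) X
  receivers : IsPoissonProcess P (lam * (1 - p)) Y
  fading_law : ∀ i k, HasLaw (h i k) (complexNormalVec L) P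
  fading_indep : iIndepFun (fun (j : Option ℕ × ℕ) (ω : Ω) => h j.1 j.2 ω) P
  emitters_indep_receivers :
    IndepFun (fun (ω : Ω) (i : ℕ) => X i ω) (fun (ω : Ω) (k : ℕ) => Y k ω) P
  nodes_indep_fading :
    IndepFun (fun ω : Ω => ((fun i : ℕ => X i ω), (fun k : ℕ => Y k ω)))
      (fun (ω : Ω) (j : Option ℕ × ℕ) => h j.1 j.2 ω) P

/-- The interference covariance matrix `∑ᵢ |xᵢ - y|^{-α} gᵢ gᵢᴴ` at a receiver located at `y`,
for emitters at `xᵢ` with channel vectors `gᵢ`. -/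
def interferenceCov {L : ℕ} (α : ℝ) (x : ℕ → Plane) (g : ℕ → Fin L → ℂ) (y : Plane) :
    Matrix (Fin L) (Fin L) ℂ :=
  ∑' i, (‖x i - y‖ ^ (-α) : ℝ) • Matrix.vecMulVec (g i) (star (g i))

/-- The signal-to-interference ratio, after optimum combining, at a receiver located at `y` for
the packet of the emitter at the origin: `|y|^{-α} g₀ᴴ R⁻¹ g₀`. -/
def sir {L : ℕ} (α : ℝ) (x : ℕ → Plane) (g₀ : Fin L → ℂ) (g : ℕ → Fin L → ℂ) (y : Plane) : ℝ :=
  ‖y‖ ^ (-α) * (star g₀ ⬝ᵥ ((interferenceCov α x g y)⁻¹).mulVec g₀).re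

/-- The set of feasible receivers of the typical emitter: the receivers whose
signal-to-interference ratio is at least `β`, together with the emitter itself.
The arguments are a realization of the positions and of the channel vectors. -/
def feasible {L : ℕ} (α β : ℝ) (x y : ℕ → Plane) (h : Option ℕ → ℕ → Fin L → ℂ) : Set Plane :=
  {v | ∃ k, β ≤ sir α x (h none k) (fun i => h (some i) k) (y k) ∧ v = y k} ∪ {0}

/-- The projected progress `cos θ · |v|` of a hop from the origin to `v`, where `θ` is the angle
between `v` and the direction `d` of the final destination. -/
def progress (d v : Plane) : ℝ :=
  Real.cos (InnerProductGeometry.angle d v) * ‖v‖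

/-- `v` is a relay selected by the MSR-Aloha rule: a feasible receiver of maximal progress. -/
def IsRelay {L : ℕ} (α β : ℝ) (d : Plane) (x y : ℕ → Plane) (h : Option ℕ → ℕ → Fin L → ℂ)
    (v : Plane) : Prop :=
  v ∈ feasible α β x y h ∧ ∀ w ∈ feasible α β x y h, progress d w ≤ progress d v

/-- `V` is the (random) relay selected by the typical emitter under MSR-Aloha. -/
def IsRandomRelay {Ω : Type*} [MeasurableSpace Ω] (P : Measure Ω) {L : ℕ} (α β : ℝ) (d : Plane)
    (X Y : ℕ → Ω → Plane) (h : Option ℕ → ℕ → Ω → Fin L → ℂ) (V : Ω → Plane) : Prop :=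
  ∀ᵐ ω ∂P, IsRelay α β d (fun i => X i ω) (fun k => Y k ω) (fun i k => h i k ω) (V ω)

/-- The mean progress of a random relay. -/
def meanProgress {Ω : Type*} [MeasurableSpace Ω] (P : Measure Ω) (d : Plane) (V : Ω → Plane) : ℝ :=
  ∫ ω, progress d (V ω) ∂P

/-- `Δ = (2π/α) Γ(2/α) Γ(1 - 2/α)`. -/
def Delta (α : ℝ) : ℝ :=
  2 * Real.pi / α * Real.Gamma (2 / α) * Real.Gamma (1 - 2 / α)

/-- The (upper) incomplete Gamma function `∫_z^∞ t^{s-1} e^{-t} dt`. -/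
def GammaInc (s z : ℝ) : ℝ :=
  ∫ t in Set.Ioi z, t ^ (s - 1) * Real.exp (-t)

/-- `F(z) = ∑_{i<L} ∑_{k≤i} Γ(1/2+k) Γ_inc(1/2+i-k, z²) / (2 k! (i-k)!)`. -/
def F (L : ℕ) (z : ℝ) : ℝ :=
  ∑ i ∈ Finset.range L, ∑ k ∈ Finset.range (i + 1),
    Real.Gamma (1 / 2 + (k : ℝ)) * GammaInc (1 / 2 + (i : ℝ) - (k : ℝ)) (z ^ 2)
      / (2 * (k.factorial : ℝ) * ((i - k).factorial : ℝ))

/-- The integrand of `H`. -/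
def HIntegrand (α β p : ℝ) (L : ℕ) (z : ℝ) : ℝ :=
  1 - Real.exp (-((1 - p) / p * (F L z / (β ^ (2 / α) * Delta α))))

/-- `H(p, L, β) = ∫_0^∞ (1 - exp(-((1-p)/p) F(z) / (β^{2/α} Δ))) dz`. -/
def H (α β p : ℝ) (L : ℕ) : ℝ :=
  ∫ z in Set.Ioi (0 : ℝ), HIntegrand α β p L z

end

end MSRAloha

open MeasureTheory ProbabilityTheory

namespace MSRAloha

open scoped ENNReal

/-! ### The standard complex normal law -/

/-! Fix a location `y ≠ 0` and put `κ = β |y|^α`. Given the emitters, set `p_i = |X_i - y|^{-α}`.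
The central fact is that, averaged over the fading, a receiver at `y` decodes with probability at
most that of fewer than `L` successes in independent trials with success probabilities `p_i κ / (1 +
p_i κ)`.

For finitely many interferers, substituting `g = R^{1/2} k` turns the tail of `g* R⁻¹ g` into the
integral of `π^{-L} det R exp(-k* R k)` over `|k|² ≥ s` (`complexNormalVec_quadForm_tail`). Unitary
invariance rotates `k` onto a coordinate axis. The expected determinant is then computed one
interferer at a time by rank one updates: the exponentially tilted expected principal minors obey
the same recursion as the Poisson binomial probabilities and their `κ`-derivative
(`tiltedMinor_of_mem_range`). Radial integration over `|k|² ≥ s` integrates that derivative back to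
the distribution function, and Fatou's lemma passes to infinitely many interferers
(`successProb_le_trialsCDF`).

Averaging over the Poisson emitters makes the number of successes Poisson with mean `λ p ∫ wκ / (1 +
wκ)`, where `w` is the path loss seen from `y`. This mean is `q² |y|²` with `q = β^{1/α} √(λ p Δ)`
(`IsPoissonProcess.lintegral_trialsMass`, `lintegral_pathLoss_div_one_add`). Expanding `|y|^{2i}` by
the binomial theorem, the integral of its distribution function over the half plane of progress
above `z` is `F(qz) / q²` (`setLIntegral_progress`).

Given the emitters, the receivers that decode form an independent thinning of a Poisson process.
Hence the probability that none lies in the half plane is the mean of `exp(-λ(1-p) ∫ successProb)`,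
and Jensen's inequality bounds it below by the exponential of the mean. So the maximal progress
exceeds `z` with probability at most the integrand of `H` at `qz`, and integration over `z` gives `H
/ q`. Campbell's formula makes the expected number of decoding receivers with positive progress
finite, so a maximizer exists almost surely. The scaling law holds because, without noise, a
dilation multiplies signal and interference by the same factor. -/

/-- The density of the standard complex normal law. -/
noncomputable def complexNormalPDF (z : ℂ) : ℝ := Real.pi⁻¹ * Real.exp (-‖z‖ ^ 2)

lemma measurable_complexNormalPDF : Measurable complexNormalPDF := by
  unfold complexNormalPDF; fun_prop

lemma complexNormalPDF_nonneg (z : ℂ) : 0 ≤ complexNormalPDF z := by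
  unfold complexNormalPDF; positivity

lemma complexNormal_eq_withDensity :
    complexNormal = volume.withDensity (fun z => ENNReal.ofReal (complexNormalPDF z)) := by
  have hv : (1 / 2 : NNReal) ≠ 0 := by norm_num
  have hpdf : ∀ q : ℝ × ℝ, gaussianPDF 0 (1 / 2) q.1 * gaussianPDF 0 (1 / 2) q.2 =
      ENNReal.ofReal (complexNormalPDF ⟨q.1, q.2⟩) := by
    intro q
    rw [gaussianPDF, gaussianPDF, ← ENNReal.ofReal_mul (gaussianPDFReal_nonneg _ _ _)]
    congr 1
    have h2 : ‖(⟨q.1, q.2⟩ : ℂ)‖ ^ 2 = q.1 ^ 2 + q.2 ^ 2 := by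
      rw [Complex.sq_norm, Complex.normSq_mk]; ring
    rw [gaussianPDFReal, gaussianPDFReal, complexNormalPDF, h2]
    have h3 : (2 * Real.pi * ((1 / 2 : NNReal) : ℝ)) = Real.pi := by push_cast; ring
    have h4 : (√Real.pi)⁻¹ * (√Real.pi)⁻¹ = Real.pi⁻¹ := by
      rw [← mul_inv, Real.mul_self_sqrt Real.pi_pos.le]
    rw [h3, mul_mul_mul_comm, h4, ← Real.exp_add]
    congr 2
    push_cast
    ring
  have hm : Measurable (fun z => ENNReal.ofReal (complexNormalPDF z)) :=
    measurable_complexNormalPDF.ennreal_ofReal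
  have hmk : (fun q : ℝ × ℝ => (⟨q.1, q.2⟩ : ℂ)) = Complex.measurableEquivRealProd.symm := rfl
  rw [complexNormal, gaussianReal_of_var_ne_zero _ hv, prod_withDensity (measurable_gaussianPDF _ _)
    (measurable_gaussianPDF _ _)]
  simp_rw [hpdf]
  ext s hs
  have hmp := Complex.volume_preserving_equiv_real_prod.symm
  rw [hmk, Measure.map_apply (by fun_prop) hs, withDensity_apply _ hs,
    withDensity_apply _ (hs.preimage (by fun_prop)), ← Measure.volume_eq_prod]
  exact hmp.setLIntegral_comp_preimage hs hm

instance : IsProbabilityMeasure complexNormal := by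
  unfold complexNormal
  exact Measure.isProbabilityMeasure_map
    (Complex.measurableEquivRealProd.symm.measurable.aemeasurable)

instance (L : ℕ) : IsProbabilityMeasure (complexNormalVec L) := by
  unfold complexNormalVec; infer_instance

lemma integral_complexNormal {E : Type*} [NormedAddCommGroup E] [NormedSpace ℝ E] (f : ℂ → E) :
    ∫ z, f z ∂complexNormal = ∫ z, complexNormalPDF z • f z := by
  rw [complexNormal_eq_withDensity, integral_withDensity_eq_integral_toReal_smul
    measurable_complexNormalPDF.ennreal_ofReal (by simp)]
  simp [ENNReal.toReal_ofReal (complexNormalPDF_nonneg _)]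

lemma integrable_complexNormal_iff {E : Type*} [NormedAddCommGroup E] [NormedSpace ℝ E]
    (f : ℂ → E) :
    Integrable f complexNormal ↔ Integrable (fun z => complexNormalPDF z • f z) := by
  rw [complexNormal_eq_withDensity, integrable_withDensity_iff_integrable_smul'
    measurable_complexNormalPDF.ennreal_ofReal (by simp)]
  simp [ENNReal.toReal_ofReal (complexNormalPDF_nonneg _)]

lemma integral_exp_neg_complexNormal {a : ℝ} (ha : 0 ≤ a) :
    ∫ z, Real.exp (-a * ‖z‖ ^ 2) ∂complexNormal = (1 + a)⁻¹ := by
  have h := Complex.integral_exp_neg_mul_rpow (p := 2) (b := 1 + a) (by norm_num) (by positivity)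
  simp only [Real.rpow_two] at h
  rw [integral_complexNormal]
  simp only [complexNormalPDF, smul_eq_mul, mul_assoc, ← Real.exp_add]
  rw [integral_const_mul]
  have : ∀ z : ℂ, -‖z‖ ^ 2 + -a * ‖z‖ ^ 2 = -(1 + a) * ‖z‖ ^ 2 := fun z => by ring
  simp_rw [this, h]
  rw [show (-(2:ℝ) / 2) = -1 by norm_num, show (2:ℝ)/2 + 1 = 2 by norm_num, Real.Gamma_two,
    Real.rpow_neg_one]
  field_simp

lemma integral_sq_exp_neg_complexNormal {a : ℝ} (ha : 0 ≤ a) :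
    ∫ z, ‖z‖ ^ 2 * Real.exp (-a * ‖z‖ ^ 2) ∂complexNormal = (1 + a)⁻¹ * (1 + a)⁻¹ := by
  have h := Complex.integral_rpow_mul_exp_neg_mul_rpow (p := 2) (q := 2) (b := 1 + a)
    (by norm_num) (by norm_num) (by positivity)
  simp only [Real.rpow_two] at h
  rw [integral_complexNormal]
  have : ∀ z : ℂ, complexNormalPDF z • (‖z‖ ^ 2 * Real.exp (-a * ‖z‖ ^ 2)) =
      Real.pi⁻¹ * (‖z‖ ^ 2 * Real.exp (-(1 + a) * ‖z‖ ^ 2)) := fun z => by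
    rw [show -(1 + a) * ‖z‖ ^ 2 = -‖z‖ ^ 2 + -a * ‖z‖ ^ 2 by ring, Real.exp_add,
      complexNormalPDF, smul_eq_mul]
    ring
  simp_rw [this, integral_const_mul, h]
  rw [show (-((2:ℝ) + 2) / 2) = -(2 : ℕ) by norm_num, show ((2:ℝ) + 2) / 2 = 2 by norm_num,
    Real.Gamma_two, Real.rpow_neg (by positivity), Real.rpow_natCast]
  field_simp

lemma integrable_sq_norm_complexNormal : Integrable (fun z : ℂ => ‖z‖ ^ 2) complexNormal := by
  -- The Bochner integral of a non-integrable function is 0, whereas the second moment, the case `a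
  -- = 0` above, is 1.
  by_contra h
  have h1 := integral_undef h
  have h2 := integral_sq_exp_neg_complexNormal le_rfl
  simp at h2
  rw [h2] at h1
  norm_num at h1

lemma integral_odd_complexNormal {f : ℂ → ℂ} (hf : ∀ z, f (-z) = -f z) :
    ∫ z, f z ∂complexNormal = 0 := by
  rw [integral_complexNormal, ← self_eq_neg, ← integral_neg,
    ← integral_neg_eq_self (fun z => complexNormalPDF z • f z)]
  simp [hf, complexNormalPDF]

/-- The density of the standard complex normal law on `ℂ^L`. -/
noncomputable def complexNormalVecPDF (L : ℕ) (k : Fin L → ℂ) : ℝ :=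
  Real.pi⁻¹ ^ L * Real.exp (-∑ i, ‖k i‖ ^ 2)

lemma measurable_complexNormalVecPDF (L : ℕ) : Measurable (complexNormalVecPDF L) := by
  unfold complexNormalVecPDF; fun_prop

lemma complexNormalVecPDF_eq_prod (L : ℕ) (k : Fin L → ℂ) :
    complexNormalVecPDF L k = ∏ i, complexNormalPDF (k i) := by
  simp [complexNormalVecPDF, complexNormalPDF, Finset.prod_mul_distrib, ← Real.exp_sum]

lemma complexNormalVec_eq_withDensity (L : ℕ) :
    complexNormalVec L = volume.withDensity
      (fun k => ENNReal.ofReal (complexNormalVecPDF L k)) := by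
  symm
  rw [complexNormalVec]
  refine (Measure.pi_eq fun s hs => ?_).symm
  have hint : Integrable complexNormalPDF := by
    have := (integrable_complexNormal_iff (fun _ => (1 : ℝ))).1 (integrable_const _)
    simpa using this
  have hi : ∀ i, Integrable ((s i).indicator complexNormalPDF) := fun i => hint.indicator (hs i)
  have hprod := integral_fintype_prod_volume_eq_prod (fun i => (s i).indicator complexNormalPDF)
  have hind : ∀ x : Fin L → ℂ, (Set.univ.pi s).indicator
      (fun k => ENNReal.ofReal (complexNormalVecPDF L k)) x =
      ENNReal.ofReal (∏ i, (s i).indicator complexNormalPDF (x i)) := by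
    intro x
    by_cases hx : x ∈ Set.univ.pi s
    · rw [Set.indicator_of_mem hx, complexNormalVecPDF_eq_prod]
      congr 1
      exact Finset.prod_congr rfl fun i _ => (Set.indicator_of_mem (hx i (Set.mem_univ i)) _).symm
    · rw [Set.indicator_of_notMem hx]
      obtain ⟨i, hi⟩ : ∃ i, x i ∉ s i := by simpa [Set.mem_pi] using hx
      rw [Finset.prod_eq_zero (Finset.mem_univ i) (Set.indicator_of_notMem hi _), ENNReal.ofReal_zero]
  have hnn : ∀ i z, 0 ≤ (s i).indicator complexNormalPDF z := fun i z =>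
    Set.indicator_nonneg (fun z _ => complexNormalPDF_nonneg z) z
  rw [withDensity_apply _ (MeasurableSet.univ_pi hs), ← lintegral_indicator (MeasurableSet.univ_pi hs)]
  simp_rw [hind]
  rw [← ofReal_integral_eq_lintegral_ofReal, hprod, ENNReal.ofReal_prod_of_nonneg]
  · refine Finset.prod_congr rfl fun i _ => ?_
    rw [complexNormal_eq_withDensity, withDensity_apply _ (hs i),
      ← ofReal_integral_eq_lintegral_ofReal hint.restrict (ae_of_all _ complexNormalPDF_nonneg),
      integral_indicator (hs i)]
  · exact fun i _ => integral_nonneg (hnn i)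
  · exact Integrable.fintype_prod hi
  · exact ae_of_all _ fun x => Finset.prod_nonneg fun i _ => hnn i _

lemma lintegral_complexNormalVec (L : ℕ) {f : (Fin L → ℂ) → ℝ≥0∞} (hf : Measurable f) :
    ∫⁻ k, f k ∂complexNormalVec L = ∫⁻ k, ENNReal.ofReal (complexNormalVecPDF L k) * f k := by
  rw [complexNormalVec_eq_withDensity, lintegral_withDensity_eq_lintegral_mul _
    (measurable_complexNormalVecPDF L).ennreal_ofReal hf]
  rfl

/-- Second moments of a standard complex normal vector, tilted along one coordinate. -/
lemma integral_mul_star_exp_complexNormalVec {L : ℕ} {a : ℝ} (ha : 0 ≤ a) (o i j : Fin L) :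
    ∫ g, g i * star (g j) * (Real.exp (-a * ‖g o‖ ^ 2) : ℂ) ∂complexNormalVec L =
      if i = j then ((1 + a)⁻¹ * (if i = o then (1 + a)⁻¹ else 1) : ℝ) else 0 := by
  have hprod : ∀ g : Fin L → ℂ, g i * star (g j) * (Real.exp (-a * ‖g o‖ ^ 2) : ℂ) =
      ∏ l, ((if l = i then g l else 1) * (if l = j then star (g l) else 1) *
        (if l = o then (Real.exp (-a * ‖g l‖ ^ 2) : ℂ) else 1)) := by
    intro g
    simp only [Finset.prod_mul_distrib, Finset.prod_ite_eq', Finset.mem_univ, if_true]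
  simp_rw [hprod]
  have key := integral_fintype_prod_eq_prod (μ := fun _ : Fin L => complexNormal) (𝕜 := ℂ)
    (fun l z => (if l = i then z else 1) * (if l = j then star z else 1) *
        (if l = o then (Real.exp (-a * ‖z‖ ^ 2) : ℂ) else 1))
  rw [complexNormalVec, key]
  split_ifs with hij hio
  · subst hij hio
    rw [Finset.prod_eq_single i]
    · have : ∀ z : ℂ, z * star z * (Real.exp (-a * ‖z‖ ^ 2) : ℂ) =
          ((‖z‖ ^ 2 * Real.exp (-a * ‖z‖ ^ 2) : ℝ) : ℂ) := fun z => by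
        rw [RCLike.star_def, Complex.mul_conj']; push_cast; ring
      simp only [if_true, this]
      rw [integral_complex_ofReal, integral_sq_exp_neg_complexNormal ha]
    · intro l _ hl
      simp [hl]
    · simp
  · subst hij
    have h1 : ∫ z, z * star z ∂complexNormal = 1 := by
      have h2 := integral_sq_exp_neg_complexNormal le_rfl
      have : ∀ z : ℂ, z * star z = ((‖z‖ ^ 2 * Real.exp (-0 * ‖z‖ ^ 2) : ℝ) : ℂ) := fun z => by
        rw [RCLike.star_def, Complex.mul_conj']; simp
      simp only [this]
      rw [integral_complex_ofReal, h2]; simp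
    rw [← Finset.mul_prod_erase _ _ (Finset.mem_univ o), Finset.prod_eq_one]
    · simp only [Ne.symm hio, if_false, if_true, one_mul, mul_one]
      rw [integral_complex_ofReal, integral_exp_neg_complexNormal ha]
    · intro l hl
      have hlo : l ≠ o := (Finset.mem_erase.1 hl).1
      by_cases hli : l = i
      · simp only [hli, if_true, hio, if_false, mul_one]; exact h1
      · simp [hli, hlo]
  -- For `i ≠ j` the factor at coordinate `i` is odd: the tilt, if it sits there, depends on the
  -- modulus only.
  · refine Finset.prod_eq_zero (Finset.mem_univ i) ?_
    refine integral_odd_complexNormal fun z => ?_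
    simp only [hij, if_true, if_false, norm_neg]
    split_ifs <;> ring

lemma integrable_mul_star_exp_complexNormalVec {L : ℕ} {a : ℝ} (ha : 0 ≤ a) (o i j : Fin L) :
    Integrable (fun g : Fin L → ℂ => g i * star (g j) * (Real.exp (-a * ‖g o‖ ^ 2) : ℂ))
      (complexNormalVec L) := by
  have hsq : ∀ l : Fin L, Integrable (fun g : Fin L → ℂ => ‖g l‖ ^ 2) (complexNormalVec L) :=
    fun l => (measurePreserving_eval (fun _ : Fin L => complexNormal) l).integrable_comp_of_integrable
      integrable_sq_norm_complexNormal
  refine ((hsq i).add (hsq j)).mono (by fun_prop) (ae_of_all _ fun g => ?_)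
  have h1 : ‖(Real.exp (-a * ‖g o‖ ^ 2) : ℂ)‖ ≤ 1 := by
    rw [Complex.norm_real, Real.norm_eq_abs, Real.abs_exp, Real.exp_le_one_iff]
    nlinarith [sq_nonneg ‖g o‖]
  rw [norm_mul, norm_mul, norm_star]
  simp only [Pi.add_apply]
  rw [Real.norm_of_nonneg (by positivity)]
  calc _ ≤ ‖g i‖ * ‖g j‖ * 1 := by gcongr
    _ ≤ _ := by nlinarith [sq_nonneg (‖g i‖ - ‖g j‖), sq_nonneg ‖g i‖, sq_nonneg ‖g j‖]

lemma integral_exp_complexNormalVec {L : ℕ} {a : ℝ} (ha : 0 ≤ a) (o : Fin L) :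
    ∫ g, Real.exp (-a * ‖g o‖ ^ 2) ∂complexNormalVec L = (1 + a)⁻¹ := by
  rw [← integral_exp_neg_complexNormal ha]
  exact integral_comp_eval (μ := fun _ : Fin L => complexNormal) (i := o)
    (f := fun z => Real.exp (-a * ‖z‖ ^ 2))
    (Continuous.aestronglyMeasurable (by fun_prop))

lemma integrable_exp_complexNormalVec {L : ℕ} {a : ℝ} (ha : 0 ≤ a) (o : Fin L) :
    Integrable (fun g : Fin L → ℂ => Real.exp (-a * ‖g o‖ ^ 2)) (complexNormalVec L) := by
  refine (integrable_const (1 : ℝ)).mono (Continuous.aestronglyMeasurable (by fun_prop))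
    (ae_of_all _ fun g => ?_)
  rw [Real.norm_eq_abs, Real.abs_exp, norm_one, Real.exp_le_one_iff]
  nlinarith [sq_nonneg ‖g o‖]

/-- The Jacobian is squared because a complex matrix acting on the underlying real space has
determinant `|det U|²`. -/
lemma map_mulVec_volume {L : ℕ} (U : Matrix (Fin L) (Fin L) ℂ) (hU : U.det ≠ 0) :
    Measure.map (fun g : Fin L → ℂ => U.mulVec g) volume =
      ENNReal.ofReal ((‖U.det‖ ^ 2)⁻¹) • volume := by
  have hdet : LinearMap.det ((Matrix.toLin' U).restrictScalars ℝ) = ‖U.det‖ ^ 2 := by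
    rw [LinearMap.det_restrictScalars, LinearMap.det_toLin', Algebra.norm_complex_apply,
      Complex.normSq_eq_norm_sq]
  have h := Measure.map_linearMap_addHaar_eq_smul_addHaar (volume : Measure (Fin L → ℂ))
    (f := (Matrix.toLin' U).restrictScalars ℝ) (by rw [hdet]; positivity)
  rw [hdet, abs_of_nonneg (by positivity)] at h
  exact h

lemma star_dotProduct_self_eq {L : ℕ} (k : Fin L → ℂ) :
    star k ⬝ᵥ k = ((∑ i, ‖k i‖ ^ 2 : ℝ) : ℂ) := by
  simp [dotProduct, Complex.conj_mul']

lemma sum_sq_norm_mulVec_unitary {L : ℕ} {U : Matrix (Fin L) (Fin L) ℂ}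
    (hU : U ∈ Matrix.unitaryGroup (Fin L) ℂ) (k : Fin L → ℂ) :
    ∑ i, ‖U.mulVec k i‖ ^ 2 = ∑ i, ‖k i‖ ^ 2 := by
  have h : star (U.mulVec k) ⬝ᵥ (U.mulVec k) = star k ⬝ᵥ k := by
    rw [Matrix.star_mulVec, Matrix.dotProduct_mulVec, Matrix.vecMul_vecMul,
      ← Matrix.star_eq_conjTranspose, Matrix.mem_unitaryGroup_iff'.1 hU, Matrix.vecMul_one]
  rw [star_dotProduct_self_eq, star_dotProduct_self_eq] at h
  exact_mod_cast h

lemma continuous_mulVec_const {L : ℕ} (U : Matrix (Fin L) (Fin L) ℂ) :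
    Continuous (fun g : Fin L → ℂ => U.mulVec g) :=
  Continuous.matrix_mulVec continuous_const continuous_id

/-- The standard complex normal law is invariant under unitary maps. -/
lemma measurePreserving_mulVec_complexNormalVec {L : ℕ} {U : Matrix (Fin L) (Fin L) ℂ}
    (hU : U ∈ Matrix.unitaryGroup (Fin L) ℂ) :
    MeasurePreserving (fun g : Fin L → ℂ => U.mulVec g) (complexNormalVec L)
      (complexNormalVec L) := by
  have hm : Measurable (fun g : Fin L → ℂ => U.mulVec g) := (continuous_mulVec_const U).measurable
  refine ⟨hm, ?_⟩
  have hdet : ‖U.det‖ = 1 := CStarRing.norm_of_mem_unitary (Matrix.det_of_mem_unitary hU)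
  have hvol := map_mulVec_volume U (by rw [← norm_ne_zero_iff, hdet]; exact one_ne_zero)
  rw [hdet] at hvol
  simp only [one_pow, inv_one, ENNReal.ofReal_one, one_smul] at hvol
  ext s hs
  rw [Measure.map_apply hm hs, ← lintegral_indicator_one (hs.preimage hm),
    ← lintegral_indicator_one hs, lintegral_complexNormalVec _ (measurable_one.indicator (hs.preimage hm)),
    lintegral_complexNormalVec _ (measurable_one.indicator hs)]
  conv_rhs => rw [← hvol]
  rw [lintegral_map (f := fun k => ENNReal.ofReal (complexNormalVecPDF L k) * s.indicator 1 k)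
    ((measurable_complexNormalVecPDF L).ennreal_ofReal.mul (measurable_one.indicator hs)) hm]
  refine lintegral_congr fun k => ?_
  simp only [complexNormalVecPDF, sum_sq_norm_mulVec_unitary hU]
  rfl

open scoped ComplexOrder

/-! ### Quadratic forms of complex normal vectors -/

lemma sum_sq_norm_mulVec_of_isHermitian {L : ℕ} {S : Matrix (Fin L) (Fin L) ℂ}
    (hS : S.IsHermitian) (k : Fin L → ℂ) :
    ∑ i, ‖S.mulVec k i‖ ^ 2 = (star k ⬝ᵥ (S * S).mulVec k).re := by
  have h : star (S.mulVec k) ⬝ᵥ (S.mulVec k) = star k ⬝ᵥ (S * S).mulVec k := by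
    rw [Matrix.star_mulVec, hS.eq, ← Matrix.dotProduct_mulVec, Matrix.mulVec_mulVec]
  rw [← h, star_dotProduct_self_eq, Complex.ofReal_re]

open scoped MatrixOrder in
lemma exists_posSemidef_mul_self {L : ℕ} {R : Matrix (Fin L) (Fin L) ℂ} (hR : R.PosSemidef) :
    ∃ S : Matrix (Fin L) (Fin L) ℂ, S.IsHermitian ∧ S * S = R :=
  ⟨CFC.sqrt R, (Matrix.nonneg_iff_posSemidef.1 (CFC.sqrt_nonneg R)).isHermitian, CFC.sqrt_mul_sqrt_self R hR.nonneg⟩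

/-- The tail of the quadratic form `gᴴ R⁻¹ g` of a standard complex normal vector `g`. -/
lemma complexNormalVec_quadForm_tail {L : ℕ} {R : Matrix (Fin L) (Fin L) ℂ} (hR : R.PosSemidef)
    {s : ℝ} (hs : 0 < s) :
    complexNormalVec L {g | s ≤ (star g ⬝ᵥ (R⁻¹).mulVec g).re} =
      ∫⁻ k in {k : Fin L → ℂ | s ≤ ∑ i, ‖k i‖ ^ 2}, ENNReal.ofReal (Real.pi⁻¹ ^ L) *
        ENNReal.ofReal (R.det.re * Real.exp (-(star k ⬝ᵥ R.mulVec k).re)) := by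
  -- In the singular case both sides vanish: `R⁻¹` is 0 by convention, so the quadratic form cannot
  -- reach `s > 0`, and the density carries the factor `det R`.
  by_cases hdet : R.det = 0
  · have hinv : R⁻¹ = 0 := by
      rw [Matrix.inv_def, hdet]; simp
    simp [hdet, hinv, not_le.2 hs]
  obtain ⟨S, hS, hSR⟩ := exists_posSemidef_mul_self hR
  have hSdet : S.det ≠ 0 := by
    intro h; apply hdet; rw [← hSR, Matrix.det_mul, h, zero_mul]
  have hunit : IsUnit S.det := isUnit_iff_ne_zero.2 hSdet
  have hnorm : ‖S.det‖ ^ 2 = R.det.re := by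
    have h0 : 0 ≤ R.det := hR.det_nonneg
    have h1 : ‖R.det‖ = R.det.re := by
      obtain ⟨h2, h3⟩ := Complex.nonneg_iff.1 h0
      rw [← Complex.re_add_im R.det, ← h3]
      simp [abs_of_nonneg h2]
    rw [← h1, ← hSR, Matrix.det_mul, norm_mul, sq]
  have hpos : 0 < ‖S.det‖ ^ 2 := by positivity
  have hvol := map_mulVec_volume S hSdet
  have hvol' : (volume : Measure (Fin L → ℂ)) = ENNReal.ofReal (‖S.det‖ ^ 2) •
      Measure.map (fun g : Fin L → ℂ => S.mulVec g) volume := by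
    rw [hvol, smul_smul, ← ENNReal.ofReal_mul hpos.le, mul_inv_cancel₀ hpos.ne',
      ENNReal.ofReal_one, one_smul]
  set A : Set (Fin L → ℂ) := {g | s ≤ (star g ⬝ᵥ (R⁻¹).mulVec g).re} with hAdef
  have hcont : ∀ M : Matrix (Fin L) (Fin L) ℂ, Continuous fun g : Fin L → ℂ =>
      (star g ⬝ᵥ M.mulVec g).re := fun M =>
    Complex.continuous_re.comp ((continuous_star).dotProduct (continuous_mulVec_const M))
  have hA : MeasurableSet A := measurableSet_le measurable_const (hcont _).measurable
  have hB : MeasurableSet {k : Fin L → ℂ | s ≤ ∑ i, ‖k i‖ ^ 2} :=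
    measurableSet_le measurable_const (by fun_prop)
  have hmem : ∀ k : Fin L → ℂ, S.mulVec k ∈ A ↔ k ∈ {k : Fin L → ℂ | s ≤ ∑ i, ‖k i‖ ^ 2} := by
    intro k
    have h1 : star (S.mulVec k) ⬝ᵥ (R⁻¹).mulVec (S.mulVec k) = star k ⬝ᵥ k := by
      rw [Matrix.star_mulVec, hS.eq, ← Matrix.dotProduct_mulVec, Matrix.mulVec_mulVec,
        Matrix.mulVec_mulVec, ← hSR, Matrix.mul_inv_rev, ← mul_assoc,
        Matrix.mul_nonsing_inv _ hunit, one_mul, Matrix.nonsing_inv_mul _ hunit, Matrix.one_mulVec]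
    rw [hAdef, Set.mem_ofPred_eq, h1, star_dotProduct_self_eq, Complex.ofReal_re]
    rfl
  rw [← lintegral_indicator_one hA, lintegral_complexNormalVec _ (measurable_one.indicator hA)]
  -- Substitution `g = S k` with `S² = R`: the Jacobian is `|det S|² = det R`, and the quadratic
  -- form becomes `|k|²`.
  conv_lhs => rw [hvol']
  rw [lintegral_smul_measure, lintegral_map
    (f := fun k => ENNReal.ofReal (complexNormalVecPDF L k) * A.indicator 1 k)
    ((measurable_complexNormalVecPDF L).ennreal_ofReal.mul (measurable_one.indicator hA))
    (continuous_mulVec_const S).measurable, smul_eq_mul,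
    ← lintegral_const_mul _ (by
      refine Measurable.mul ?_ ?_
      · exact ((measurable_complexNormalVecPDF L).comp
          (continuous_mulVec_const S).measurable).ennreal_ofReal
      · exact (measurable_one.indicator hA).comp (continuous_mulVec_const S).measurable),
    ← lintegral_indicator hB]
  refine lintegral_congr fun k => ?_
  by_cases hk : k ∈ {k : Fin L → ℂ | s ≤ ∑ i, ‖k i‖ ^ 2}
  · rw [Set.indicator_of_mem hk, Set.indicator_of_mem ((hmem k).2 hk), Pi.one_apply, mul_one,
      complexNormalVecPDF, sum_sq_norm_mulVec_of_isHermitian hS, hSR, hnorm,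
      ENNReal.ofReal_mul (by positivity), ENNReal.ofReal_mul (p := R.det.re) (by
        rw [← hnorm]; positivity)]
    ring
  · rw [Set.indicator_of_notMem hk, Set.indicator_of_notMem (fun h => hk ((hmem k).1 h))]
    simp

/-! ### Rank one updates -/

/-- The adjugate form of the matrix determinant lemma also covers singular `A`. Both sides are
continuous in `t` along `A + t • 1`, which is invertible for all but finitely many `t`. -/
lemma det_add_vecMulVec {n : ℕ} (A : Matrix (Fin n) (Fin n) ℂ) (u v : Fin n → ℂ) :
    (A + Matrix.vecMulVec u v).det = A.det + ∑ i, ∑ j, v i * A.adjugate i j * u j := by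
  have hinv : ∀ A : Matrix (Fin n) (Fin n) ℂ, A.det ≠ 0 →
      (A + Matrix.vecMulVec u v).det = A.det + ∑ i, ∑ j, v i * A.adjugate i j * u j := by
    intro A hA
    have h := Matrix.det_add_replicateCol_mul_replicateRow (ι := Unit) (isUnit_iff_ne_zero.2 hA) u v
    have h1 : (1 + Matrix.replicateRow Unit v * A⁻¹ * Matrix.replicateCol Unit u).det =
        1 + ∑ i, ∑ j, v i * A⁻¹ i j * u j := by
      rw [Matrix.det_unique, Finset.sum_comm]
      simp [Matrix.mul_apply, Finset.sum_mul]
    rw [Matrix.vecMulVec_eq Unit, h, h1, mul_add, mul_one, Finset.mul_sum]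
    congr 1
    refine Finset.sum_congr rfl fun i _ => ?_
    rw [Finset.mul_sum]
    refine Finset.sum_congr rfl fun j _ => ?_
    rw [Matrix.inv_def, Ring.inverse_eq_inv', Matrix.smul_apply, smul_eq_mul]
    field_simp
  have hdense : Dense {t : ℂ | (A + t • 1).det ≠ 0} := by
    have hfin : {t : ℂ | (A + t • 1).det = 0}.Finite := by
      refine ((-A).charpoly.roots.toFinset.finite_toSet).subset fun t ht => ?_
      simp only [Finset.mem_coe, Multiset.mem_toFinset]
      rw [Polynomial.mem_roots (Matrix.charpoly_monic _).ne_zero, Polynomial.IsRoot.def,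
        Matrix.eval_charpoly, sub_neg_eq_add, add_comm, Matrix.scalar_apply, ← Matrix.smul_one_eq_diagonal]
      exact ht
    exact hfin.countable.dense_compl ℂ
  have hA : Continuous fun t : ℂ => A + t • (1 : Matrix (Fin n) (Fin n) ℂ) := by fun_prop
  have hext := Continuous.ext_on hdense
    (f := fun t : ℂ => (A + t • 1 + Matrix.vecMulVec u v).det)
    (g := fun t : ℂ => (A + t • 1).det + ∑ i, ∑ j, v i * (A + t • 1).adjugate i j * u j)
    (hA.add continuous_const).matrix_det
    (hA.matrix_det.add (continuous_finsetSum _ fun i _ => continuous_finsetSum _ fun j _ =>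
      ((continuous_const.mul (hA.matrix_adjugate.matrix_elem i j)).mul continuous_const)))
    (fun t ht => hinv _ ht)
  simpa using congrFun hext 0

/-- Expected determinant of the principal submatrix of a rank one Gaussian update, tilted along the
coordinate `o`. -/
lemma integral_det_rankOne_update {L n : ℕ} {a p : ℝ} (ha : 0 ≤ a) (o : Fin L)
    (M : Matrix (Fin L) (Fin L) ℂ) {e : Fin (n + 1) → Fin L} (he : Function.Injective e) :
    Integrable (fun g : Fin L → ℂ =>
      (((M + p • Matrix.vecMulVec g (star g)).submatrix e e).det * (Real.exp (-a * ‖g o‖ ^ 2) : ℂ)))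
      (complexNormalVec L) ∧
    ∫ g : Fin L → ℂ,
      (((M + p • Matrix.vecMulVec g (star g)).submatrix e e).det * (Real.exp (-a * ‖g o‖ ^ 2) : ℂ))
      ∂complexNormalVec L = ((1 + a)⁻¹ : ℝ) * ((M.submatrix e e).det +
        p * ∑ i, ((if e i = o then (1 + a)⁻¹ else 1 : ℝ) : ℂ) *
          (M.submatrix (e ∘ i.succAbove) (e ∘ i.succAbove)).det) := by
  have hexp : ∀ g : Fin L → ℂ,
      (((M + p • Matrix.vecMulVec g (star g)).submatrix e e).det *
        (Real.exp (-a * ‖g o‖ ^ 2) : ℂ)) =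
      (M.submatrix e e).det * (Real.exp (-a * ‖g o‖ ^ 2) : ℂ) +
        ∑ i, ∑ j, (p * (M.submatrix e e).adjugate i j) *
          (g (e j) * star (g (e i)) * (Real.exp (-a * ‖g o‖ ^ 2) : ℂ)) := by
    intro g
    have h1 : (M + p • Matrix.vecMulVec g (star g)).submatrix e e =
        M.submatrix e e + Matrix.vecMulVec (fun i => (p : ℂ) * g (e i)) (fun i => star (g (e i))) := by
      ext i j
      simp [Matrix.vecMulVec_apply, mul_assoc]
    rw [h1, det_add_vecMulVec, add_mul]
    congr 1
    rw [Finset.sum_mul]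
    refine Finset.sum_congr rfl fun i _ => ?_
    rw [Finset.sum_mul]
    refine Finset.sum_congr rfl fun j _ => ?_
    ring
  simp_rw [hexp]
  have hi1 : Integrable (fun g : Fin L → ℂ => (M.submatrix e e).det *
      (Real.exp (-a * ‖g o‖ ^ 2) : ℂ)) (complexNormalVec L) :=
    (integrable_exp_complexNormalVec ha o).ofReal.const_mul _
  have hi2 : ∀ i j, Integrable (fun g : Fin L → ℂ => (p * (M.submatrix e e).adjugate i j) *
          (g (e j) * star (g (e i)) * (Real.exp (-a * ‖g o‖ ^ 2) : ℂ))) (complexNormalVec L) :=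
    fun i j => (integrable_mul_star_exp_complexNormalVec ha o (e j) (e i)).const_mul _
  have hi3 := integrable_finsetSum (Finset.univ) fun i (_ : i ∈ Finset.univ) =>
    integrable_finsetSum (Finset.univ) fun j (_ : j ∈ Finset.univ) => hi2 i j
  refine ⟨hi1.add hi3, ?_⟩
  rw [integral_add hi1 hi3, integral_const_mul, integral_complex_ofReal,
    integral_exp_complexNormalVec ha,
    integral_finsetSum _ (fun i _ => integrable_finsetSum _ fun j _ => hi2 i j)]
  simp_rw [integral_finsetSum _ (fun j _ => hi2 _ j), integral_const_mul,
    integral_mul_star_exp_complexNormalVec ha]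
  rw [mul_add, mul_comm (M.submatrix e e).det, Finset.mul_sum, Finset.mul_sum]
  congr 1
  refine Finset.sum_congr rfl fun i _ => ?_
  -- Mixed moments of distinct coordinates vanish and `e` is injective, so only the diagonal of the
  -- adjugate survives; its entries are the principal minors with one index deleted.
  rw [Finset.sum_eq_single i]
  · rw [if_pos rfl, Matrix.adjugate_fin_succ_eq_det_submatrix, Even.neg_one_pow ⟨_, rfl⟩, one_mul,
      Matrix.submatrix_submatrix]
    push_cast
    ring
  · intro j _ hj
    simp [he.ne hj]
  · simp

/-! ### Splitting off one factor of an infinite product -/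

/-- With `optionNatEquiv` this peels the first channel vector off a sequence; with the identity it
separates the channel of the typical emitter from those of the interferers. -/
lemma measurePreserving_optionElim {V ι κ : Type*} [MeasurableSpace V] (γ : Measure V)
    [IsProbabilityMeasure γ] (e : Option ι ≃ κ) :
    MeasurePreserving (fun (q : V × (ι → V)) (i : κ) => (e.symm i).elim q.1 q.2)
      (γ.prod (Measure.infinitePi fun _ : ι => γ)) (Measure.infinitePi fun _ : κ => γ) := by
  classical
  have hm : Measurable (fun (q : V × (ι → V)) (i : κ) => (e.symm i).elim q.1 q.2) := by
    refine measurable_pi_lambda _ fun i => ?_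
    cases h : e.symm i with
    | none => simpa [h] using measurable_fst
    | some j => simpa [h, Function.comp_def] using (measurable_pi_apply j).comp measurable_snd
  refine ⟨hm, ?_⟩
  refine Measure.eq_infinitePi _ fun s t ht => ?_
  let t' : κ → Set V := fun i => if i ∈ s then t i else Set.univ
  have ht' : ∀ i, MeasurableSet (t' i) := fun i => by
    by_cases hi : i ∈ s
    · simpa [t', hi] using ht i
    · simp [t', hi]
  obtain ⟨s', hs'⟩ : ∃ s' : Finset ι, ∀ j, j ∈ s' ↔ e (some j) ∈ s :=
    ⟨s.preimage (fun j => e (some j)) (fun a _ b _ h => Option.some_injective _ (e.injective h)),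
      fun j => Finset.mem_preimage⟩
  have hpre : (fun (q : V × (ι → V)) (i : κ) => (e.symm i).elim q.1 q.2) ⁻¹' (Set.pi s t) =
      t' (e none) ×ˢ Set.pi s' (fun j => t' (e (some j))) := by
    ext q
    simp only [Set.mem_preimage, Set.mem_pi, Set.mem_prod, t', Finset.mem_coe, hs']
    constructor
    · intro h
      refine ⟨?_, fun j hj => ?_⟩
      · by_cases h0 : e none ∈ s
        · simpa [h0] using h _ h0
        · simp [h0]
      · simpa [hj] using h _ hj
    · rintro ⟨h0, h1⟩ i hi
      obtain ⟨o, rfl⟩ := e.surjective i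
      cases o with
      | none => simpa [hi] using h0
      | some j => simpa [hi] using h1 j hi
  rw [Measure.map_apply hm (MeasurableSet.pi s.countable_toSet fun i _ => ht i), hpre,
    Measure.prod_prod, Measure.infinitePi_pi _ (fun j _ => ht' _)]
  -- The index `e none` may be absent from `s`; adjoining it with the whole space as side costs a
  -- factor 1.
  have hprod : ∏ i ∈ s, γ (t i) = ∏ i ∈ insert (e none) s, γ (t' i) := by
    by_cases h0 : e none ∈ s
    · rw [Finset.insert_eq_of_mem h0]
      exact Finset.prod_congr rfl fun i hi => by simp [t', hi]
    · rw [Finset.prod_insert h0]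
      simp only [t', h0, if_false, measure_univ, one_mul]
      exact Finset.prod_congr rfl fun i hi => by simp [hi]
  have himg : insert (e none) s = insert (e none) (s'.image fun j => e (some j)) := by
    ext i
    obtain ⟨o, rfl⟩ := e.surjective i
    cases o <;> simp [hs']
  rw [hprod, himg, Finset.prod_insert (by simp), Finset.prod_image
    (fun a _ b _ h => Option.some_injective _ (e.injective h))]

/-- The bijection `Option ℕ ≃ ℕ` sending `none` to `0`. -/
def optionNatEquiv : Option ℕ ≃ ℕ where
  toFun o := o.elim 0 Nat.succ
  invFun n := n.casesOn none some
  left_inv o := by cases o <;> rfl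
  right_inv n := by cases n <;> rfl

/-! ### Poisson binomial distributions -/

/-- The generating function of the number of successes among independent trials with success
probabilities `p j * κ / (1 + p j * κ)`, `j < N`. -/
noncomputable def trialsPGF (p : ℕ → ℝ) (κ : ℝ) (N : ℕ) : Polynomial ℝ :=
  ∏ j ∈ Finset.range N, (Polynomial.C (1 + p j * κ)⁻¹ +
    Polynomial.C (p j * κ * (1 + p j * κ)⁻¹) * Polynomial.X)

/-- The probability of fewer than `m` successes. -/
noncomputable def trialsCDF (p : ℕ → ℝ) (κ : ℝ) (N m : ℕ) : ℝ :=
  ∑ i ∈ Finset.range m, (trialsPGF p κ N).coeff i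

/-- Peeling the first trial matches the removal of the first channel vector from a Gram sum;
`trialsPGF_succ` peels the last one and serves monotonicity in `N`. -/
lemma trialsPGF_succ' (p : ℕ → ℝ) (κ : ℝ) (N : ℕ) :
    trialsPGF p κ (N + 1) = (Polynomial.C (1 + p 0 * κ)⁻¹ +
      Polynomial.C (p 0 * κ * (1 + p 0 * κ)⁻¹) * Polynomial.X) *
        trialsPGF (fun j => p (j + 1)) κ N := by
  rw [trialsPGF, Finset.prod_range_succ', mul_comm]; rfl

lemma trialsPGF_succ (p : ℕ → ℝ) (κ : ℝ) (N : ℕ) :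
    trialsPGF p κ (N + 1) = (Polynomial.C (1 + p N * κ)⁻¹ +
      Polynomial.C (p N * κ * (1 + p N * κ)⁻¹) * Polynomial.X) * trialsPGF p κ N := by
  rw [trialsPGF, Finset.prod_range_succ, mul_comm]; rfl

lemma coeff_linear_mul_zero (a b : ℝ) (P : Polynomial ℝ) :
    ((Polynomial.C a + Polynomial.C b * Polynomial.X) * P).coeff 0 = a * P.coeff 0 := by
  simp [add_mul, mul_assoc]

lemma coeff_linear_mul_succ (a b : ℝ) (P : Polynomial ℝ) (m : ℕ) :
    ((Polynomial.C a + Polynomial.C b * Polynomial.X) * P).coeff (m + 1) =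
      a * P.coeff (m + 1) + b * P.coeff m := by
  simp [add_mul, mul_assoc, Polynomial.coeff_X_mul]

lemma sum_coeff_linear_mul (a b : ℝ) (P : Polynomial ℝ) (m : ℕ) :
    ∑ i ∈ Finset.range (m + 1), ((Polynomial.C a + Polynomial.C b * Polynomial.X) * P).coeff i =
      a * ∑ i ∈ Finset.range (m + 1), P.coeff i + b * ∑ i ∈ Finset.range m, P.coeff i := by
  rw [Finset.sum_range_succ', Finset.sum_range_succ' (fun i => P.coeff i)]
  simp_rw [coeff_linear_mul_succ, coeff_linear_mul_zero]
  rw [Finset.sum_add_distrib, ← Finset.mul_sum, ← Finset.mul_sum]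
  ring

lemma trialsPGF_coeff_nonneg {p : ℕ → ℝ} (hp : ∀ j, 0 ≤ p j) {κ : ℝ} (hκ : 0 ≤ κ) (N m : ℕ) :
    0 ≤ (trialsPGF p κ N).coeff m := by
  induction N generalizing m with
  | zero => simp only [trialsPGF, Finset.range_zero, Finset.prod_empty, Polynomial.coeff_one]
            split_ifs <;> norm_num
  | succ N ih =>
    have := mul_nonneg (hp N) hκ
    rw [trialsPGF_succ]
    cases m with
    | zero => rw [coeff_linear_mul_zero]; exact mul_nonneg (by positivity) (ih 0)
    | succ m =>
      rw [coeff_linear_mul_succ]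
      have h1 := ih m
      have h2 := ih (m + 1)
      positivity

lemma trialsCDF_nonneg {p : ℕ → ℝ} (hp : ∀ j, 0 ≤ p j) {κ : ℝ} (hκ : 0 ≤ κ) (N m : ℕ) :
    0 ≤ trialsCDF p κ N m :=
  Finset.sum_nonneg fun i _ => trialsPGF_coeff_nonneg hp hκ N i

lemma trialsCDF_mono {p : ℕ → ℝ} (hp : ∀ j, 0 ≤ p j) {κ : ℝ} (hκ : 0 ≤ κ) (N m : ℕ) :
    trialsCDF p κ N m ≤ trialsCDF p κ N (m + 1) := by
  rw [trialsCDF, trialsCDF, Finset.sum_range_succ]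
  linarith [trialsPGF_coeff_nonneg hp hκ N m]

/-- An additional trial can only add a success: the new value is a convex combination of the old
ones at `m` and at `m - 1`. -/
lemma trialsCDF_succ_le {p : ℕ → ℝ} (hp : ∀ j, 0 ≤ p j) {κ : ℝ} (hκ : 0 ≤ κ) (N m : ℕ) :
    trialsCDF p κ (N + 1) m ≤ trialsCDF p κ N m := by
  cases m with
  | zero => simp [trialsCDF]
  | succ m =>
    have h0 := mul_nonneg (hp N) hκ
    have h1 := trialsCDF_mono hp hκ N m
    have h2 : (1 + p N * κ)⁻¹ + p N * κ * (1 + p N * κ)⁻¹ = 1 := by field_simp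
    have h3 : 0 ≤ p N * κ * (1 + p N * κ)⁻¹ := by positivity
    rw [trialsCDF, trialsPGF_succ, sum_coeff_linear_mul]
    rw [trialsCDF, trialsCDF] at h1
    rw [trialsCDF]
    have h4 := mul_le_mul_of_nonneg_left h1 h3
    have h5 := congrArg (· * ∑ i ∈ Finset.range (m + 1), (trialsPGF p κ N).coeff i) h2
    simp only [add_mul, one_mul] at h5
    linarith

/-- Minus the derivative in `κ` of `trialsCDF p κ N m`. -/
noncomputable def trialsDensity : (ℕ → ℝ) → ℝ → ℕ → ℕ → ℝ
  | _, _, 0, _ => 0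
  | _, _, _ + 1, 0 => 0
  | p, κ, N + 1, m + 1 =>
    (1 + p 0 * κ)⁻¹ * trialsDensity (fun j => p (j + 1)) κ N (m + 1) +
      p 0 * κ * (1 + p 0 * κ)⁻¹ * trialsDensity (fun j => p (j + 1)) κ N m +
      p 0 * (1 + p 0 * κ)⁻¹ * (1 + p 0 * κ)⁻¹ * (trialsPGF (fun j => p (j + 1)) κ N).coeff m

lemma trialsDensity_zero (p : ℕ → ℝ) (κ : ℝ) (N : ℕ) : trialsDensity p κ N 0 = 0 := by
  cases N <;> simp [trialsDensity]

lemma trialsDensity_nonneg {p : ℕ → ℝ} (hp : ∀ j, 0 ≤ p j) {κ : ℝ} (hκ : 0 ≤ κ) (N m : ℕ) :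
    0 ≤ trialsDensity p κ N m := by
  induction N generalizing p m with
  | zero => simp [trialsDensity]
  | succ N ih =>
    cases m with
    | zero => simp [trialsDensity]
    | succ m =>
      have hp' : ∀ j, 0 ≤ p (j + 1) := fun j => hp _
      have h0 := hp 0
      have h1 := ih hp' m
      have h2 := ih hp' (m + 1)
      have h3 := trialsPGF_coeff_nonneg hp' hκ N m
      rw [trialsDensity]
      positivity

/-- Product rule on the recursion that conditions on the first trial. Its success probability has
derivative `p₀ / (1 + p₀ κ)²`, and a first success matters only if exactly `m` of the other trials
succeed; this is the third term of `trialsDensity`. -/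
lemma hasDerivAt_trialsCDF {p : ℕ → ℝ} (hp : ∀ j, 0 ≤ p j) {κ : ℝ} (hκ : 0 ≤ κ) (N m : ℕ) :
    HasDerivAt (fun κ => trialsCDF p κ N m) (-trialsDensity p κ N m) κ := by
  induction N generalizing p m with
  | zero => simpa [trialsCDF, trialsPGF, trialsDensity] using hasDerivAt_const κ _
  | succ N ih =>
    cases m with
    | zero => simpa [trialsCDF, trialsDensity] using hasDerivAt_const κ (0 : ℝ)
    | succ m =>
      have hp' : ∀ j, 0 ≤ p (j + 1) := fun j => hp _
      have h0 : 0 < 1 + p 0 * κ := by have := mul_nonneg (hp 0) hκ; linarith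
      have hrec : ∀ κ, trialsCDF p κ (N + 1) (m + 1) =
          (1 + p 0 * κ)⁻¹ * trialsCDF (fun j => p (j + 1)) κ N (m + 1) +
          p 0 * κ * (1 + p 0 * κ)⁻¹ * trialsCDF (fun j => p (j + 1)) κ N m := by
        intro κ
        rw [trialsCDF, trialsPGF_succ', sum_coeff_linear_mul]; rfl
      have hlin : HasDerivAt (fun κ => p 0 * κ) (p 0) κ := by
        simpa using (hasDerivAt_id κ).const_mul (p 0)
      have hinv := (hlin.const_add 1).fun_inv h0.ne'
      have hd := (hinv.fun_mul (ih hp' (m + 1))).fun_add ((hlin.fun_mul hinv).fun_mul (ih hp' m))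
      simp_rw [hrec]
      refine hd.congr_deriv ?_
      rw [trialsDensity]
      have hc : trialsCDF (fun j => p (j + 1)) κ N (m + 1) =
          trialsCDF (fun j => p (j + 1)) κ N m + (trialsPGF (fun j => p (j + 1)) κ N).coeff m := by
        rw [trialsCDF, Finset.sum_range_succ]; rfl
      rw [hc]
      field_simp
      ring

/-! ### Expected determinants of weighted Gram sums -/

/-- `∑_{j<N} p j • h j (h j)ᴴ`. -/
noncomputable def gramSum {L : ℕ} (p : ℕ → ℝ) (h : ℕ → Fin L → ℂ) (N : ℕ) : Matrix (Fin L) (Fin L) ℂ :=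
  ∑ j ∈ Finset.range N, p j • Matrix.vecMulVec (h j) (star (h j))

lemma gramSum_succ' {L : ℕ} (p : ℕ → ℝ) (h : ℕ → Fin L → ℂ) (N : ℕ) :
    gramSum p h (N + 1) = gramSum (fun j => p (j + 1)) (fun j => h (j + 1)) N +
      p 0 • Matrix.vecMulVec (h 0) (star (h 0)) := by
  rw [gramSum, Finset.sum_range_succ']; rfl

lemma posSemidef_smul_vecMulVec {L : ℕ} {p : ℝ} (hp : 0 ≤ p) (g : Fin L → ℂ) :
    (p • Matrix.vecMulVec g (star g)).PosSemidef :=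
  (Matrix.posSemidef_vecMulVec_self_star g).smul hp

lemma gramSum_posSemidef {L : ℕ} {p : ℕ → ℝ} (hp : ∀ j, 0 ≤ p j) (h : ℕ → Fin L → ℂ) (N : ℕ) :
    (gramSum p h N).PosSemidef :=
  Matrix.posSemidef_sum _ fun j _ => posSemidef_smul_vecMulVec (hp j) (h j)

lemma continuous_gramSum {L : ℕ} (p : ℕ → ℝ) (N : ℕ) :
    Continuous fun h : ℕ → Fin L → ℂ => gramSum p h N := by
  unfold gramSum
  refine continuous_finsetSum _ fun j _ => ?_
  exact ((continuous_apply j).matrix_vecMulVec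
    (continuous_star.comp (continuous_apply j))).const_smul (p j)

/-- The law of an independent sequence of standard complex normal vectors. -/
noncomputable abbrev fadingLaw (L : ℕ) : Measure (ℕ → Fin L → ℂ) :=
  Measure.infinitePi fun _ : ℕ => complexNormalVec L

/-- Expected principal minor of `gramSum p h N`, tilted along the coordinate `o`. -/
noncomputable def tiltedMinor {L n : ℕ} (p : ℕ → ℝ) (κ : ℝ) (o : Fin L) (N : ℕ)
    (e : Fin n → Fin L) : ℝ≥0∞ :=
  ∫⁻ h, ENNReal.ofReal (((gramSum p h N).submatrix e e).det.re *
    Real.exp (-κ * ∑ j ∈ Finset.range N, p j * ‖h j o‖ ^ 2)) ∂fadingLaw L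

lemma continuous_tiltedMinor_integrand {L n : ℕ} (p : ℕ → ℝ) (κ : ℝ) (o : Fin L) (N : ℕ)
    (e : Fin n → Fin L) :
    Continuous fun h : ℕ → Fin L → ℂ => ((gramSum p h N).submatrix e e).det.re *
      Real.exp (-κ * ∑ j ∈ Finset.range N, p j * ‖h j o‖ ^ 2) := by
  refine (Complex.continuous_re.comp ((continuous_gramSum p N).matrix_submatrix e e).matrix_det).mul
    ?_
  fun_prop

lemma lintegral_fadingLaw_cons {L : ℕ} {f : (ℕ → Fin L → ℂ) → ℝ≥0∞} (hf : Measurable f) :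
    ∫⁻ h, f h ∂fadingLaw L = ∫⁻ h', ∫⁻ g, f (fun i => (optionNatEquiv.symm i).elim g h')
      ∂complexNormalVec L ∂fadingLaw L := by
  have mp := measurePreserving_optionElim (complexNormalVec L) optionNatEquiv
  rw [← mp.lintegral_comp hf]
  exact lintegral_prod_symm _ (hf.comp mp.measurable).aemeasurable

lemma re_det_submatrix_nonneg {L n : ℕ} {M : Matrix (Fin L) (Fin L) ℂ} (hM : M.PosSemidef)
    (e : Fin n → Fin L) : 0 ≤ (M.submatrix e e).det.re :=
  (Complex.nonneg_iff.1 (hM.submatrix e).det_nonneg).1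

/-- An extended nonnegative form, so that integrating over the remaining channels needs no
integrability. The weight `w` stands for the tilt coming from those channels. -/
lemma lintegral_det_rankOne_update {L n : ℕ} {κ p w : ℝ} (hκ : 0 ≤ κ) (hp : 0 ≤ p) (hw : 0 ≤ w)
    (o : Fin L) {M : Matrix (Fin L) (Fin L) ℂ} (hM : M.PosSemidef) {e : Fin (n + 1) → Fin L}
    (he : Function.Injective e) :
    ∫⁻ g : Fin L → ℂ, ENNReal.ofReal (((M + p • Matrix.vecMulVec g (star g)).submatrix e e).det.re *
        (Real.exp (-(p * κ) * ‖g o‖ ^ 2) * w)) ∂complexNormalVec L =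
      ENNReal.ofReal (1 + p * κ)⁻¹ * (ENNReal.ofReal ((M.submatrix e e).det.re * w) +
        ENNReal.ofReal p * ∑ i, ENNReal.ofReal (if e i = o then (1 + p * κ)⁻¹ else 1) *
          ENNReal.ofReal ((M.submatrix (e ∘ i.succAbove) (e ∘ i.succAbove)).det.re * w)) := by
  have ha : 0 ≤ p * κ := mul_nonneg hp hκ
  obtain ⟨hint, hval⟩ := integral_det_rankOne_update (p := p) ha o M he
  have hre : ∀ g : Fin L → ℂ, ((M + p • Matrix.vecMulVec g (star g)).submatrix e e).det.re *
        (Real.exp (-(p * κ) * ‖g o‖ ^ 2) * w) =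
      (((M + p • Matrix.vecMulVec g (star g)).submatrix e e).det *
        (Real.exp (-(p * κ) * ‖g o‖ ^ 2) : ℂ)).re * w := fun g => by
    rw [Complex.re_mul_ofReal, mul_assoc]
  have hnn : ∀ g : Fin L → ℂ, 0 ≤ ((M + p • Matrix.vecMulVec g (star g)).submatrix e e).det.re *
        (Real.exp (-(p * κ) * ‖g o‖ ^ 2) * w) := fun g =>
    mul_nonneg (re_det_submatrix_nonneg (hM.add (posSemidef_smul_vecMulVec hp g)) e)
      (mul_nonneg (Real.exp_nonneg _) hw)
  rw [← ofReal_integral_eq_lintegral_ofReal (by simp_rw [hre]; exact hint.re.mul_const w)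
    (ae_of_all _ hnn)]
  simp_rw [hre]
  have hc : ∀ i : Fin (n + 1), (0 : ℝ) ≤ (if e i = o then (1 + p * κ)⁻¹ else 1) := fun i => by
    split_ifs <;> positivity
  have hd : ∀ i : Fin (n + 1),
      0 ≤ (M.submatrix (e ∘ i.succAbove) (e ∘ i.succAbove)).det.re * w :=
    fun i => mul_nonneg (re_det_submatrix_nonneg hM _) hw
  simp_rw [← ENNReal.ofReal_mul (hc _)]
  rw [integral_mul_const, ← ENNReal.ofReal_sum_of_nonneg (fun i _ => mul_nonneg (hc i) (hd i)),
    ← ENNReal.ofReal_mul hp, ← ENNReal.ofReal_add (mul_nonneg (re_det_submatrix_nonneg hM _) hw)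
      (mul_nonneg hp (Finset.sum_nonneg fun i _ => mul_nonneg (hc i) (hd i))),
    ← ENNReal.ofReal_mul (by positivity)]
  congr 1
  have h1 := congrArg Complex.re hval
  rw [show (∫ g : Fin L → ℂ, (((M + p • Matrix.vecMulVec g (star g)).submatrix e e).det *
        (Real.exp (-(p * κ) * ‖g o‖ ^ 2) : ℂ)).re ∂complexNormalVec L) = _ from
      (integral_re hint).trans h1]
  rw [Complex.re_ofReal_mul, Complex.add_re, Complex.re_ofReal_mul, Complex.re_sum]
  simp_rw [Complex.re_ofReal_mul]
  rw [mul_assoc, add_mul, mul_assoc, Finset.sum_mul]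
  simp_rw [mul_assoc]

/-- Integrating out the first channel vector either leaves the minor as it is or deletes one index
at the price `p 0`. Deleting the tilted index `o` costs a further factor `(1 + p 0 * κ)⁻¹`. -/
lemma tiltedMinor_succ {L n : ℕ} {p : ℕ → ℝ} (hp : ∀ j, 0 ≤ p j) {κ : ℝ} (hκ : 0 ≤ κ)
    (o : Fin L) (N : ℕ) {e : Fin (n + 1) → Fin L} (he : Function.Injective e) :
    tiltedMinor p κ o (N + 1) e = ENNReal.ofReal (1 + p 0 * κ)⁻¹ *
      (tiltedMinor (fun j => p (j + 1)) κ o N e + ENNReal.ofReal (p 0) *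
        ∑ i, ENNReal.ofReal (if e i = o then (1 + p 0 * κ)⁻¹ else 1) *
          tiltedMinor (fun j => p (j + 1)) κ o N (e ∘ i.succAbove)) := by
  have hm : ∀ {m : ℕ} (f : Fin m → Fin L) (p : ℕ → ℝ) (N : ℕ), Measurable fun h : ℕ → Fin L → ℂ =>
      ENNReal.ofReal (((gramSum p h N).submatrix f f).det.re *
        Real.exp (-κ * ∑ j ∈ Finset.range N, p j * ‖h j o‖ ^ 2)) := fun f p N =>
    (continuous_tiltedMinor_integrand p κ o N f).measurable.ennreal_ofReal
  rw [tiltedMinor, lintegral_fadingLaw_cons (hm e p (N + 1))]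
  have hinner : ∀ h' : ℕ → Fin L → ℂ, _ := fun h' =>
    lintegral_det_rankOne_update hκ (hp 0) (Real.exp_nonneg
      (-κ * ∑ j ∈ Finset.range N, p (j + 1) * ‖h' j o‖ ^ 2)) o
      (gramSum_posSemidef (fun j => hp (j + 1)) h' N) he
  have hrw : ∀ (h' : ℕ → Fin L → ℂ) (g : Fin L → ℂ),
      ((gramSum p (fun i => (optionNatEquiv.symm i).elim g h') (N + 1)).submatrix e e).det.re *
        Real.exp (-κ * ∑ j ∈ Finset.range (N + 1),
          p j * ‖(optionNatEquiv.symm j).elim g h' o‖ ^ 2) =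
      ((gramSum (fun j => p (j + 1)) h' N + p 0 • Matrix.vecMulVec g (star g)).submatrix e e).det.re *
        (Real.exp (-(p 0 * κ) * ‖g o‖ ^ 2) * Real.exp
          (-κ * ∑ j ∈ Finset.range N, p (j + 1) * ‖h' j o‖ ^ 2)) := by
    intro h' g
    rw [gramSum_succ', ← Real.exp_add, Finset.sum_range_succ']
    congr 2
    simp only [optionNatEquiv, Equiv.coe_fn_symm_mk, Option.elim]
    ring
  simp_rw [hrw, hinner]
  rw [lintegral_const_mul _ (by
    refine (hm e _ N).add (Measurable.const_mul (Finset.measurable_sum _ fun i _ =>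
      (hm _ _ N).const_mul _) _)), lintegral_add_left (hm e _ N), lintegral_const_mul _
      (Finset.measurable_sum _ fun i _ => (hm _ _ N).const_mul _),
    lintegral_finsetSum _ (fun i _ => (hm _ _ N).const_mul _)]
  simp_rw [lintegral_const_mul _ (hm _ _ N)]
  rfl

lemma tiltedMinor_succ_empty {L : ℕ} {p : ℕ → ℝ} (hp : ∀ j, 0 ≤ p j) {κ : ℝ} (hκ : 0 ≤ κ)
    (o : Fin L) (N : ℕ) (e : Fin 0 → Fin L) :
    tiltedMinor p κ o (N + 1) e = ENNReal.ofReal (1 + p 0 * κ)⁻¹ *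
      tiltedMinor (fun j => p (j + 1)) κ o N e := by
  have hm : ∀ (p : ℕ → ℝ) (N : ℕ), Measurable fun h : ℕ → Fin L → ℂ =>
      ENNReal.ofReal (((gramSum p h N).submatrix e e).det.re *
        Real.exp (-κ * ∑ j ∈ Finset.range N, p j * ‖h j o‖ ^ 2)) := fun p N =>
    (continuous_tiltedMinor_integrand p κ o N e).measurable.ennreal_ofReal
  have ha : 0 ≤ p 0 * κ := mul_nonneg (hp 0) hκ
  rw [tiltedMinor, lintegral_fadingLaw_cons (hm p (N + 1)), tiltedMinor,
    ← lintegral_const_mul _ (hm _ N)]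
  refine lintegral_congr fun h' => ?_
  rw [← integral_exp_complexNormalVec ha o, ofReal_integral_eq_lintegral_ofReal
    (integrable_exp_complexNormalVec ha o) (ae_of_all _ fun g => (Real.exp_nonneg _)),
    ← lintegral_mul_const _ (Measurable.ennreal_ofReal (Continuous.measurable (by fun_prop)))]
  refine lintegral_congr fun g => ?_
  rw [← ENNReal.ofReal_mul (Real.exp_nonneg _), Finset.sum_range_succ']
  simp only [Matrix.det_fin_zero, Complex.one_re, one_mul, ← Real.exp_add]
  congr 2
  simp only [optionNatEquiv, Equiv.coe_fn_symm_mk, Option.elim]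
  ring

lemma tiltedMinor_zero {L n : ℕ} (p : ℕ → ℝ) (κ : ℝ) (o : Fin L) (e : Fin n → Fin L) :
    tiltedMinor p κ o 0 e = ENNReal.ofReal (if n = 0 then 1 else 0) := by
  have h0 : ∀ h : ℕ → Fin L → ℂ, ((gramSum p h 0).submatrix e e).det.re = if n = 0 then 1 else 0 := by
    intro h
    have : (gramSum p h 0).submatrix e e = 0 := by simp [gramSum]
    rw [this]
    cases n with
    | zero => simp
    | succ n => rw [Matrix.det_zero]; simp
  simp [tiltedMinor, h0]

/-- The minor does not see the tilted coordinate, so the expectation is `n!` times the `n`-th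
elementary symmetric function of the `p j`, times the product of the `(1 + p j κ)⁻¹`. The proof
matches recursions: the `n + 1` possible deletions turn `n!` into `(n + 1)!`. -/
lemma tiltedMinor_of_notMem_range {L n : ℕ} {p : ℕ → ℝ} (hp : ∀ j, 0 ≤ p j) {κ : ℝ} (hκ : 0 < κ)
    {o : Fin L} (N : ℕ) {e : Fin n → Fin L} (he : Function.Injective e) (ho : ∀ i, e i ≠ o) :
    tiltedMinor p κ o N e =
      ENNReal.ofReal (n.factorial / κ ^ n * (trialsPGF p κ N).coeff n) := by
  induction N generalizing p n with
  | zero =>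
    rw [tiltedMinor_zero]
    cases n <;> simp [trialsPGF, Polynomial.coeff_one]
  | succ N ih =>
    have hp' : ∀ j, 0 ≤ p (j + 1) := fun j => hp _
    have ha := mul_nonneg (hp 0) hκ.le
    cases n with
    | zero =>
      rw [tiltedMinor_succ_empty hp hκ.le, ih hp' he ho, ← ENNReal.ofReal_mul (by positivity),
        trialsPGF_succ', coeff_linear_mul_zero]
      simp
    | succ n =>
      have hc := trialsPGF_coeff_nonneg hp' hκ.le N
      rw [tiltedMinor_succ hp hκ.le _ _ he, ih hp' he ho]
      have hi : ∀ i : Fin (n + 1), tiltedMinor (fun j => p (j + 1)) κ o N (e ∘ i.succAbove) = _ :=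
        fun i => ih hp' (he.comp i.succAbove_right_injective) fun j => ho _
      simp_rw [hi, ho, if_false]
      rw [Finset.sum_const, Finset.card_univ, Fintype.card_fin, nsmul_eq_mul, ENNReal.ofReal_one,
        one_mul, ← ENNReal.ofReal_natCast, ← ENNReal.ofReal_mul (by positivity),
        ← ENNReal.ofReal_mul (hp 0),
        ← ENNReal.ofReal_add (mul_nonneg (by positivity) (hc _))
          (mul_nonneg (hp 0) (mul_nonneg (by positivity) (mul_nonneg (by positivity) (hc _)))),
        ← ENNReal.ofReal_mul (by positivity), trialsPGF_succ', coeff_linear_mul_succ]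
      congr 1
      rw [Nat.factorial_succ]
      push_cast
      field_simp
      ring

/-- Deleting the tilted index `i₀` leads to the previous lemma and yields the coefficient term of
`trialsDensity`; deleting one of the other `n` indices stays within this lemma at size one less and
yields the middle term. -/
lemma tiltedMinor_of_mem_range {L n : ℕ} {p : ℕ → ℝ} (hp : ∀ j, 0 ≤ p j) {κ : ℝ} (hκ : 0 < κ)
    {o : Fin L} (N : ℕ) {e : Fin (n + 1) → Fin L} (he : Function.Injective e)
    {i₀ : Fin (n + 1)} (ho : e i₀ = o) :
    tiltedMinor p κ o N e =
      ENNReal.ofReal (n.factorial / κ ^ n * trialsDensity p κ N (n + 1)) := by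
  induction N generalizing p n with
  | zero =>
    rw [tiltedMinor_zero]
    simp [trialsDensity]
  | succ N ih =>
    have hp' : ∀ j, 0 ≤ p (j + 1) := fun j => hp _
    have ha := mul_nonneg (hp 0) hκ.le
    have hc := trialsPGF_coeff_nonneg hp' hκ.le N
    have hd := trialsDensity_nonneg hp' hκ.le N
    rw [tiltedMinor_succ hp hκ.le _ _ he, ih hp' he ho]
    have hne : ∀ i, i ≠ i₀ → e i ≠ o := fun i hi h => hi (he (h.trans ho.symm))
    have h0 : tiltedMinor (fun j => p (j + 1)) κ o N (e ∘ i₀.succAbove) = _ :=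
      tiltedMinor_of_notMem_range hp' hκ N (he.comp i₀.succAbove_right_injective)
        fun j => hne _ (Fin.succAbove_ne i₀ j)
    have hrest : ∑ i ∈ Finset.univ.erase i₀,
        ENNReal.ofReal (if e i = o then (1 + p 0 * κ)⁻¹ else 1) *
          tiltedMinor (fun j => p (j + 1)) κ o N (e ∘ i.succAbove) =
        ENNReal.ofReal (n.factorial / κ ^ n * (κ * trialsDensity (fun j => p (j + 1)) κ N n)) := by
      -- For a minor of size 1 there is no other index to delete, in agreement with `trialsDensity p
      -- κ N 0 = 0`.
      cases n with
      | zero =>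
        have : (Finset.univ.erase i₀ : Finset (Fin 1)) = ∅ := by
          ext i; simp [Subsingleton.elim i i₀]
        rw [this, trialsDensity_zero]
        simp
      | succ n =>
        have hterm : ∀ i ∈ Finset.univ.erase i₀,
            ENNReal.ofReal (if e i = o then (1 + p 0 * κ)⁻¹ else 1) *
              tiltedMinor (fun j => p (j + 1)) κ o N (e ∘ i.succAbove) =
            ENNReal.ofReal (n.factorial / κ ^ n *
              trialsDensity (fun j => p (j + 1)) κ N (n + 1)) := by
          intro i hi
          have hii : i ≠ i₀ := (Finset.mem_erase.1 hi).1
          obtain ⟨j, hj⟩ := Fin.exists_succAbove_eq hii.symm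
          rw [if_neg (hne i hii), ENNReal.ofReal_one, one_mul,
            ih hp' (he.comp i.succAbove_right_injective) (i₀ := j) (by simp [hj, ho])]
        rw [Finset.sum_congr rfl hterm, Finset.sum_const, Finset.card_erase_of_mem (Finset.mem_univ _),
          Finset.card_univ, Fintype.card_fin, nsmul_eq_mul, Nat.add_sub_cancel,
          ← ENNReal.ofReal_natCast, ← ENNReal.ofReal_mul (by positivity)]
        congr 1
        rw [Nat.factorial_succ]
        push_cast
        field_simp
        ring
    rw [← Finset.add_sum_erase _ _ (Finset.mem_univ i₀), hrest, h0, if_pos ho,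
      ← ENNReal.ofReal_mul (by positivity),
      ← ENNReal.ofReal_add (mul_nonneg (by positivity) (mul_nonneg (by positivity) (hc _)))
        (mul_nonneg (by positivity) (mul_nonneg hκ.le (hd _))), ← ENNReal.ofReal_mul (hp 0),
      ← ENNReal.ofReal_add (mul_nonneg (by positivity) (hd _)) (mul_nonneg (hp 0) (add_nonneg
        (mul_nonneg (by positivity) (mul_nonneg (by positivity) (hc _)))
        (mul_nonneg (by positivity) (mul_nonneg hκ.le (hd _))))),
      ← ENNReal.ofReal_mul (by positivity), trialsDensity]
    congr 1
    field_simp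
    ring

/-- The unit vector `k / |k|` extends to an orthonormal basis, whose vectors are taken as the
columns of `U`. -/
lemma exists_unitary_conjTranspose_mulVec_eq {L : ℕ} {k : Fin (L + 1) → ℂ}
    (hk : 0 < ∑ i, ‖k i‖ ^ 2) : ∃ U ∈ Matrix.unitaryGroup (Fin (L + 1)) ℂ,
      U.conjTranspose.mulVec k = Pi.single 0 (√(∑ i, ‖k i‖ ^ 2) : ℂ) := by
  set κ := ∑ i, ‖k i‖ ^ 2 with hκ
  let v : EuclideanSpace ℂ (Fin (L + 1)) := WithLp.toLp 2 k
  have hv : ‖v‖ = √κ := by rw [EuclideanSpace.norm_eq]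
  have hpos : 0 < √κ := Real.sqrt_pos.2 hk
  let u : EuclideanSpace ℂ (Fin (L + 1)) := ((√κ)⁻¹ : ℂ) • v
  have hu : ‖u‖ = 1 := by
    rw [norm_smul, hv, norm_inv, Complex.norm_real, Real.norm_of_nonneg hpos.le,
      inv_mul_cancel₀ hpos.ne']
  have hvu : v = (√κ : ℂ) • u := by
    have : (√κ : ℂ) ≠ 0 := by exact_mod_cast hpos.ne'
    rw [smul_smul, mul_inv_cancel₀ this, one_smul]
  obtain ⟨b, hb⟩ := Orthonormal.exists_orthonormalBasis_extension_of_card_eq (𝕜 := ℂ)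
    (E := EuclideanSpace ℂ (Fin (L + 1))) (ι := Fin (L + 1)) (by simp) (v := fun _ => u)
    (s := {0}) (by
      rw [orthonormal_iff_ite]
      intro i j
      simp [Subsingleton.elim i j, hu])
  have hb0 : b 0 = u := hb 0 rfl
  let a := EuclideanSpace.basisFun (Fin (L + 1)) ℂ
  refine ⟨a.toBasis.toMatrix b, a.toMatrix_orthonormalBasis_mem_unitary b, ?_⟩
  have hU : ∀ i j, a.toBasis.toMatrix b i j = b j i := fun i j => by
    simp [Module.Basis.toMatrix_apply, a]
  have horth := orthonormal_iff_ite.1 b.orthonormal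
  ext i
  have h1 : (a.toBasis.toMatrix b).conjTranspose.mulVec k i = inner ℂ (b i) v := by
    simp only [Matrix.mulVec, dotProduct, Matrix.conjTranspose_apply, hU, PiLp.inner_apply, v,
      RCLike.inner_apply, RCLike.star_def]
    exact Finset.sum_congr rfl fun j _ => mul_comm _ _
  rw [h1, hvu, ← hb0, inner_smul_right, horth, Pi.single_apply]
  simp

lemma gramSum_mulVec {L : ℕ} (p : ℕ → ℝ) (h : ℕ → Fin L → ℂ) (N : ℕ)
    (U : Matrix (Fin L) (Fin L) ℂ) :
    gramSum p (fun j => U.mulVec (h j)) N = U * gramSum p h N * U.conjTranspose := by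
  simp only [gramSum, Finset.mul_sum, Finset.sum_mul]
  refine Finset.sum_congr rfl fun j _ => ?_
  rw [Matrix.mul_smul, Matrix.smul_mul, Matrix.mul_vecMulVec, Matrix.vecMulVec_mul,
    Matrix.star_mulVec]

/-- Expected value of `det R exp (-kᴴ R k)` for a Gaussian Gram sum `R`. -/
lemma lintegral_det_mul_exp_gramSum {L : ℕ} {p : ℕ → ℝ} (hp : ∀ j, 0 ≤ p j) (N : ℕ)
    {k : Fin (L + 1) → ℂ} (hk : 0 < ∑ i, ‖k i‖ ^ 2) :
    ∫⁻ h, ENNReal.ofReal ((gramSum p h N).det.re *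
        Real.exp (-(star k ⬝ᵥ (gramSum p h N).mulVec k).re)) ∂fadingLaw (L + 1) =
      ENNReal.ofReal (L.factorial / (∑ i, ‖k i‖ ^ 2) ^ L *
        trialsDensity p (∑ i, ‖k i‖ ^ 2) N (L + 1)) := by
  -- Applying `U` to every channel vector preserves their joint law and the determinant, while the
  -- quadratic form at `k` becomes `|k|² ∑ p_j |h_j 0|²`, the exponent in `tiltedMinor`.
  obtain ⟨U, hU, hUk⟩ := exists_unitary_conjTranspose_mulVec_eq hk
  rw [← tiltedMinor_of_mem_range hp hk N (e := id) (o := 0) (i₀ := 0) Function.injective_id rfl,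
    tiltedMinor]
  have hmp : Measure.map (fun (h : ℕ → Fin (L + 1) → ℂ) j => U.mulVec (h j)) (fadingLaw (L + 1)) =
      fadingLaw (L + 1) := by
    rw [fadingLaw, Measure.infinitePi_map_pi (μ := fun _ : ℕ => complexNormalVec (L + 1))
      (f := fun _ g => U.mulVec g) (fun _ => (continuous_mulVec_const U).measurable)]
    simp_rw [(measurePreserving_mulVec_complexNormalVec hU).map_eq]
  have hcont : Continuous fun h : ℕ → Fin (L + 1) → ℂ => (gramSum p h N).det.re *
        Real.exp (-(star k ⬝ᵥ (gramSum p h N).mulVec k).re) := by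
    have := continuous_gramSum (L := L + 1) p N
    refine (Complex.continuous_re.comp this.matrix_det).mul (Real.continuous_exp.comp
      (Complex.continuous_re.comp (continuous_const.dotProduct
        (this.matrix_mulVec continuous_const))).neg)
  conv_lhs => rw [← hmp]
  have hmap : Measurable fun (h : ℕ → Fin (L + 1) → ℂ) j => U.mulVec (h j) :=
    measurable_pi_lambda _ fun j =>
      (continuous_mulVec_const U).measurable.comp (measurable_pi_apply j)
  rw [lintegral_map hcont.measurable.ennreal_ofReal hmap]
  refine lintegral_congr fun h => ?_
  have hUU : U * U.conjTranspose = 1 := Matrix.mem_unitaryGroup_iff.1 hU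
  have hdet : (U * gramSum p h N * U.conjTranspose).det = (gramSum p h N).det := by
    rw [Matrix.det_mul, Matrix.det_mul, mul_right_comm, ← Matrix.det_mul, hUU, Matrix.det_one,
      one_mul]
  have hquad : (star k ⬝ᵥ (U * gramSum p h N * U.conjTranspose).mulVec k).re =
      (∑ i, ‖k i‖ ^ 2) * ∑ j ∈ Finset.range N, p j * ‖h j 0‖ ^ 2 := by
    rw [mul_assoc, ← Matrix.mulVec_mulVec, Matrix.dotProduct_mulVec, ← Matrix.mulVec_mulVec, hUk]
    have h2 : Matrix.vecMul (star k) U = star (U.conjTranspose.mulVec k) := by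
      rw [Matrix.star_mulVec, Matrix.conjTranspose_conjTranspose]
    have h3 : gramSum p h N 0 0 = ((∑ j ∈ Finset.range N, p j * ‖h j 0‖ ^ 2 : ℝ) : ℂ) := by
      simp [gramSum, Matrix.sum_apply, Matrix.vecMulVec_apply, Complex.mul_conj']
    have h4 : ((√(∑ i, ‖k i‖ ^ 2) : ℝ) : ℂ) * (√(∑ i, ‖k i‖ ^ 2) : ℝ) = (∑ i, ‖k i‖ ^ 2 : ℝ) := by
      rw [← Complex.ofReal_mul, Real.mul_self_sqrt hk.le]
    rw [h2, hUk, ← Pi.single_star, single_dotProduct, Matrix.mulVec_single,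
      Pi.smul_apply, Matrix.col_apply, h3, op_smul_eq_mul, RCLike.star_def, Complex.conj_ofReal,
      mul_left_comm, h4, ← Complex.ofReal_mul, Complex.ofReal_re, mul_comm]
  rw [gramSum_mulVec, hdet, hquad, neg_mul]
  rfl

/-! ### Radial integration on `ℂ^L` -/

lemma volume_sum_sq_norm_le (n : ℕ) (b : ℝ) (hb : 0 ≤ b) :
    volume {k : Fin (n + 1) → ℂ | ∑ i, ‖k i‖ ^ 2 ≤ b} =
      ENNReal.ofReal (Real.pi ^ (n + 1) * b ^ (n + 1) / (n + 1).factorial) := by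
  have h := Complex.volume_sum_rpow_le (ι := Fin (n + 1)) (p := 2) (by norm_num) (√b)
  have hset : {k : Fin (n + 1) → ℂ | (∑ i, ‖k i‖ ^ (2 : ℝ)) ^ (1 / 2 : ℝ) ≤ √b} =
      {k : Fin (n + 1) → ℂ | ∑ i, ‖k i‖ ^ 2 ≤ b} := by
    ext k
    simp only [Set.mem_ofPred_eq, Real.rpow_two]
    rw [← Real.sqrt_eq_rpow, Real.sqrt_le_sqrt_iff hb]
  rw [hset] at h
  rw [h, ← ENNReal.ofReal_pow (Real.sqrt_nonneg b), ← ENNReal.ofReal_mul (by positivity)]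
  congr 1
  have h2 : (2 * (Fintype.card (Fin (n + 1)) : ℝ) / 2 + 1) = ((n + 1 : ℕ) : ℝ) + 1 := by
    rw [Fintype.card_fin]; field_simp
  rw [h2, Real.Gamma_nat_eq_factorial, pow_mul, Real.sq_sqrt hb, Fintype.card_fin,
    show ((2 : ℝ) / 2 + 1) = 2 by norm_num, Real.Gamma_two, mul_one]
  ring

/-- The ball `|k|² ≤ b` has volume `π^{n+1} b^{n+1} / (n+1)!`, whose derivative in `b` is the
density. The two measures agree on the half-lines `Iic b`, hence on bounded intervals by
subtraction. -/
lemma map_sum_sq_norm_volume (n : ℕ) :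
    Measure.map (fun k : Fin (n + 1) → ℂ => ∑ i, ‖k i‖ ^ 2) volume =
      (volume.restrict (Set.Ioi 0)).withDensity
        (fun κ : ℝ => ENNReal.ofReal (Real.pi ^ (n + 1) * κ ^ n / n.factorial)) := by
  set μ := Measure.map (fun k : Fin (n + 1) → ℂ => ∑ i, ‖k i‖ ^ 2) volume with hμ
  set ν := (volume.restrict (Set.Ioi 0)).withDensity
        (fun κ : ℝ => ENNReal.ofReal (Real.pi ^ (n + 1) * κ ^ n / n.factorial)) with hν
  have hm : Measurable fun k : Fin (n + 1) → ℂ => ∑ i, ‖k i‖ ^ 2 := by fun_prop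
  have hμ1 : ∀ b, 0 ≤ b → μ (Set.Iic b) =
      ENNReal.ofReal (Real.pi ^ (n + 1) * b ^ (n + 1) / (n + 1).factorial) := fun b hb => by
    rw [hμ, Measure.map_apply hm measurableSet_Iic]
    exact volume_sum_sq_norm_le n b hb
  have hν1 : ∀ b, 0 ≤ b → ν (Set.Iic b) =
      ENNReal.ofReal (Real.pi ^ (n + 1) * b ^ (n + 1) / (n + 1).factorial) := fun b hb => by
    rw [hν, withDensity_apply _ measurableSet_Iic, Measure.restrict_restrict measurableSet_Iic,
      Set.inter_comm, Set.Ioi_inter_Iic, ← ofReal_integral_eq_lintegral_ofReal]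
    · congr 1
      rw [← intervalIntegral.integral_of_le hb]
      simp only [mul_div_assoc, intervalIntegral.integral_const_mul,
        intervalIntegral.integral_div, integral_pow]
      rw [Nat.factorial_succ]
      push_cast
      field_simp
      simp
    · exact Continuous.integrableOn_Ioc (by fun_prop)
    · refine (ae_restrict_iff' measurableSet_Ioc).2 (ae_of_all _ fun κ hκ => ?_)
      have := hκ.1.le
      positivity
  have hIic : ∀ b, μ (Set.Iic b) = ν (Set.Iic b) := by
    intro b
    rcases le_or_gt 0 b with hb | hb
    · rw [hμ1 b hb, hν1 b hb]
    · have h0 : μ (Set.Iic b) ≤ μ (Set.Iic 0) := measure_mono (Set.Iic_subset_Iic.2 hb.le)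
      have h1 : ν (Set.Iic b) ≤ ν (Set.Iic 0) := measure_mono (Set.Iic_subset_Iic.2 hb.le)
      rw [hμ1 0 le_rfl] at h0
      rw [hν1 0 le_rfl] at h1
      simp only [ne_eq, Nat.add_eq_zero_iff, one_ne_zero, and_false, not_false_eq_true, zero_pow,
        mul_zero, zero_div, ENNReal.ofReal_zero, nonpos_iff_eq_zero] at h0 h1
      rw [h0, h1]
  have hfin : ∀ b, μ (Set.Iic b) < ∞ := fun b =>
    (measure_mono (Set.Iic_subset_Iic.2 (le_max_left b 0))).trans_lt
      (by rw [hμ1 _ (le_max_right b 0)]; exact ENNReal.ofReal_lt_top)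
  have : IsLocallyFiniteMeasure μ :=
    ⟨fun x => ⟨Set.Iic (x + 1), Iic_mem_nhds (by linarith), hfin _⟩⟩
  refine Measure.ext_of_Ioc μ ν fun a b hab => ?_
  rw [← Set.Iic_sdiff_Iic, measure_sdiff (Set.Iic_subset_Iic.2 hab.le)
    measurableSet_Iic.nullMeasurableSet (hfin a).ne,
    measure_sdiff (Set.Iic_subset_Iic.2 hab.le) measurableSet_Iic.nullMeasurableSet
    (hIic a ▸ (hfin a).ne), hIic, hIic]

lemma lintegral_sum_sq_norm (n : ℕ) {f : ℝ → ℝ≥0∞} (hf : Measurable f) :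
    ∫⁻ k : Fin (n + 1) → ℂ, f (∑ i, ‖k i‖ ^ 2) =
      ∫⁻ κ in Set.Ioi 0, ENNReal.ofReal (Real.pi ^ (n + 1) * κ ^ n / n.factorial) * f κ := by
  rw [← lintegral_map (μ := volume) hf (by fun_prop : Measurable fun k : Fin (n + 1) → ℂ =>
    ∑ i, ‖k i‖ ^ 2), map_sum_sq_norm_volume, lintegral_withDensity_eq_lintegral_mul _
      (by fun_prop) hf]
  rfl

/-! ### The tail of the quadratic form for finitely many interferers -/

lemma measurable_trialsPGF_coeff (p : ℕ → ℝ) (N m : ℕ) :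
    Measurable fun κ => (trialsPGF p κ N).coeff m := by
  induction N generalizing m with
  | zero => simp [trialsPGF]
  | succ N ih =>
    have h0 : Measurable fun κ : ℝ => p N * κ := measurable_id.const_mul _
    simp_rw [trialsPGF_succ]
    cases m with
    | zero =>
      simp_rw [coeff_linear_mul_zero]
      exact (h0.const_add 1).inv.mul (ih 0)
    | succ m =>
      simp_rw [coeff_linear_mul_succ]
      exact ((h0.const_add 1).inv.mul (ih _)).add ((h0.mul (h0.const_add 1).inv).mul (ih _))

lemma measurable_trialsDensity (p : ℕ → ℝ) (N m : ℕ) :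
    Measurable fun κ => trialsDensity p κ N m := by
  induction N generalizing p m with
  | zero => simp [trialsDensity]
  | succ N ih =>
    cases m with
    | zero => simp [trialsDensity]
    | succ m =>
      simp_rw [trialsDensity]
      have h0 : Measurable fun κ : ℝ => p 0 * κ := measurable_id.const_mul _
      have h1 := (h0.const_add 1).inv
      exact ((h1.mul (ih _ _)).add ((h0.mul h1).mul (ih _ _))).add
        (((h1.const_mul _).mul h1).mul (measurable_trialsPGF_coeff _ _ _))

/-- Fundamental theorem of calculus with the nonnegative boundary term at infinity dropped. That
term does not vanish when fewer than `m` of the `p j` are positive, so only an inequality holds. -/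
lemma lintegral_trialsDensity_le {p : ℕ → ℝ} (hp : ∀ j, 0 ≤ p j) {s : ℝ} (hs : 0 ≤ s) (N m : ℕ) :
    ∫⁻ κ in Set.Ioi s, ENNReal.ofReal (trialsDensity p κ N m) ≤
      ENNReal.ofReal (trialsCDF p s N m) := by
  have hU : Set.Ioi s = ⋃ n : ℕ, Set.Ioc s (s + n) := by
    ext x
    simp only [Set.mem_Ioi, Set.mem_iUnion, Set.mem_Ioc]
    constructor
    · intro h
      obtain ⟨n, hn⟩ := exists_nat_ge (x - s)
      exact ⟨n, h, by linarith⟩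
    · rintro ⟨n, h, _⟩; exact h
  have hmono : Monotone fun n : ℕ => Set.Ioc s (s + n) := fun a b hab =>
    Set.Ioc_subset_Ioc_right (by have : (a : ℝ) ≤ b := by exact_mod_cast hab
                                 linarith)
  rw [hU, setLIntegral_iUnion_of_directed _ hmono.directed_le]
  refine iSup_le fun n => ?_
  have hle : s ≤ s + n := by linarith [(Nat.cast_nonneg n : (0 : ℝ) ≤ n)]
  have hd : ∀ x ∈ Set.Icc s (s + n),
      HasDerivAt (fun κ => -trialsCDF p κ N m) (trialsDensity p x N m) x := fun x hx => by
    simpa using (hasDerivAt_trialsCDF hp (hs.trans hx.1) N m).fun_neg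
  have hcont : ContinuousOn (fun κ => -trialsCDF p κ N m) (Set.Icc s (s + n)) := fun x hx =>
    (hd x hx).continuousAt.continuousWithinAt
  have hint : IntegrableOn (fun κ => trialsDensity p κ N m) (Set.Ioc s (s + n)) :=
    intervalIntegral.integrableOn_deriv_of_nonneg hcont
      (fun x hx => hd x (Set.Ioo_subset_Icc_self hx))
      (fun x hx => trialsDensity_nonneg hp (hs.trans hx.1.le) N m)
  rw [← ofReal_integral_eq_lintegral_ofReal hint ((ae_restrict_iff' measurableSet_Ioc).2
    (ae_of_all _ fun κ hκ => trialsDensity_nonneg hp (hs.trans hκ.1.le) N m))]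
  refine ENNReal.ofReal_le_ofReal ?_
  rw [← intervalIntegral.integral_of_le hle, intervalIntegral.integral_eq_sub_of_hasDerivAt
    (f := fun κ => -trialsCDF p κ N m) (by rwa [Set.uIcc_of_le hle])
    ((intervalIntegrable_iff_integrableOn_Ioc_of_le hle).2 hint)]
  linarith [trialsCDF_nonneg hp (hs.trans hle) N m]

/-- The integrand expressing the tail of `gᴴ R⁻¹ g`. -/
noncomputable def quadFormDensity {L : ℕ} (R : Matrix (Fin L) (Fin L) ℂ) (k : Fin L → ℂ) : ℝ :=
  R.det.re * Real.exp (-(star k ⬝ᵥ R.mulVec k).re)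

lemma continuous_quadFormDensity {L : ℕ} (k : Fin L → ℂ) :
    Continuous fun R : Matrix (Fin L) (Fin L) ℂ => quadFormDensity R k :=
  (Complex.continuous_re.comp continuous_id.matrix_det).mul (Real.continuous_exp.comp
      (Complex.continuous_re.comp (continuous_const.dotProduct
        (continuous_id.matrix_mulVec continuous_const))).neg)

lemma continuous_quadFormDensity_right {L : ℕ} (R : Matrix (Fin L) (Fin L) ℂ) :
    Continuous fun k : Fin L → ℂ => quadFormDensity R k :=
  continuous_const.mul (Real.continuous_exp.comp
    (Complex.continuous_re.comp (continuous_star.dotProduct (continuous_mulVec_const R))).neg)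

lemma continuous_quadFormDensity_gramSum {L : ℕ} (p : ℕ → ℝ) (N : ℕ) :
    Continuous fun q : (ℕ → Fin L → ℂ) × (Fin L → ℂ) => quadFormDensity (gramSum p q.1 N) q.2 := by
  have h1 : Continuous fun q : (ℕ → Fin L → ℂ) × (Fin L → ℂ) => gramSum p q.1 N :=
    (continuous_gramSum p N).comp continuous_fst
  exact (Complex.continuous_re.comp h1.matrix_det).mul (Real.continuous_exp.comp
    (Complex.continuous_re.comp ((continuous_star.comp continuous_snd).dotProduct
      (h1.matrix_mulVec continuous_snd))).neg)

/-- After Tonelli the inner expectation depends on `|k|²` only. The radial density `π^{L+1} κ^L /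
L!` cancels both the Gaussian constant and the factor `L! / κ^L`, leaving the integral of
`trialsDensity`. -/
lemma lintegral_gramSum_tail_le {L : ℕ} {p : ℕ → ℝ} (hp : ∀ j, 0 ≤ p j) (N : ℕ) {s : ℝ}
    (hs : 0 < s) :
    ∫⁻ h, (∫⁻ k in {k : Fin (L + 1) → ℂ | s ≤ ∑ i, ‖k i‖ ^ 2},
      ENNReal.ofReal (Real.pi⁻¹ ^ (L + 1)) * ENNReal.ofReal (quadFormDensity (gramSum p h N) k))
        ∂fadingLaw (L + 1) ≤ ENNReal.ofReal (trialsCDF p s N (L + 1)) := by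
  have hB : MeasurableSet {k : Fin (L + 1) → ℂ | s ≤ ∑ i, ‖k i‖ ^ 2} :=
    measurableSet_le measurable_const (by fun_prop)
  have hcont := continuous_quadFormDensity_gramSum (L := L + 1) p N
  rw [lintegral_lintegral_swap (hcont.measurable.ennreal_ofReal.const_mul _).aemeasurable]
  have hinner : ∀ k ∈ {k : Fin (L + 1) → ℂ | s ≤ ∑ i, ‖k i‖ ^ 2},
      ∫⁻ h, ENNReal.ofReal (Real.pi⁻¹ ^ (L + 1)) *
        ENNReal.ofReal (quadFormDensity (gramSum p h N) k) ∂fadingLaw (L + 1) =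
      ENNReal.ofReal (Real.pi⁻¹ ^ (L + 1)) * ENNReal.ofReal (L.factorial / (∑ i, ‖k i‖ ^ 2) ^ L *
        trialsDensity p (∑ i, ‖k i‖ ^ 2) N (L + 1)) := fun k hk => by
    have hck : Continuous fun h : ℕ → Fin (L + 1) → ℂ => quadFormDensity (gramSum p h N) k :=
      Continuous.comp (g := fun R => quadFormDensity R k) (f := fun h => gramSum p h N)
        (continuous_quadFormDensity k) (continuous_gramSum p N)
    rw [lintegral_const_mul _ hck.measurable.ennreal_ofReal,
      ← lintegral_det_mul_exp_gramSum hp N (hs.trans_le hk)]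
    rfl
  rw [setLIntegral_congr_fun hB hinner, ← lintegral_indicator hB]
  have hf : Measurable ((Set.Ici s).indicator fun κ : ℝ => ENNReal.ofReal (Real.pi⁻¹ ^ (L + 1)) *
      ENNReal.ofReal (L.factorial / κ ^ L * trialsDensity p κ N (L + 1))) :=
    Measurable.indicator (Measurable.const_mul (((measurable_const.div
      (measurable_id.pow_const L)).mul (measurable_trialsDensity p N (L + 1))).ennreal_ofReal) _)
      measurableSet_Ici
  refine ((lintegral_sum_sq_norm L hf).le).trans ?_
  refine le_trans ?_ (lintegral_trialsDensity_le hp hs.le N (L + 1))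
  rw [← lintegral_indicator measurableSet_Ioi,
    ← setLIntegral_congr (Ioi_ae_eq_Ici (a := s)).symm, ← lintegral_indicator measurableSet_Ici]
  refine lintegral_mono fun κ => ?_
  by_cases hκ : κ ∈ Set.Ici s
  · have hκ0 : 0 < κ := hs.trans_le hκ
    rw [Set.indicator_of_mem (Set.mem_Ioi.2 hκ0), Set.indicator_of_mem hκ,
      Set.indicator_of_mem hκ, ← ENNReal.ofReal_mul (by positivity),
      ← ENNReal.ofReal_mul (by positivity)]
    refine ENNReal.ofReal_le_ofReal (le_of_eq ?_)
    rw [inv_pow]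
    field_simp
  · by_cases h0 : κ ∈ Set.Ioi (0 : ℝ)
    · rw [Set.indicator_of_mem h0, Set.indicator_of_notMem hκ]; simp
    · rw [Set.indicator_of_notMem h0]; exact zero_le

open scoped Topology
open Filter

/-! ### Measurability of the signal-to-interference ratio -/

lemma interferenceCov_eq_fun {L : ℕ} (α : ℝ) (x : ℕ → Plane) (g : ℕ → Fin L → ℂ) (y : Plane) :
    interferenceCov α x g y = ∑' i, (fun a b => ((‖x i - y‖ ^ (-α) : ℝ) : ℂ) *
      (g i a * star (g i b)) : Fin L → Fin L → ℂ) := by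
  have : ∀ i, (‖x i - y‖ ^ (-α) : ℝ) • Matrix.vecMulVec (g i) (star (g i)) =
      Matrix.of (fun a b => ((‖x i - y‖ ^ (-α) : ℝ) : ℂ) * (g i a * star (g i b))) := by
    intro i; ext a b; simp [Matrix.vecMulVec_apply]
  rw [interferenceCov]
  simp_rw [this]
  rfl

lemma measurable_interferenceCov_apply {L : ℕ} (α : ℝ) (a b : Fin L) :
    Measurable fun q : ((ℕ → Plane) × Plane) × (ℕ → Fin L → ℂ) =>
      interferenceCov α q.1.1 q.2 q.1.2 a b := by
  have h : Measurable fun q : ((ℕ → Plane) × Plane) × (ℕ → Fin L → ℂ) =>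
      (∑' i, (fun a b => ((‖q.1.1 i - q.1.2‖ ^ (-α) : ℝ) : ℂ) * (q.2 i a * star (q.2 i b)) :
        Fin L → Fin L → ℂ)) := by
    refine Measurable.tsum fun i => ?_
    refine measurable_pi_lambda _ fun a => measurable_pi_lambda _ fun b => ?_
    have h1 : Measurable fun q : ((ℕ → Plane) × Plane) × (ℕ → Fin L → ℂ) =>
        ‖q.1.1 i - q.1.2‖ ^ (-α) := by fun_prop
    have h2 : Continuous fun q : ((ℕ → Plane) × Plane) × (ℕ → Fin L → ℂ) =>
        q.2 i a * star (q.2 i b) := by fun_prop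
    exact (Complex.measurable_ofReal.comp h1).mul h2.measurable
  simp_rw [interferenceCov_eq_fun]
  exact (measurable_pi_apply b).comp ((measurable_pi_apply a).comp h)

lemma measurable_sir {L : ℕ} (α : ℝ) :
    Measurable fun q : ((ℕ → Plane) × Plane) × ((Fin L → ℂ) × (ℕ → Fin L → ℂ)) =>
      sir α q.1.1 q.2.1 q.2.2 q.1.2 := by
  have hR : Measurable fun q : ((ℕ → Plane) × Plane) × ((Fin L → ℂ) × (ℕ → Fin L → ℂ)) =>
      (fun a b => interferenceCov α q.1.1 q.2.2 q.1.2 a b : Fin L → Fin L → ℂ) :=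
    measurable_pi_lambda _ fun a => measurable_pi_lambda _ fun b =>
      Measurable.comp (g := fun q : ((ℕ → Plane) × Plane) × (ℕ → Fin L → ℂ) =>
        interferenceCov α q.1.1 q.2 q.1.2 a b) (measurable_interferenceCov_apply α a b)
        (f := fun q : ((ℕ → Plane) × Plane) × ((Fin L → ℂ) × (ℕ → Fin L → ℂ)) => (q.1, q.2.2))
        (by fun_prop)
  have hid : Continuous fun M : Fin L → Fin L → ℂ => (Matrix.of M : Matrix (Fin L) (Fin L) ℂ) :=
    continuous_id
  have hinv : ∀ a b, Measurable fun M : Fin L → Fin L → ℂ => (Matrix.of M)⁻¹ a b := by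
    intro a b
    -- The adjugate formula for the inverse holds for singular matrices too, with `0⁻¹ = 0`.
    have h1 : Measurable fun M : Fin L → Fin L → ℂ => (Matrix.of M).det⁻¹ *
        (Matrix.of M).adjugate a b :=
      (hid.matrix_det.measurable.inv).mul (hid.matrix_adjugate.matrix_elem a b).measurable
    simp_rw [Matrix.inv_def, Ring.inverse_eq_inv', Matrix.smul_apply, smul_eq_mul]
    exact h1
  have hq : ∀ a, Measurable fun q : ((ℕ → Plane) × Plane) × ((Fin L → ℂ) × (ℕ → Fin L → ℂ)) =>
      q.2.1 a := fun a => by fun_prop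
  unfold sir
  refine Measurable.mul (by fun_prop) (Complex.measurable_re.comp ?_)
  simp only [dotProduct, Matrix.mulVec, Pi.star_apply]
  exact Finset.measurable_sum _ fun a _ => (continuous_star.measurable.comp (hq a)).mul
    (Finset.measurable_sum _ fun b _ => ((hinv a b).comp hR).mul (hq b))

/-! ### Success probability given the positions of the emitters -/

/-- A divergent series has `tsum` equal to 0. This dichotomy dispenses with a proof of almost sure
convergence: covariance 0 has inverse 0, so decoding is then impossible at a positive threshold and
the upper bound is trivial. -/
lemma interferenceCov_eq_zero_or_tendsto {L : ℕ} (α : ℝ) (x : ℕ → Plane) (g : ℕ → Fin L → ℂ)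
    (y : Plane) : interferenceCov α x g y = 0 ∨
      Tendsto (fun N => gramSum (fun i => ‖x i - y‖ ^ (-α)) g N) atTop
        (𝓝 (interferenceCov α x g y)) := by
  by_cases h : Summable fun i => (‖x i - y‖ ^ (-α) : ℝ) • Matrix.vecMulVec (g i) (star (g i))
  · exact Or.inr h.hasSum.tendsto_sum_nat
  · exact Or.inl (tsum_eq_zero_of_not_summable h)

lemma isClosed_posSemidef (L : ℕ) :
    IsClosed {M : Matrix (Fin L) (Fin L) ℂ | M.PosSemidef} := by
  have hset : {M : Matrix (Fin L) (Fin L) ℂ | M.PosSemidef} = {M | M.conjTranspose = M} ∩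
      ⋂ k : Fin L → ℂ, {M | 0 ≤ (star k ⬝ᵥ M.mulVec k).re} ∩ {M | 0 = (star k ⬝ᵥ M.mulVec k).im} := by
    ext M
    simp only [Set.mem_ofPred_eq, Matrix.posSemidef_iff_dotProduct_mulVec, Set.mem_inter_iff,
      Set.mem_iInter, Complex.nonneg_iff, Matrix.IsHermitian]
  have hc : ∀ k : Fin L → ℂ, Continuous fun M : Matrix (Fin L) (Fin L) ℂ => star k ⬝ᵥ M.mulVec k :=
    fun k => continuous_const.dotProduct (continuous_id.matrix_mulVec continuous_const)
  rw [hset]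
  refine (isClosed_eq continuous_id.matrix_conjTranspose continuous_id).inter
    (isClosed_iInter fun k => (isClosed_le continuous_const (Complex.continuous_re.comp (hc k))).inter
      (isClosed_eq continuous_const (Complex.continuous_im.comp (hc k))))

lemma interferenceCov_posSemidef {L : ℕ} (α : ℝ) (x : ℕ → Plane) (g : ℕ → Fin L → ℂ)
    (y : Plane) : (interferenceCov α x g y).PosSemidef := by
  rcases interferenceCov_eq_zero_or_tendsto α x g y with h | h
  · rw [h]; exact Matrix.PosSemidef.zero
  · exact (isClosed_posSemidef L).mem_of_tendsto h (Eventually.of_forall fun N =>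
      gramSum_posSemidef (fun j => by positivity) g N)

/-- Given the positions `x` of the other emitters, the probability that a receiver located at `y`
is feasible. -/
noncomputable def successProb {L : ℕ} (α β : ℝ) (x : ℕ → Plane) (y : Plane) : ℝ≥0∞ :=
  (Measure.infinitePi fun _ : Option ℕ => complexNormalVec L)
    {g | β ≤ sir α x (g none) (fun i => g (some i)) y}

lemma measurableSet_success {L : ℕ} (α β : ℝ) :
    MeasurableSet {q : ((ℕ → Plane) × Plane) × (Option ℕ → Fin L → ℂ) |
      β ≤ sir α q.1.1 (q.2 none) (fun i => q.2 (some i)) q.1.2} := by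
  refine measurableSet_le measurable_const ((measurable_sir α).comp (g := fun q :
    ((ℕ → Plane) × Plane) × ((Fin L → ℂ) × (ℕ → Fin L → ℂ)) => sir α q.1.1 q.2.1 q.2.2 q.1.2)
    (f := fun q : ((ℕ → Plane) × Plane) × (Option ℕ → Fin L → ℂ) =>
      (q.1, (q.2 none, fun i => q.2 (some i)))) (by fun_prop))

lemma measurable_successProb {L : ℕ} (α β : ℝ) :
    Measurable fun q : (ℕ → Plane) × Plane => successProb (L := L) α β q.1 q.2 :=
  measurable_measure_prodMk_left (measurableSet_success α β)

lemma successProb_eq_lintegral {L : ℕ} {α β : ℝ} (x : ℕ → Plane) {y : Plane} (hy : y ≠ 0) :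
    successProb (L := L) α β x y = ∫⁻ h, complexNormalVec L
      {g | β * ‖y‖ ^ α ≤ (star g ⬝ᵥ ((interferenceCov α x h y)⁻¹).mulVec g).re} ∂fadingLaw L := by
  have hy0 : 0 < ‖y‖ := norm_pos_iff.2 hy
  have hsir : ∀ (g₀ : Fin L → ℂ) (g : ℕ → Fin L → ℂ), β ≤ sir α x g₀ g y ↔
      β * ‖y‖ ^ α ≤ (star g₀ ⬝ᵥ ((interferenceCov α x g y)⁻¹).mulVec g₀).re := fun g₀ g => by
    rw [sir, Real.rpow_neg hy0.le, inv_mul_eq_div, le_div_iff₀ (by positivity)]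
  have hAx : MeasurableSet {g : Option ℕ → Fin L → ℂ |
      β ≤ sir α x (g none) (fun i => g (some i)) y} :=
    measurable_prodMk_left (x := (x, y)) (measurableSet_success (L := L) α β)
  have mp := measurePreserving_optionElim (complexNormalVec L) (Equiv.refl (Option ℕ))
  rw [successProb, ← mp.measure_preimage hAx.nullMeasurableSet,
    Measure.prod_apply_symm (hAx.preimage mp.measurable)]
  refine lintegral_congr fun h => ?_
  congr 1
  ext g
  exact hsir g h

/-- The tail formula integrates a continuous nonnegative function of the covariance, so Fatou's
lemma applies along the partial Gram sums. At least one antenna is needed for the zero matrix to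
have determinant 0. -/
lemma complexNormalVec_tail_le_liminf {L : ℕ} (α : ℝ) (x : ℕ → Plane) (y : Plane) {s : ℝ}
    (hs : 0 < s) (h : ℕ → Fin (L + 1) → ℂ) :
    complexNormalVec (L + 1) {g | s ≤ (star g ⬝ᵥ ((interferenceCov α x h y)⁻¹).mulVec g).re} ≤
      liminf (fun N => ∫⁻ k in {k : Fin (L + 1) → ℂ | s ≤ ∑ i, ‖k i‖ ^ 2},
        ENNReal.ofReal (Real.pi⁻¹ ^ (L + 1)) *
          ENNReal.ofReal (quadFormDensity (gramSum (fun i => ‖x i - y‖ ^ (-α)) h N) k)) atTop := by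
  rw [complexNormalVec_quadForm_tail (interferenceCov_posSemidef α x h y) hs]
  rcases interferenceCov_eq_zero_or_tendsto α x h y with h0 | htend
  · rw [h0, Matrix.det_zero]
    simp
  · have hm : ∀ N, Measurable fun k : Fin (L + 1) → ℂ => ENNReal.ofReal (Real.pi⁻¹ ^ (L + 1)) *
        ENNReal.ofReal (quadFormDensity (gramSum (fun i => ‖x i - y‖ ^ (-α)) h N) k) := fun N =>
      (continuous_quadFormDensity_right _).measurable.ennreal_ofReal.const_mul _
    refine le_trans (lintegral_mono fun k => ?_) (lintegral_liminf_le hm)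
    have hq : Tendsto (fun N => quadFormDensity (gramSum (fun i => ‖x i - y‖ ^ (-α)) h N) k) atTop
        (𝓝 (quadFormDensity (interferenceCov α x h y) k)) :=
      ((continuous_quadFormDensity k).tendsto (interferenceCov α x h y)).comp htend
    rw [Tendsto.liminf_eq (ENNReal.Tendsto.const_mul (ENNReal.tendsto_ofReal hq)
      (Or.inr ENNReal.ofReal_ne_top))]
    rfl

/-- A second use of Fatou, over the fading, bounds the success probability by a liminf of
distribution functions. They decrease in `N`, so the liminf is below each of them. -/
lemma successProb_le_trialsCDF {L : ℕ} {α β : ℝ} (hβ : 0 < β) (x : ℕ → Plane) {y : Plane}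
    (hy : y ≠ 0) (N : ℕ) :
    successProb (L := L + 1) α β x y ≤
      ENNReal.ofReal (trialsCDF (fun i => ‖x i - y‖ ^ (-α)) (β * ‖y‖ ^ α) N (L + 1)) := by
  have hp : ∀ j, 0 ≤ ‖x j - y‖ ^ (-α) := fun j => by positivity
  have hs : 0 < β * ‖y‖ ^ α := by have := norm_pos_iff.2 hy; positivity
  rw [successProb_eq_lintegral x hy]
  refine (lintegral_mono (complexNormalVec_tail_le_liminf α x y hs)).trans
    ((lintegral_liminf_le fun N => Measurable.lintegral_prod_right'
      ((continuous_quadFormDensity_gramSum _ N).measurable.ennreal_ofReal.const_mul _)).trans ?_)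
  refine (liminf_le_liminf (Eventually.of_forall fun N => lintegral_gramSum_tail_le hp N hs)).trans ?_
  have hanti : Antitone fun N => ENNReal.ofReal
      (trialsCDF (fun i => ‖x i - y‖ ^ (-α)) (β * ‖y‖ ^ α) N (L + 1)) :=
    antitone_nat_of_succ_le fun N => ENNReal.ofReal_le_ofReal (trialsCDF_succ_le hp hs.le N _)
  refine Filter.liminf_le_of_le (by isBoundedDefault) fun b hb => ?_
  obtain ⟨M, hM⟩ := eventually_atTop.1 hb
  exact (hM (max M N) (le_max_left _ _)).trans (hanti (le_max_right _ _))

/-! ### The extended negative exponential -/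

/-- The map `x ↦ e^{-x}` from `[0, ∞]` to `[0, 1]`. -/
noncomputable def expNeg (x : ℝ≥0∞) : ℝ≥0∞ := EReal.exp (-(x : EReal))

lemma continuous_expNeg : Continuous expNeg :=
  (ENNReal.continuous_exp : Continuous EReal.exp).comp (continuous_neg.comp continuous_coe_ennreal_ereal)

lemma measurable_expNeg : Measurable expNeg := continuous_expNeg.measurable

lemma antitone_expNeg : Antitone expNeg := fun a b hab => by
  unfold expNeg
  exact EReal.exp_monotone (EReal.neg_le_neg_iff.2 (EReal.coe_ennreal_le_coe_ennreal_iff.2 hab))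

@[simp] lemma expNeg_zero : expNeg 0 = 1 := by simp [expNeg]

lemma expNeg_le_one (x : ℝ≥0∞) : expNeg x ≤ 1 := by
  simpa using antitone_expNeg (zero_le (a := x))

lemma expNeg_add (a b : ℝ≥0∞) : expNeg (a + b) = expNeg a * expNeg b := by
  unfold expNeg
  rw [← EReal.exp_add, EReal.coe_ennreal_add, EReal.neg_add (by simp) (by simp), sub_eq_add_neg]

lemma expNeg_sum {ι : Type*} (s : Finset ι) (f : ι → ℝ≥0∞) :
    expNeg (∑ i ∈ s, f i) = ∏ i ∈ s, expNeg (f i) := by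
  classical
  induction s using Finset.induction_on with
  | empty => simp
  | insert a s ha ih => rw [Finset.sum_insert ha, Finset.prod_insert ha, expNeg_add, ih]

lemma expNeg_ofReal {r : ℝ} (hr : 0 ≤ r) :
    expNeg (ENNReal.ofReal r) = ENNReal.ofReal (Real.exp (-r)) := by
  unfold expNeg
  rw [EReal.coe_ennreal_ofReal, max_eq_left hr, ← EReal.coe_neg, EReal.exp_coe]

/-- Turns products of factors in `[0, 1]` into exponentials of sums; the factor 0 is allowed, as its
exponent is `⊤`. -/
lemma expNeg_neg_log {v : ℝ≥0∞} (hv : v ≤ 1) : expNeg (-(ENNReal.log v)).toENNReal = v := by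
  unfold expNeg
  have h : ENNReal.log v ≤ 0 := by
    rw [← ENNReal.log_one]
    exact ENNReal.log_monotone hv
  rw [EReal.coe_toENNReal (by simpa using EReal.neg_le_neg_iff.2 h), neg_neg, ENNReal.exp_log]

lemma tendsto_prod_expNeg (f : ℕ → ℝ≥0∞) :
    Tendsto (fun N => ∏ i ∈ Finset.range N, expNeg (f i)) atTop (𝓝 (expNeg (∑' i, f i))) := by
  simp_rw [← expNeg_sum]
  exact (continuous_expNeg.tendsto _).comp ENNReal.summable.hasSum.tendsto_sum_nat

/-! ### Functionals of a Poisson point process -/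

variable {Ω : Type*} [MeasurableSpace Ω] {P : Measure Ω}

lemma tsum_eq_lintegral_sum_dirac (x : ℕ → Plane) {f : Plane → ℝ≥0∞} (hf : Measurable f) :
    ∑' i, f (x i) = ∫⁻ z, f z ∂(Measure.sum fun i => Measure.dirac (x i)) := by
  rw [lintegral_sum_measure]
  exact tsum_congr fun i => (lintegral_dirac' _ hf).symm

lemma measurable_pointCount {X : ℕ → Ω → Plane} (hX : ∀ i, Measurable (X i)) {A : Set Plane}
    (hA : MeasurableSet A) : Measurable fun ω => pointCount (fun i => X i ω) A := by
  have : (fun ω => pointCount (fun i => X i ω) A) =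
      fun ω => ∑' i, A.indicator (fun _ => (1 : ℝ≥0∞)) (X i ω) := by
    ext ω
    rw [pointCount, Measure.sum_apply _ hA]
    exact tsum_congr fun i => Measure.dirac_apply' _ hA
  rw [this]
  exact Measurable.tsum fun i => (measurable_const.indicator hA).comp (hX i)

lemma lintegral_poisson {r : ℝ} (hr : 0 ≤ r) (f : ℕ → ℝ≥0∞) :
    ∫⁻ n, f n ∂(poissonMeasure r.toNNReal) =
      ∑' n : ℕ, ENNReal.ofReal (Real.exp (-r) * r ^ n / n.factorial) * f n := by
  rw [poissonMeasure, lintegral_sum_measure]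
  refine tsum_congr fun n => ?_
  rw [lintegral_smul_measure, lintegral_dirac, smul_eq_mul, Real.coe_toNNReal _ hr]

lemma lintegral_poisson_expNeg {r : ℝ} (hr : 0 ≤ r) {c : ℝ≥0∞} (hc : c ≠ ⊤) :
    ∫⁻ n : ℕ, expNeg (c * n) ∂(poissonMeasure r.toNNReal) =
      expNeg (ENNReal.ofReal r * (1 - expNeg c)) := by
  lift c to NNReal using hc
  rw [lintegral_poisson hr]
  have e1 : expNeg (c : ℝ≥0∞) = ENNReal.ofReal (Real.exp (-c)) := by
    rw [← expNeg_ofReal c.coe_nonneg]; simp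
  have e2 : ∀ n : ℕ, expNeg (c * n) = ENNReal.ofReal (Real.exp (-c) ^ n) := by
    intro n
    have : (c * n : ℝ≥0∞) = ENNReal.ofReal (n * c) := by
      rw [ENNReal.ofReal_mul (by positivity)]; simp [mul_comm]
    rw [this, expNeg_ofReal (by positivity), ← Real.exp_nat_mul]; simp
  have hexp : Real.exp (-(c : ℝ)) ≤ 1 := by simp
  rw [e1, ← ENNReal.ofReal_one, ← ENNReal.ofReal_sub _ (by positivity),
    ← ENNReal.ofReal_mul hr, expNeg_ofReal (mul_nonneg hr (by linarith))]
  have hs := (NormedSpace.expSeries_div_hasSum_exp (𝔸 := ℝ) (r * Real.exp (-c))).mul_left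
    (Real.exp (-r))
  rw [← Real.exp_eq_exp_ℝ, ← Real.exp_add] at hs
  rw [show -(r * (1 - Real.exp (-(c : ℝ)))) = -r + r * Real.exp (-c) by ring, ← hs.tsum_eq,
    ENNReal.ofReal_tsum_of_nonneg (fun n => by positivity) hs.summable]
  refine tsum_congr fun n => ?_
  rw [e2, ← ENNReal.ofReal_mul (by positivity)]
  congr 1
  rw [mul_pow]; ring

lemma lintegral_poisson_id {r : ℝ} (hr : 0 ≤ r) :
    ∫⁻ n : ℕ, (n : ℝ≥0∞) ∂(poissonMeasure r.toNNReal) = ENNReal.ofReal r := by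
  rw [lintegral_poisson hr, tsum_eq_zero_add' ENNReal.summable]
  have hs := (NormedSpace.expSeries_div_hasSum_exp (𝔸 := ℝ) r).mul_left (Real.exp (-r) * r)
  rw [← Real.exp_eq_exp_ℝ, mul_right_comm, ← Real.exp_add, neg_add_cancel, Real.exp_zero,
    one_mul] at hs
  rw [Nat.cast_zero, mul_zero, zero_add]
  conv_rhs => rw [← hs.tsum_eq]
  rw [ENNReal.ofReal_tsum_of_nonneg (fun n => by positivity) hs.summable]
  refine tsum_congr fun n => ?_
  rw [← ENNReal.ofReal_natCast, ← ENNReal.ofReal_mul (by positivity)]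
  congr 1
  rw [Nat.factorial_succ]
  push_cast
  field_simp
  ring

namespace IsPoissonProcess

variable {ρ : ℝ} {X : ℕ → Ω → Plane}

lemma lintegral_pointCount (hX : IsPoissonProcess P ρ X) {A : Set Plane}
    (hA : MeasurableSet A) (hfin : volume A < ⊤) {f : ℝ≥0∞ → ℝ≥0∞} (hf : Measurable f) :
    ∫⁻ ω, f (pointCount (fun i => X i ω) A) ∂P =
      ∫⁻ n : ℕ, f n ∂(poissonMeasure (ρ * (volume A).toReal).toNNReal) := by
  rw [(hX.count_law A hA hfin).lintegral_comp hf.aemeasurable,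
    lintegral_map hf (by fun_prop)]

/-- The sum over the points is a combination of the counts in the level sets of `s`; these are
independent and Poisson, so their Laplace transforms multiply. -/
lemma lintegral_expNeg_tsum_simpleFunc [IsProbabilityMeasure P]
    (hX : IsPoissonProcess P ρ X) (hρ : 0 ≤ ρ)
    (s : SimpleFunc Plane ℝ≥0∞) (hs : ∀ z, s z ≠ ⊤) (hv : ∀ c, c ≠ 0 → volume (s ⁻¹' {c}) < ⊤) :
    ∫⁻ ω, expNeg (∑' i, s (X i ω)) ∂P =
      expNeg (ENNReal.ofReal ρ * ∫⁻ z, (1 - expNeg (s z))) := by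
  have h1 : ∀ ω, expNeg (∑' i, s (X i ω)) =
      ∏ c ∈ s.range, expNeg (c * pointCount (fun i => X i ω) (s ⁻¹' {c})) := by
    intro ω
    rw [tsum_eq_lintegral_sum_dirac _ s.measurable, SimpleFunc.lintegral_eq_lintegral,
      SimpleFunc.lintegral, expNeg_sum]
    rfl
  have h2 : ∫⁻ z, (1 - expNeg (s z)) =
      ∑ c ∈ s.range, (1 - expNeg c) * volume (s ⁻¹' {c}) := by
    have := SimpleFunc.map_lintegral (μ := volume) (fun c => 1 - expNeg c) s
    rw [← SimpleFunc.lintegral_eq_lintegral] at this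
    simpa using this
  simp_rw [h1]
  rw [h2, Finset.mul_sum, expNeg_sum]
  have hind : iIndepFun (fun (c : s.range) ω => expNeg (c * pointCount (fun i => X i ω) (s ⁻¹' {(c : ℝ≥0∞)}))) P := by
    let e := s.range.equivFin
    have := hX.count_indep s.range.card (fun j => s ⁻¹' {((e.symm j : s.range) : ℝ≥0∞)})
      (fun j => s.measurableSet_preimage _) (fun j l hjl => by
        refine Disjoint.preimage _ ?_
        rw [Set.disjoint_singleton]
        intro h
        exact hjl (e.symm.injective (Subtype.ext h)))
    have h3 := this.precomp (g := e) e.injective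
    have h4 := h3.comp (fun (c : s.range) x => expNeg (c * x))
      (fun c => measurable_expNeg.comp (measurable_const_mul _))
    convert h4 using 3 with c
    simp
  have h5 := lintegral_prod_eq_prod_lintegral_of_indepFun Finset.univ _ hind (fun c => measurable_expNeg.comp
      ((measurable_pointCount hX.measurable (s.measurableSet_preimage _)).const_mul _))
  rw [← Finset.prod_coe_sort s.range (fun c => expNeg (ENNReal.ofReal ρ * ((1 - expNeg c) * volume (s ⁻¹' {c}))))]
  simp_rw [← Finset.prod_coe_sort s.range]
  rw [h5]
  refine Finset.prod_congr rfl fun c _ => ?_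
  -- The level set of the value 0 may have infinite area, but it contributes the factor 1.
  by_cases hc : (c : ℝ≥0∞) = 0
  · simp [hc]
  · have hc' : (c : ℝ≥0∞) ≠ ⊤ := by
      obtain ⟨z, hz⟩ := SimpleFunc.mem_range.1 c.2
      rw [← hz]; exact hs z
    rw [hX.lintegral_pointCount (s.measurableSet_preimage _) (hv _ hc)
      (f := fun x => expNeg (c * x)) (measurable_expNeg.comp (measurable_const_mul _)),
      lintegral_poisson_expNeg (by positivity) hc', ENNReal.ofReal_mul hρ,
      ENNReal.ofReal_toReal (hv _ hc).ne]
    congr 1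
    ring

/-- The Laplace functional of a Poisson point process. -/
theorem lintegral_expNeg_tsum [IsProbabilityMeasure P] (hX : IsPoissonProcess P ρ X) (hρ : 0 ≤ ρ)
    {f : Plane → ℝ≥0∞} (hf : Measurable f) :
    ∫⁻ ω, expNeg (∑' i, f (X i ω)) ∂P =
      expNeg (ENNReal.ofReal ρ * ∫⁻ z, (1 - expNeg (f z))) := by
  -- Truncation to balls gives the nonzero level sets finite area, as the simple case requires.
  let s : ℕ → SimpleFunc Plane ℝ≥0∞ := fun n =>
    (SimpleFunc.eapprox f n).restrict (Metric.ball 0 n)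
  have hs : ∀ n z, s n z = (Metric.ball 0 n).indicator (SimpleFunc.eapprox f n) z := fun n z => by
    simp only [s]
    rw [SimpleFunc.restrict_apply _ Metric.isOpen_ball.measurableSet]
  have hmono : ∀ z, Monotone fun n => s n z := fun z m n hmn => by
    simp only [hs]
    refine (Set.indicator_le_indicator (SimpleFunc.monotone_eapprox f hmn z)).trans ?_
    exact Set.indicator_le_indicator_of_subset
      (Metric.ball_subset_ball (by exact_mod_cast hmn)) (fun _ => zero_le) z
  have hlim : ∀ z, Tendsto (fun n => s n z) atTop (𝓝 (f z)) := fun z => by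
    refine (SimpleFunc.tendsto_eapprox hf z).congr' ?_
    obtain ⟨N, hN⟩ := exists_nat_gt ‖z‖
    filter_upwards [eventually_ge_atTop N] with n hn
    rw [hs, Set.indicator_of_mem]
    simpa using hN.trans_le (by exact_mod_cast hn)
  have key : ∀ n, ∫⁻ ω, expNeg (∑' i, s n (X i ω)) ∂P =
      expNeg (ENNReal.ofReal ρ * ∫⁻ z, (1 - expNeg (s n z))) := fun n => by
    refine hX.lintegral_expNeg_tsum_simpleFunc hρ (s n) (fun z => ?_) fun c hc => ?_
    · rw [hs]
      by_cases hz : z ∈ Metric.ball (0 : Plane) n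
      · rw [Set.indicator_of_mem hz]; exact (SimpleFunc.eapprox_lt_top f n z).ne
      · rw [Set.indicator_of_notMem hz]; simp
    · refine (measure_mono ?_).trans_lt (measure_ball_lt_top (μ := volume) (x := (0 : Plane)) (r := n))
      intro z hz
      by_contra hz'
      apply hc
      have : s n z = c := hz
      rw [← this, hs, Set.indicator_of_notMem hz']
  have hL : Tendsto (fun n => ∫⁻ ω, expNeg (∑' i, s n (X i ω)) ∂P) atTop
      (𝓝 (∫⁻ ω, expNeg (∑' i, f (X i ω)) ∂P)) := by
    refine tendsto_lintegral_of_dominated_convergence (fun _ => 1) (fun n => ?_) (fun n => ?_)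
      (by simp) ?_
    · exact measurable_expNeg.comp (Measurable.tsum fun i => (s n).measurable.comp (hX.measurable i))
    · exact Eventually.of_forall fun ω => expNeg_le_one _
    · refine Eventually.of_forall fun ω => (continuous_expNeg.tendsto _).comp ?_
      simp_rw [tsum_eq_lintegral_sum_dirac _ (s _).measurable, tsum_eq_lintegral_sum_dirac _ hf]
      exact lintegral_tendsto_of_tendsto_of_monotone (fun n => (s n).measurable.aemeasurable)
        (Eventually.of_forall hmono) (Eventually.of_forall hlim)
  have hR : Tendsto (fun n => expNeg (ENNReal.ofReal ρ * ∫⁻ z, (1 - expNeg (s n z)))) atTop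
      (𝓝 (expNeg (ENNReal.ofReal ρ * ∫⁻ z, (1 - expNeg (f z))))) := by
    refine (continuous_expNeg.tendsto _).comp (ENNReal.Tendsto.const_mul ?_ (Or.inr (by simp)))
    refine lintegral_tendsto_of_tendsto_of_monotone
      (fun n => (measurable_const.sub (measurable_expNeg.comp (s n).measurable)).aemeasurable)
      (Eventually.of_forall fun z m n hmn => tsub_le_tsub_left (antitone_expNeg (hmono z hmn)) _)
      (Eventually.of_forall fun z => ?_)
    exact ENNReal.Tendsto.sub tendsto_const_nhds ((continuous_expNeg.tendsto _).comp (hlim z))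
      (Or.inl (by simp))
  exact tendsto_nhds_unique hL (by simpa only [key] using hR)

/-- Campbell's formula for a Poisson point process. -/
theorem lintegral_tsum (hX : IsPoissonProcess P ρ X) (hρ : 0 ≤ ρ)
    {f : Plane → ℝ≥0∞} (hf : Measurable f) :
    ∫⁻ ω, ∑' i, f (X i ω) ∂P = ENNReal.ofReal ρ * ∫⁻ z, f z := by
  -- The intensity measure is a multiple of Lebesgue measure: on sets of finite area by the mean of
  -- the Poisson count, in general by exhaustion with balls.
  have hm : Measure.sum (fun i => P.map (X i)) = ENNReal.ofReal ρ • (volume : Measure Plane) := by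
    have hfin : ∀ A, MeasurableSet A → volume A < ⊤ →
        Measure.sum (fun i => P.map (X i)) A = (ENNReal.ofReal ρ • (volume : Measure Plane)) A := by
      intro A hA hA'
      have h1 := hX.lintegral_pointCount hA hA' measurable_id
      simp only [id] at h1
      rw [lintegral_poisson_id (by positivity), ENNReal.ofReal_mul hρ,
        ENNReal.ofReal_toReal hA'.ne] at h1
      rw [Measure.smul_apply, smul_eq_mul, ← h1, Measure.sum_apply _ hA]
      have h2 : ∀ ω, pointCount (fun i => X i ω) A = ∑' i, A.indicator 1 (X i ω) := fun ω => by
        rw [pointCount, Measure.sum_apply _ hA]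
        exact tsum_congr fun i => Measure.dirac_apply' _ hA
      simp_rw [h2]
      rw [MeasureTheory.lintegral_tsum (f := fun i ω => A.indicator 1 (X i ω)) fun i =>
        ((measurable_one.indicator hA).comp (hX.measurable i)).aemeasurable]
      refine tsum_congr fun i => ?_
      rw [Measure.map_apply (hX.measurable i) hA, ← lintegral_indicator_one (hX.measurable i hA)]
      rfl
    refine Measure.ext fun A hA => ?_
    have hU : A = ⋃ n : ℕ, A ∩ Metric.ball 0 n := by
      rw [← Set.inter_iUnion, Metric.iUnion_ball_nat, Set.inter_univ]
    have hmono : Monotone fun n : ℕ => A ∩ Metric.ball (0 : Plane) n := fun m n hmn =>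
      Set.inter_subset_inter_right _ (Metric.ball_subset_ball (by exact_mod_cast hmn))
    rw [hU, hmono.measure_iUnion, hmono.measure_iUnion]
    refine iSup_congr fun n => hfin _ (hA.inter Metric.isOpen_ball.measurableSet) ?_
    exact (measure_mono Set.inter_subset_right).trans_lt measure_ball_lt_top
  rw [MeasureTheory.lintegral_tsum (f := fun i ω => f (X i ω)) fun i => (hf.comp (hX.measurable i)).aemeasurable]
  have : ∀ i, ∫⁻ ω, f (X i ω) ∂P = ∫⁻ z, f z ∂(P.map (X i)) := fun i =>
    (lintegral_map hf (hX.measurable i)).symm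
  simp_rw [this]
  rw [← lintegral_sum_measure, hm, lintegral_smul_measure, smul_eq_mul]

/-- The probability generating functional of a Poisson point process. -/
theorem lintegral_iInf_prod [IsProbabilityMeasure P] (hX : IsPoissonProcess P ρ X) (hρ : 0 ≤ ρ)
    {v : Plane → ℝ≥0∞} (hv : Measurable v) (hv1 : ∀ z, v z ≤ 1) :
    ∫⁻ ω, ⨅ N, ∏ i ∈ Finset.range N, v (X i ω) ∂P =
      expNeg (ENNReal.ofReal ρ * ∫⁻ z, (1 - v z)) := by
  have hf : Measurable fun z => (-(ENNReal.log (v z))).toENNReal :=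
    (measurable_ereal_toENNReal).comp
      (measurable_neg.comp (ENNReal.measurable_log.comp hv))
  have h := hX.lintegral_expNeg_tsum hρ hf
  simp_rw [expNeg_neg_log (hv1 _)] at h
  rw [← h]
  refine lintegral_congr fun ω => ?_
  have h1 := tendsto_prod_expNeg fun i => (-(ENNReal.log (v (X i ω)))).toENNReal
  simp_rw [expNeg_neg_log (hv1 _)] at h1
  refine tendsto_nhds_unique (tendsto_atTop_iInf ?_) h1
  refine antitone_nat_of_succ_le fun n => ?_
  rw [Finset.prod_range_succ]
  exact mul_le_of_le_one_right' (hv1 _)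

end IsPoissonProcess

/-! ### Infinitely many trials -/

lemma eval_trialsPGF (p : ℕ → ℝ) (κ t : ℝ) (N : ℕ) :
    (trialsPGF p κ N).eval t =
      ∏ j ∈ Finset.range N, ((1 + p j * κ)⁻¹ + p j * κ * (1 + p j * κ)⁻¹ * t) := by
  simp [trialsPGF, Polynomial.eval_prod]

lemma hasSum_coeff_trialsPGF (p : ℕ → ℝ) (κ t : ℝ) (N : ℕ) :
    HasSum (fun m => (trialsPGF p κ N).coeff m * t ^ m) ((trialsPGF p κ N).eval t) := by
  rw [Polynomial.eval_eq_sum_range]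
  refine hasSum_sum_of_ne_finset_zero fun m hm => ?_
  rw [Polynomial.coeff_eq_zero_of_natDegree_lt, zero_mul]
  simpa using hm

lemma trialsPGF_coeff_le_one {p : ℕ → ℝ} (hp : ∀ j, 0 ≤ p j) {κ : ℝ} (hκ : 0 ≤ κ) (N m : ℕ) :
    (trialsPGF p κ N).coeff m ≤ 1 := by
  have h := hasSum_coeff_trialsPGF p κ 1 N
  simp only [one_pow, mul_one] at h
  refine (le_hasSum h m fun j _ => trialsPGF_coeff_nonneg hp hκ N j).trans_eq ?_
  rw [eval_trialsPGF]
  refine Finset.prod_eq_one fun j _ => ?_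
  have := mul_nonneg (hp j) hκ
  field_simp

/-- The probability of fewer than `m` successes in infinitely many trials. -/
noncomputable def trialsLimit (p : ℕ → ℝ) (κ : ℝ) (m : ℕ) : ℝ := ⨅ N, trialsCDF p κ N m

lemma tendsto_trialsCDF {p : ℕ → ℝ} (hp : ∀ j, 0 ≤ p j) {κ : ℝ} (hκ : 0 ≤ κ) (m : ℕ) :
    Tendsto (fun N => trialsCDF p κ N m) atTop (𝓝 (trialsLimit p κ m)) :=
  tendsto_atTop_ciInf (antitone_nat_of_succ_le fun N => trialsCDF_succ_le hp hκ N m)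
    ⟨0, by rintro _ ⟨N, rfl⟩; exact trialsCDF_nonneg hp hκ N m⟩

/-- The probability of exactly `m` successes in infinitely many trials. -/
noncomputable def trialsMass (p : ℕ → ℝ) (κ : ℝ) (m : ℕ) : ℝ :=
  trialsLimit p κ (m + 1) - trialsLimit p κ m

lemma tendsto_trialsPGF_coeff {p : ℕ → ℝ} (hp : ∀ j, 0 ≤ p j) {κ : ℝ} (hκ : 0 ≤ κ) (m : ℕ) :
    Tendsto (fun N => (trialsPGF p κ N).coeff m) atTop (𝓝 (trialsMass p κ m)) := by
  refine ((tendsto_trialsCDF hp hκ (m + 1)).sub (tendsto_trialsCDF hp hκ m)).congr fun N => ?_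
  rw [trialsCDF, trialsCDF, Finset.sum_range_succ, add_sub_cancel_left]

lemma trialsMass_nonneg {p : ℕ → ℝ} (hp : ∀ j, 0 ≤ p j) {κ : ℝ} (hκ : 0 ≤ κ) (m : ℕ) :
    0 ≤ trialsMass p κ m :=
  ge_of_tendsto' (tendsto_trialsPGF_coeff hp hκ m) fun N => trialsPGF_coeff_nonneg hp hκ N m

lemma trialsMass_le_one {p : ℕ → ℝ} (hp : ∀ j, 0 ≤ p j) {κ : ℝ} (hκ : 0 ≤ κ) (m : ℕ) :
    trialsMass p κ m ≤ 1 :=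
  le_of_tendsto' (tendsto_trialsPGF_coeff hp hκ m) fun N => trialsPGF_coeff_le_one hp hκ N m

lemma trialsLimit_eq_sum (p : ℕ → ℝ) (κ : ℝ) (m : ℕ) :
    trialsLimit p κ m = ∑ i ∈ Finset.range m, trialsMass p κ i := by
  simp_rw [trialsMass, Finset.sum_range_sub]
  simp [trialsLimit, trialsCDF]

/-- Dominated convergence with the geometric series `t ^ m`. At `t = 1` it can fail, since the
number of successes may tend to infinity. -/
lemma tendsto_eval_trialsPGF {p : ℕ → ℝ} (hp : ∀ j, 0 ≤ p j) {κ : ℝ} (hκ : 0 ≤ κ) {t : ℝ}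
    (ht0 : 0 ≤ t) (ht1 : t < 1) :
    Tendsto (fun N => (trialsPGF p κ N).eval t) atTop (𝓝 (∑' m, trialsMass p κ m * t ^ m)) := by
  simp_rw [← (hasSum_coeff_trialsPGF p κ t _).tsum_eq]
  refine tendsto_tsum_of_dominated_convergence (summable_geometric_of_lt_one ht0 ht1)
    (fun m => (tendsto_trialsPGF_coeff hp hκ m).mul_const _) (Eventually.of_forall fun N m => ?_)
  have h1 := trialsPGF_coeff_nonneg hp hκ N m
  have h2 := trialsPGF_coeff_le_one hp hκ N m
  rw [Real.norm_of_nonneg (by positivity)]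
  exact mul_le_of_le_one_left (by positivity) h2

lemma measurable_trialsPGF_coeff_left (κ : ℝ) (N m : ℕ) :
    Measurable fun p : ℕ → ℝ => (trialsPGF p κ N).coeff m := by
  induction N generalizing m with
  | zero => simp [trialsPGF]
  | succ N ih =>
    simp_rw [trialsPGF_succ]
    cases m with
    | zero =>
      simp_rw [coeff_linear_mul_zero]
      have := ih 0
      fun_prop
    | succ m =>
      simp_rw [coeff_linear_mul_succ]
      have h1 := ih m
      have h2 := ih (m + 1)
      fun_prop

lemma measurable_trialsCDF (κ : ℝ) (N m : ℕ) :
    Measurable fun p : ℕ → ℝ => trialsCDF p κ N m :=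
  Finset.measurable_sum _ fun i _ => measurable_trialsPGF_coeff_left κ N i

lemma measurable_trialsMass (κ : ℝ) (m : ℕ) : Measurable fun p : ℕ → ℝ => trialsMass p κ m := by
  unfold trialsMass trialsLimit
  exact (Measurable.iInf fun N => measurable_trialsCDF κ N _).sub
    (Measurable.iInf fun N => measurable_trialsCDF κ N _)

/-- A bounded sequence whose generating function vanishes on `(0, 1)` is zero. -/
lemma eq_zero_of_tsum_mul_pow_eq_zero {b : ℕ → ℝ} {C : ℝ} (hb : ∀ m, |b m| ≤ C)
    (h : ∀ t : ℝ, 0 < t → t < 1 → ∑' m, b m * t ^ m = 0) (n : ℕ) : b n = 0 := by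
  induction n using Nat.strong_induction_on with
  | _ n ih =>
    have hC : 0 ≤ C := (abs_nonneg _).trans (hb 0)
    -- Once the lower coefficients vanish, dividing by `t ^ n` leaves `b n` plus a remainder of size
    -- at most `t C / (1 - t)`; then `t → 0`.
    have key : ∀ t : ℝ, 0 < t → t < 1 → |b n| * (1 - t) ≤ t * C := by
      intro t ht0 ht1
      have hg := summable_geometric_of_lt_one ht0.le ht1
      have hsum : ∀ k, Summable fun m => b (m + k) * t ^ m := fun k =>
        Summable.of_norm_bounded (g := fun m => C * t ^ m) (hg.mul_left C) fun m => by
          rw [norm_mul, Real.norm_eq_abs, Real.norm_of_nonneg (by positivity)]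
          exact mul_le_mul_of_nonneg_right (hb _) (by positivity)
      have h1 := h t ht0 ht1
      rw [← (show Summable fun m => b m * t ^ m from hsum 0).sum_add_tsum_nat_add n, Finset.sum_eq_zero, zero_add] at h1
      · have h2 : ∑' m, b (m + n) * t ^ m = 0 := by
          have : ∑' m, b (m + n) * t ^ (m + n) = (∑' m, b (m + n) * t ^ m) * t ^ n := by
            rw [← tsum_mul_right]
            exact tsum_congr fun m => by rw [pow_add]; ring
          rw [this] at h1
          exact (mul_eq_zero.1 h1).resolve_right (by positivity)
        rw [(hsum n).tsum_eq_zero_add] at h2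
        simp only [zero_add, pow_zero, mul_one] at h2
        have h3 : |∑' m, b (m + 1 + n) * t ^ (m + 1)| ≤ t * C * (1 - t)⁻¹ := by
          rw [← tsum_geometric_of_lt_one ht0.le ht1, ← tsum_mul_left, ← Real.norm_eq_abs]
          refine tsum_of_norm_bounded (hg.mul_left (t * C)).hasSum fun m => ?_
          rw [norm_mul, Real.norm_eq_abs, Real.norm_of_nonneg (by positivity), pow_succ]
          nlinarith [mul_le_mul_of_nonneg_right (hb (m + 1 + n)) (by positivity : 0 ≤ t ^ m * t)]
        rw [eq_neg_of_add_eq_zero_left h2, abs_neg]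
        refine (mul_le_mul_of_nonneg_right h3 (by linarith)).trans_eq ?_
        rw [mul_assoc, inv_mul_cancel₀ (by linarith), mul_one]
      · intro i hi
        simp [ih i (by simpa using hi)]
    have hl : Tendsto (fun t : ℝ => |b n| * (1 - t)) (𝓝[>] 0) (𝓝 (|b n| * (1 - 0))) :=
      tendsto_nhdsWithin_of_tendsto_nhds (Continuous.tendsto (by fun_prop) 0)
    have hr : Tendsto (fun t : ℝ => t * C) (𝓝[>] 0) (𝓝 (0 * C)) :=
      tendsto_nhdsWithin_of_tendsto_nhds (Continuous.tendsto (by fun_prop) 0)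
    have := le_of_tendsto_of_tendsto hl hr (by
      filter_upwards [Ioo_mem_nhdsGT (zero_lt_one' ℝ)] with t ht using key t ht.1 ht.2)
    simp only [sub_zero, mul_one, zero_mul] at this
    exact abs_eq_zero.1 (le_antisymm this (abs_nonneg _))

/-- Independent trials attached to the points of a Poisson process have a Poisson number of
successes. -/
theorem IsPoissonProcess.lintegral_trialsMass [IsProbabilityMeasure P] {ρ : ℝ}
    {X : ℕ → Ω → Plane} (hX : IsPoissonProcess P ρ X) (hρ : 0 ≤ ρ) {w : Plane → ℝ}
    (hw : Measurable w) (hw0 : ∀ z, 0 ≤ w z) {κ μ : ℝ} (hκ : 0 ≤ κ) (hμ0 : 0 ≤ μ)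
    (hμ : ENNReal.ofReal ρ * ∫⁻ z, ENNReal.ofReal (w z * κ * (1 + w z * κ)⁻¹) = ENNReal.ofReal μ)
    (m : ℕ) :
    ∫⁻ ω, ENNReal.ofReal (trialsMass (fun i => w (X i ω)) κ m) ∂P =
      ENNReal.ofReal (Real.exp (-μ) * μ ^ m / m.factorial) := by
  set A : ℕ → ℝ≥0∞ := fun m => ∫⁻ ω, ENNReal.ofReal (trialsMass (fun i => w (X i ω)) κ m) ∂P
    with hA
  have hA1 : ∀ m, A m ≤ 1 := fun m => by
    refine (lintegral_mono fun ω => ENNReal.ofReal_le_ofReal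
      (trialsMass_le_one (fun i => hw0 _) hκ m)).trans ?_
    simp
  have hAtop : ∀ m, A m ≠ ⊤ := fun m => ((hA1 m).trans_lt ENNReal.one_lt_top).ne
  have hwX : Measurable fun ω => (fun i => w (X i ω)) :=
    measurable_pi_lambda _ fun i => hw.comp (hX.measurable i)
  -- Each trial contributes the factor `1 - (1 - t) q(z)`, with `q` its success probability. The
  -- generating functional of the Poisson process then gives `exp(-(1 - t) μ)`, the Poisson
  -- generating function.
  have key : ∀ t : ℝ, 0 < t → t < 1 →
      ∑' m, A m * ENNReal.ofReal (t ^ m) = ENNReal.ofReal (Real.exp (-((1 - t) * μ))) := by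
    intro t ht0 ht1
    have hq : ∀ z, 0 ≤ w z * κ * (1 + w z * κ)⁻¹ := fun z => by
      have := mul_nonneg (hw0 z) hκ
      positivity
    have hq1 : ∀ z, w z * κ * (1 + w z * κ)⁻¹ ≤ 1 := fun z => by
      have := mul_nonneg (hw0 z) hκ
      rw [← div_eq_mul_inv, div_le_one (by positivity)]
      linarith
    have hfac : ∀ z, (1 + w z * κ)⁻¹ + w z * κ * (1 + w z * κ)⁻¹ * t =
        1 - (1 - t) * (w z * κ * (1 + w z * κ)⁻¹) := fun z => by
      have := mul_nonneg (hw0 z) hκ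
      field_simp
      ring
    have hfac0 : ∀ z, 0 ≤ 1 - (1 - t) * (w z * κ * (1 + w z * κ)⁻¹) := fun z => by
      nlinarith [hq z, hq1 z]
    have hmv : Measurable fun z =>
        ENNReal.ofReal (1 - (1 - t) * (w z * κ * (1 + w z * κ)⁻¹)) := by fun_prop
    have h1 := hX.lintegral_iInf_prod hρ hmv fun z => by
      rw [ENNReal.ofReal_le_one]
      nlinarith [hq z]
    have h2 : ∀ ω, ⨅ N, ∏ i ∈ Finset.range N,
        ENNReal.ofReal (1 - (1 - t) * (w (X i ω) * κ * (1 + w (X i ω) * κ)⁻¹)) =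
        ENNReal.ofReal (∑' m, trialsMass (fun i => w (X i ω)) κ m * t ^ m) := by
      intro ω
      refine tendsto_nhds_unique (tendsto_atTop_iInf ?_) (((ENNReal.continuous_ofReal.tendsto _).comp
        (tendsto_eval_trialsPGF (fun i => hw0 _) hκ ht0.le ht1)).congr fun N => ?_)
      · refine antitone_nat_of_succ_le fun n => ?_
        rw [Finset.prod_range_succ]
        refine mul_le_of_le_one_right' ?_
        rw [ENNReal.ofReal_le_one]
        nlinarith [hq (X n ω)]
      · rw [Function.comp_apply, eval_trialsPGF, ENNReal.ofReal_prod_of_nonneg]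
        · exact Finset.prod_congr rfl fun j _ => by rw [hfac]
        · intro j _
          rw [hfac]
          exact hfac0 _
    have h3 : ∀ ω, ENNReal.ofReal (∑' m, trialsMass (fun i => w (X i ω)) κ m * t ^ m) =
        ∑' m, ENNReal.ofReal (trialsMass (fun i => w (X i ω)) κ m) * ENNReal.ofReal (t ^ m) := by
      intro ω
      have hnn := fun m => trialsMass_nonneg (p := fun i => w (X i ω)) (fun i => hw0 _) hκ m
      rw [ENNReal.ofReal_tsum_of_nonneg (fun m => mul_nonneg (hnn m) (by positivity))]
      · exact tsum_congr fun m => ENNReal.ofReal_mul (hnn m)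
      · refine Summable.of_nonneg_of_le (fun m => mul_nonneg (hnn m) (by positivity)) (fun m => ?_)
          (summable_geometric_of_lt_one ht0.le ht1)
        exact mul_le_of_le_one_left (by positivity) (trialsMass_le_one (fun i => hw0 _) hκ m)
    simp_rw [h2, h3] at h1
    have hmm : ∀ m, Measurable fun ω => ENNReal.ofReal (trialsMass (fun i => w (X i ω)) κ m) :=
      fun m => ((measurable_trialsMass κ m).comp hwX).ennreal_ofReal
    rw [MeasureTheory.lintegral_tsum fun m => ((hmm m).mul_const _).aemeasurable] at h1
    simp_rw [lintegral_mul_const _ (hmm _)] at h1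
    rw [h1]
    have h4 : ∀ z, 1 - ENNReal.ofReal (1 - (1 - t) * (w z * κ * (1 + w z * κ)⁻¹)) =
        ENNReal.ofReal (1 - t) * ENNReal.ofReal (w z * κ * (1 + w z * κ)⁻¹) := fun z => by
      rw [← ENNReal.ofReal_mul (by linarith), ← ENNReal.ofReal_one,
        ← ENNReal.ofReal_sub _ (hfac0 z)]
      congr 1
      ring
    simp_rw [h4]
    rw [lintegral_const_mul _ (by fun_prop), mul_left_comm, hμ, ← ENNReal.ofReal_mul (by linarith),
      expNeg_ofReal (mul_nonneg (by linarith) hμ0)]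
  have hreal : ∀ m, (A m).toReal - Real.exp (-μ) * μ ^ m / m.factorial = 0 := by
    have hexp : ∀ m : ℕ, Real.exp (-μ) * μ ^ m / m.factorial ≤ 1 := fun m => by
      have := Real.pow_div_factorial_le_exp μ hμ0 m
      rw [mul_div_assoc]
      refine (mul_le_mul_of_nonneg_left this (Real.exp_nonneg _)).trans_eq ?_
      rw [← Real.exp_add]
      simp
    refine eq_zero_of_tsum_mul_pow_eq_zero (C := 1) (fun m => ?_) fun t ht0 ht1 => ?_
    · have h1 : (A m).toReal ≤ 1 := ENNReal.toReal_le_of_le_ofReal zero_le_one (by simpa using hA1 m)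
      have h2 : 0 ≤ (A m).toReal := ENNReal.toReal_nonneg
      have h3 : 0 ≤ Real.exp (-μ) * μ ^ m / m.factorial := by positivity
      rw [abs_le]
      constructor <;> linarith [hexp m]
    · have h1 := congrArg ENNReal.toReal (key t ht0 ht1)
      rw [ENNReal.tsum_toReal_eq fun m => ENNReal.mul_ne_top (hAtop m) (by simp),
        ENNReal.toReal_ofReal (Real.exp_nonneg _)] at h1
      simp_rw [ENNReal.toReal_mul, ENNReal.toReal_ofReal (pow_nonneg ht0.le _)] at h1
      have hs := (NormedSpace.expSeries_div_hasSum_exp (𝔸 := ℝ) (μ * t)).mul_left (Real.exp (-μ))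
      rw [← Real.exp_eq_exp_ℝ, ← Real.exp_add] at hs
      have hs' : HasSum (fun m : ℕ => Real.exp (-μ) * μ ^ m / m.factorial * t ^ m)
          (Real.exp (-((1 - t) * μ))) := by
        rw [show -((1 - t) * μ) = -μ + μ * t by ring]
        exact hs.congr_fun fun m => by rw [mul_pow]; ring
      have hsA : Summable fun m => (A m).toReal * t ^ m :=
        Summable.of_nonneg_of_le (fun m => mul_nonneg ENNReal.toReal_nonneg (by positivity))
          (fun m => mul_le_of_le_one_left (by positivity)
            (ENNReal.toReal_le_of_le_ofReal zero_le_one (by simpa using hA1 m)))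
          (summable_geometric_of_lt_one ht0.le ht1)
      simp_rw [sub_mul]
      rw [hsA.tsum_sub hs'.summable, h1, hs'.tsum_eq, sub_self]
  rw [← sub_eq_zero.1 (hreal m), ENNReal.ofReal_toReal (hAtop m)]

/-! ### Gamma integrals -/

/-- A nonzero Bochner integral forces integrability, so known real integrals transfer without a
separate check. -/
lemma lintegral_ofReal_eq_of_integral_pos {E : Type*} [MeasurableSpace E] {μ : Measure E}
    {f : E → ℝ} (hf : 0 ≤ᵐ[μ] f) {c : ℝ} (hc : 0 < c) (h : ∫ x, f x ∂μ = c) :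
    ∫⁻ x, ENNReal.ofReal (f x) ∂μ = ENNReal.ofReal c := by
  rw [← h, ofReal_integral_eq_lintegral_ofReal (Integrable.of_integral_ne_zero (by
    rw [h]; exact hc.ne')) hf]

lemma lintegral_rpow_mul_exp_neg_mul_Ioi {a r : ℝ} (ha : 0 < a) (hr : 0 < r) :
    ∫⁻ t in Set.Ioi (0 : ℝ), ENNReal.ofReal (t ^ (a - 1) * Real.exp (-(r * t))) =
      ENNReal.ofReal ((1 / r) ^ a * Real.Gamma a) := by
  have := Real.Gamma_pos_of_pos ha
  refine lintegral_ofReal_eq_of_integral_pos ?_ (by positivity)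
    (Real.integral_rpow_mul_exp_neg_mul_Ioi ha hr)
  filter_upwards [ae_restrict_mem measurableSet_Ioi] with t ht
  have : 0 < t := ht
  show 0 ≤ t ^ (a - 1) * Real.exp (-(r * t))
  positivity

lemma lintegral_exp_neg_mul_norm_rpow {α t : ℝ} (hα : 0 < α) (ht : 0 < t) :
    ∫⁻ z : Plane, ENNReal.ofReal (Real.exp (-(t * ‖z‖ ^ α))) =
      ENNReal.ofReal (2 * Real.pi / α * Real.Gamma (2 / α) * (1 / t) ^ (2 / α)) := by
  have := Real.Gamma_pos_of_pos (show 0 < 2 / α by positivity)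
  have := Real.pi_pos
  refine lintegral_ofReal_eq_of_integral_pos
    (Eventually.of_forall fun z => (Real.exp_nonneg _)) (by positivity) ?_
  rw [integral_fun_norm_addHaar volume fun r => Real.exp (-(t * r ^ α))]
  have h1 : ∫ y in Set.Ioi (0 : ℝ), y ^ (Module.finrank ℝ Plane - 1) •
      Real.exp (-(t * y ^ α)) = ∫ y in Set.Ioi (0 : ℝ), y ^ (1 : ℝ) * Real.exp (-t * y ^ α) := by
    simp [finrank_euclideanSpace]
  rw [h1, integral_rpow_mul_exp_neg_mul_rpow hα (by norm_num) ht]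
  have h2 : (volume : Measure Plane).real (Metric.ball 0 1) = Real.pi := by
    simp [Measure.real, Real.pi_pos.le]
  rw [h2, show (1 / t) ^ (2 / α) = t ^ (-(1 + 1) / α) by
    rw [one_div, Real.inv_rpow ht.le, ← Real.rpow_neg ht.le]; norm_num [neg_div]]
  simp [finrank_euclideanSpace]
  norm_num
  ring

lemma Delta_pos {α : ℝ} (hα : 2 < α) : 0 < Delta α := by
  have h0 : 0 < α := by linarith
  have h1 := Real.Gamma_pos_of_pos (show 0 < 2 / α by positivity)
  have h2 := Real.Gamma_pos_of_pos (show 0 < 1 - 2 / α by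
    rw [sub_pos, div_lt_one h0]; exact hα)
  have := Real.pi_pos
  unfold Delta
  positivity

/-- The integrated success probability of the trials attached to the interferers. -/
lemma lintegral_pathLoss_div_one_add {α κ : ℝ} (hα : 2 < α) (hκ : 0 < κ) (y : Plane) :
    ∫⁻ z : Plane, ENNReal.ofReal (‖z - y‖ ^ (-α) * κ * (1 + ‖z - y‖ ^ (-α) * κ)⁻¹) =
      ENNReal.ofReal (κ ^ (2 / α) * Delta α) := by
  have h0 : 0 < α := by linarith
  rw [lintegral_sub_right_eq_self (fun z : Plane =>
    ENNReal.ofReal (‖z‖ ^ (-α) * κ * (1 + ‖z‖ ^ (-α) * κ)⁻¹)) y]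
  -- The integrand equals `κ / (κ + |z|^α)`, an exponential integral over `t`. Swapping the order
  -- leaves a radial Gamma integral in `z`, then one in `t`. The origin is excluded because `0 ^
  -- (-α)` is 0 by convention.
  have h1 : ∀ᵐ z : Plane, ENNReal.ofReal (‖z‖ ^ (-α) * κ * (1 + ‖z‖ ^ (-α) * κ)⁻¹) =
      ∫⁻ t in Set.Ioi (0 : ℝ), ENNReal.ofReal (κ * Real.exp (-(κ * t))) *
        ENNReal.ofReal (Real.exp (-(t * ‖z‖ ^ α))) := by
    filter_upwards [Measure.ae_ne volume (0 : Plane)] with z hz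
    have hz' : 0 < ‖z‖ := norm_pos_iff.2 hz
    have hb : 0 < ‖z‖ ^ α := by positivity
    have e1 : ‖z‖ ^ (-α) * κ * (1 + ‖z‖ ^ (-α) * κ)⁻¹ = κ * (1 / (κ + ‖z‖ ^ α)) := by
      rw [Real.rpow_neg hz'.le]
      field_simp
      ring
    have h2 := lintegral_rpow_mul_exp_neg_mul_Ioi one_pos (add_pos hκ hb)
    simp only [sub_self, Real.rpow_zero, one_mul, Real.rpow_one, Real.Gamma_one, mul_one] at h2
    rw [e1, ENNReal.ofReal_mul hκ.le, ← h2, ← lintegral_const_mul _ (by fun_prop)]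
    refine lintegral_congr fun t => ?_
    rw [← ENNReal.ofReal_mul hκ.le, ← ENNReal.ofReal_mul (by positivity), mul_assoc,
      ← Real.exp_add]
    congr 3
    ring
  rw [lintegral_congr_ae h1, lintegral_lintegral_swap (by fun_prop)]
  have h3 : ∀ t ∈ Set.Ioi (0 : ℝ), ∫⁻ z : Plane, ENNReal.ofReal (κ * Real.exp (-(κ * t))) *
      ENNReal.ofReal (Real.exp (-(t * ‖z‖ ^ α))) =
      ENNReal.ofReal (κ * (2 * Real.pi / α * Real.Gamma (2 / α))) *
        ENNReal.ofReal (t ^ (1 - 2 / α - 1) * Real.exp (-(κ * t))) := by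
    intro t ht
    have ht' : 0 < t := ht
    have := Real.Gamma_pos_of_pos (show 0 < 2 / α by positivity)
    have := Real.pi_pos
    rw [lintegral_const_mul _ (by fun_prop), lintegral_exp_neg_mul_norm_rpow h0 ht,
      ← ENNReal.ofReal_mul (by positivity), ← ENNReal.ofReal_mul (by positivity)]
    congr 1
    rw [one_div, Real.inv_rpow ht'.le, ← Real.rpow_neg ht'.le,
      show 1 - 2 / α - 1 = -(2 / α) by ring]
    ring
  have h4 : 0 < 1 - 2 / α := by rw [sub_pos, div_lt_one h0]; exact hα
  rw [setLIntegral_congr_fun measurableSet_Ioi h3, lintegral_const_mul _ (by fun_prop),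
    lintegral_rpow_mul_exp_neg_mul_Ioi h4 hκ]
  have := Real.Gamma_pos_of_pos (show 0 < 2 / α by positivity)
  have := Real.pi_pos
  rw [← ENNReal.ofReal_mul (by positivity)]
  congr 1
  have e : κ ^ (2 / α) = κ * (1 / κ) ^ (1 - 2 / α) := by
    rw [one_div, Real.inv_rpow hκ.le, ← Real.rpow_neg hκ.le]
    nth_rewrite 2 [← Real.rpow_one κ]
    rw [← Real.rpow_add hκ]
    congr 1
    ring
  rw [e, Delta]
  ring

lemma gammaInc_integrand_nonneg {s z : ℝ} (hz : 0 ≤ z) :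
    ∀ᵐ t ∂(volume.restrict (Set.Ioi z)), 0 ≤ t ^ (s - 1) * Real.exp (-t) := by
  filter_upwards [ae_restrict_mem measurableSet_Ioi] with t ht
  have : 0 < t := hz.trans_lt ht
  positivity

lemma integrableOn_gammaInc {s z : ℝ} (hs : 0 < s) (hz : 0 ≤ z) :
    IntegrableOn (fun t => t ^ (s - 1) * Real.exp (-t)) (Set.Ioi z) := by
  have := (Real.GammaIntegral_convergent hs).mono_set (Set.Ioi_subset_Ioi hz)
  simpa only [mul_comm] using this

lemma ofReal_gammaInc {s z : ℝ} (hs : 0 < s) (hz : 0 ≤ z) :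
    ENNReal.ofReal (GammaInc s z) =
      ∫⁻ t in Set.Ioi z, ENNReal.ofReal (t ^ (s - 1) * Real.exp (-t)) :=
  ofReal_integral_eq_lintegral_ofReal (integrableOn_gammaInc hs hz) (gammaInc_integrand_nonneg hz)

lemma gammaInc_nonneg {s z : ℝ} (hz : 0 ≤ z) : 0 ≤ GammaInc s z :=
  integral_nonneg_of_ae (gammaInc_integrand_nonneg hz)

lemma gammaInc_zero {s : ℝ} (hs : 0 < s) : GammaInc s 0 = Real.Gamma s := by
  rw [Real.Gamma_eq_integral hs, GammaInc]
  simp only [mul_comm]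

/-- Substitution `t = (q x)²`. -/
lemma lintegral_pow_mul_exp_neg_sq_Ioi {q z : ℝ} (hq : 0 < q) (hz : 0 ≤ z) (m : ℕ) :
    ∫⁻ x in Set.Ioi z, ENNReal.ofReal (x ^ (2 * m) * Real.exp (-(q * x) ^ 2)) =
      ENNReal.ofReal (GammaInc (1 / 2 + m) ((q * z) ^ 2) / (2 * q ^ (2 * m + 1))) := by
  have himg : (fun x => (q * x) ^ 2) '' Set.Ioi z = Set.Ioi ((q * z) ^ 2) := by
    ext t
    constructor
    · rintro ⟨x, hx, rfl⟩
      have : z < x := hx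
      show (q * z) ^ 2 < (q * x) ^ 2
      gcongr
    · intro ht
      have ht' : (q * z) ^ 2 < t := ht
      have ht0 : 0 < t := (sq_nonneg _).trans_lt ht'
      refine ⟨√t / q, ?_, ?_⟩
      · show z < √t / q
        rw [lt_div_iff₀ hq, mul_comm]
        exact Real.lt_sqrt_of_sq_lt ht'
      · show (q * (√t / q)) ^ 2 = t
        rw [mul_div_cancel₀ _ hq.ne', Real.sq_sqrt ht0.le]
  have hinj : Set.InjOn (fun x => (q * x) ^ 2) (Set.Ioi z) := by
    intro a ha b hb hab
    have ha' : 0 < a := hz.trans_lt ha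
    have hb' : 0 < b := hz.trans_lt hb
    have := (pow_left_inj₀ (by positivity : 0 ≤ q * a) (by positivity : 0 ≤ q * b) two_ne_zero).1 hab
    exact mul_left_cancel₀ hq.ne' this
  have hder : ∀ x ∈ Set.Ioi z, HasDerivWithinAt (fun x => (q * x) ^ 2) (2 * q * (q * x)) (Set.Ioi z) x := by
    intro x _
    have := (((hasDerivAt_id x).const_mul q).pow 2).hasDerivWithinAt (s := Set.Ioi z)
    refine this.congr_deriv ?_
    simp
    ring
  have h := lintegral_image_eq_lintegral_abs_deriv_mul measurableSet_Ioi hder hinj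
    (fun t => ENNReal.ofReal (t ^ ((1 / 2 + m : ℝ) - 1) * Real.exp (-t)))
  rw [himg, ← ofReal_gammaInc (by positivity) (sq_nonneg _)] at h
  have h2 : ∀ x ∈ Set.Ioi z, ENNReal.ofReal |2 * q * (q * x)| *
      ENNReal.ofReal (((q * x) ^ 2) ^ ((1 / 2 + m : ℝ) - 1) * Real.exp (-(q * x) ^ 2)) =
      ENNReal.ofReal (2 * q ^ (2 * m + 1)) *
        ENNReal.ofReal (x ^ (2 * m) * Real.exp (-(q * x) ^ 2)) := by
    intro x hx
    have hx' : 0 < x := hz.trans_lt hx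
    rw [abs_of_pos (by positivity), ← ENNReal.ofReal_mul (by positivity),
      ← ENNReal.ofReal_mul (by positivity)]
    congr 1
    have e1 : (q * x) * ((q * x) ^ 2) ^ ((1 / 2 + m : ℝ) - 1) = (q * x) ^ (2 * m) := by
      have hu : 0 < q * x := by positivity
      rw [← Real.rpow_natCast (q * x) 2, ← Real.rpow_mul hu.le, ← Real.rpow_natCast (q * x) (2 * m)]
      nth_rewrite 1 [← Real.rpow_one (q * x)]
      rw [← Real.rpow_add hu]
      congr 1
      push_cast
      ring
    calc _ = 2 * q * ((q * x) * ((q * x) ^ 2) ^ ((1 / 2 + m : ℝ) - 1)) * Real.exp (-(q * x) ^ 2) := by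
          ring
      _ = _ := by rw [e1]; ring
  rw [setLIntegral_congr_fun measurableSet_Ioi h2, lintegral_const_mul _ (by fun_prop)] at h
  rw [ENNReal.ofReal_div_of_pos (by positivity), h, ENNReal.eq_div_iff _ ENNReal.ofReal_ne_top]
  exact (ENNReal.ofReal_pos.2 (by positivity)).ne'

lemma lintegral_pow_mul_exp_neg_sq {q : ℝ} (hq : 0 < q) (m : ℕ) :
    ∫⁻ x : ℝ, ENNReal.ofReal (x ^ (2 * m) * Real.exp (-(q * x) ^ 2)) =
      ENNReal.ofReal (Real.Gamma (1 / 2 + m) / q ^ (2 * m + 1)) := by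
  have hΓ := Real.Gamma_pos_of_pos (show (0 : ℝ) < 1 / 2 + m by positivity)
  have hnn : ∀ x : ℝ, 0 ≤ x ^ (2 * m) * Real.exp (-(q * x) ^ 2) := fun x => by
    rw [pow_mul]; positivity
  refine lintegral_ofReal_eq_of_integral_pos (Eventually.of_forall hnn) (by positivity) ?_
  have h1 : ∀ x : ℝ, x ^ (2 * m) * Real.exp (-(q * x) ^ 2) =
      (fun x => x ^ (2 * m) * Real.exp (-(q * x) ^ 2)) |x| := fun x => by
    simp only [pow_mul, mul_pow, sq_abs]
  rw [integral_congr_ae (Eventually.of_forall h1), integral_comp_abs (f := fun x => x ^ (2 * m) * Real.exp (-(q * x) ^ 2)),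
    integral_eq_lintegral_of_nonneg_ae (Eventually.of_forall hnn)
      (Continuous.aestronglyMeasurable (by fun_prop)),
    lintegral_pow_mul_exp_neg_sq_Ioi hq le_rfl, ENNReal.toReal_ofReal]
  · simp only [mul_zero, ne_eq, OfNat.ofNat_ne_zero, not_false_eq_true, zero_pow]
    rw [gammaInc_zero (by positivity)]
    field_simp
  · simp only [mul_zero, ne_eq, OfNat.ofNat_ne_zero, not_false_eq_true, zero_pow]
    rw [gammaInc_zero (by positivity)]
    positivity

/-! ### Integration over a half plane -/

lemma progress_eq_inner (d v : Plane) : progress d v = inner ℝ (‖d‖⁻¹ • d) v := by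
  unfold progress
  by_cases hd : d = 0
  · simp [hd]
  by_cases hv : v = 0
  · simp [hv]
  have h1 : ‖d‖ ≠ 0 := norm_ne_zero_iff.2 hd
  have h2 : ‖v‖ ≠ 0 := norm_ne_zero_iff.2 hv
  rw [InnerProductGeometry.cos_angle, inner_smul_left]
  simp only [conj_trivial]
  field_simp

lemma continuous_progress (d : Plane) : Continuous (progress d) := by
  simp_rw [funext (progress_eq_inner d)]
  fun_prop

lemma progress_smul (d v : Plane) (c : ℝ) : progress d (c • v) = c * progress d v := by
  simp [progress_eq_inner, inner_smul_right]

/-- Orthonormal coordinates whose first axis points along `d`. -/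
lemma exists_measurePreserving_progress {d : Plane} (hd : d ≠ 0) :
    ∃ T : Plane → ℝ × ℝ, MeasurePreserving T ∧ (∀ v, (T v).1 = progress d v) ∧
      ∀ v, ‖v‖ ^ 2 = (T v).1 ^ 2 + (T v).2 ^ 2 := by
  have hu : ‖(‖d‖⁻¹ • d)‖ = 1 := by
    rw [norm_smul, norm_inv, norm_norm, inv_mul_cancel₀ (norm_ne_zero_iff.2 hd)]
  have hon : Orthonormal ℝ (({0} : Set (Fin 2)).domRestrict fun _ => ‖d‖⁻¹ • d) := by
    rw [orthonormal_iff_ite]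
    rintro ⟨i, hi⟩ ⟨j, hj⟩
    have : i = j := by rw [Set.mem_singleton_iff.1 hi, Set.mem_singleton_iff.1 hj]
    subst this
    simp only [Set.domRestrict_apply, if_true]
    rw [real_inner_self_eq_norm_sq, hu]
    norm_num
  obtain ⟨b, hb⟩ := hon.exists_orthonormalBasis_extension_of_card_eq (by simp)
  refine ⟨fun v => (b.repr v 0, b.repr v 1), ?_, fun v => ?_, fun v => ?_⟩
  · exact (volume_preserving_finTwoArrow ℝ).comp
      ((PiLp.volume_preserving_ofLp (Fin 2)).comp b.measurePreserving_repr)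
  · show b.repr v 0 = _
    rw [b.repr_apply_apply, hb 0 rfl, progress_eq_inner]
  · rw [← b.repr.norm_map v, EuclideanSpace.norm_sq_eq]
    simp [Fin.sum_univ_two]

lemma F_term_nonneg {z : ℝ} (i k : ℕ) :
    0 ≤ Real.Gamma (1 / 2 + (k : ℝ)) * GammaInc (1 / 2 + (i : ℝ) - (k : ℝ)) (z ^ 2)
      / (2 * (k.factorial : ℝ) * ((i - k).factorial : ℝ)) := by
  have h1 := Real.Gamma_pos_of_pos (show (0 : ℝ) < 1 / 2 + k by positivity)
  have h2 : 0 ≤ GammaInc (1 / 2 + (i : ℝ) - (k : ℝ)) (z ^ 2) := gammaInc_nonneg (sq_nonneg z)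
  positivity

lemma F_nonneg (L : ℕ) (z : ℝ) : 0 ≤ F L z :=
  Finset.sum_nonneg fun i _ => Finset.sum_nonneg fun k _ => F_term_nonneg i k

/-- The integral over a half plane of the probability that a Poisson variable of mean
`q² ‖y‖²` is less than `L`. -/
lemma setLIntegral_progress {d : Plane} (hd : d ≠ 0) {q z : ℝ} (hq : 0 < q) (hz : 0 ≤ z) (L : ℕ) :
    ∫⁻ y in {y | z < progress d y}, ENNReal.ofReal (∑ i ∈ Finset.range L,
        Real.exp (-(q ^ 2 * ‖y‖ ^ 2)) * (q ^ 2 * ‖y‖ ^ 2) ^ i / i.factorial) =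
      ENNReal.ofReal (F L (q * z) / q ^ 2) := by
  obtain ⟨T, hT, hT1, hT2⟩ := exists_measurePreserving_progress hd
  have hset : {y | z < progress d y} = T ⁻¹' (Set.Ioi z ×ˢ Set.univ) := by
    ext y; simp [hT1]
  -- With `|y|² = a² + b²`, the binomial theorem splits each Poisson weight into products of
  -- functions of `a` and `b`, where `k` is the exponent of the transverse `b²`; the binomial
  -- coefficient over `i!` is `1 / (k! (i-k)!)`.
  let G : ℝ × ℝ → ℝ≥0∞ := fun w : ℝ × ℝ => ∑ i ∈ Finset.range L, ∑ k ∈ Finset.range (i + 1),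
        ENNReal.ofReal (q ^ (2 * i) / (k.factorial * (i - k).factorial)) *
        (ENNReal.ofReal (w.1 ^ (2 * (i - k)) * Real.exp (-(q * w.1) ^ 2)) *
        ENNReal.ofReal (w.2 ^ (2 * k) * Real.exp (-(q * w.2) ^ 2)))
  have hG : Measurable G := by
    unfold G
    fun_prop
  have h1 : ∀ y, ENNReal.ofReal (∑ i ∈ Finset.range L,
      Real.exp (-(q ^ 2 * ‖y‖ ^ 2)) * (q ^ 2 * ‖y‖ ^ 2) ^ i / i.factorial) =
      G (T y) := by
    intro y
    simp only [G]
    rw [ENNReal.ofReal_sum_of_nonneg fun i _ => by positivity]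
    refine Finset.sum_congr rfl fun i _ => ?_
    have hnn : ∀ (x : ℝ) (m : ℕ), 0 ≤ x ^ (2 * m) * Real.exp (-(q * x) ^ 2) := fun x m => by
      rw [pow_mul]; positivity
    simp_rw [← ENNReal.ofReal_mul (hnn _ _)]
    have hq' : ∀ k, 0 ≤ q ^ (2 * i) / ((k.factorial : ℝ) * (i - k).factorial) := fun k => by
      positivity
    simp_rw [← ENNReal.ofReal_mul (hq' _)]
    rw [← ENNReal.ofReal_sum_of_nonneg fun k _ => mul_nonneg (hq' k)
      (mul_nonneg (hnn _ _) (hnn _ _))]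
    congr 1
    rw [hT2, show -(q ^ 2 * ((T y).1 ^ 2 + (T y).2 ^ 2)) =
      -(q * (T y).1) ^ 2 + -(q * (T y).2) ^ 2 by ring, Real.exp_add, mul_pow (q ^ 2),
      add_comm ((T y).1 ^ 2), add_pow, ← pow_mul, Finset.mul_sum, Finset.mul_sum, Finset.sum_div]
    refine Finset.sum_congr rfl fun k hk => ?_
    have hk' : k ≤ i := by simpa [Nat.lt_succ_iff] using hk
    rw [← pow_mul, ← pow_mul, Nat.cast_choose ℝ hk']
    have := Nat.factorial_ne_zero i
    field_simp
  rw [lintegral_congr h1, hset, hT.setLIntegral_comp_preimage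
    (measurableSet_Ioi.prod MeasurableSet.univ) hG, Measure.volume_eq_prod, ← Measure.prod_restrict, Measure.restrict_univ]
  simp only [G]
  rw [lintegral_finsetSum _ fun i _ => by fun_prop, F, Finset.sum_div,
    ENNReal.ofReal_sum_of_nonneg fun i _ =>
      div_nonneg (Finset.sum_nonneg fun k _ => F_term_nonneg i k) (by positivity)]
  refine Finset.sum_congr rfl fun i _ => ?_
  rw [lintegral_finsetSum _ fun k _ => by fun_prop, Finset.sum_div,
    ENNReal.ofReal_sum_of_nonneg fun k _ => div_nonneg (F_term_nonneg i k) (by positivity)]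
  refine Finset.sum_congr rfl fun k hk => ?_
  have hk' : k ≤ i := by simpa [Nat.lt_succ_iff] using hk
  rw [lintegral_const_mul _ (by fun_prop),
    lintegral_prod_mul (f := fun x : ℝ => ENNReal.ofReal (x ^ (2 * (i - k)) * Real.exp (-(q * x) ^ 2)))
      (g := fun x : ℝ => ENNReal.ofReal (x ^ (2 * k) * Real.exp (-(q * x) ^ 2)))
      (by fun_prop) (by fun_prop),
    lintegral_pow_mul_exp_neg_sq_Ioi hq hz, lintegral_pow_mul_exp_neg_sq hq]
  have h2 := gammaInc_nonneg (s := 1 / 2 + ((i - k : ℕ) : ℝ)) (sq_nonneg (q * z))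
  rw [← ENNReal.ofReal_mul (by positivity), ← ENNReal.ofReal_mul (by positivity)]
  congr 1
  obtain ⟨j, rfl⟩ := Nat.exists_eq_add_of_le hk'
  rw [show 1 / 2 + ((k + j : ℕ) : ℝ) - k = 1 / 2 + ((k + j - k : ℕ) : ℝ) by
    rw [Nat.add_sub_cancel_left]; push_cast; ring]
  rw [Nat.add_sub_cancel_left]
  field_simp
  ring

/-! ### Convergence of the integral defining `H` -/

/-- For `t > z`, `exp(-t) ≤ exp(-t/2) exp(-z/2)`. At `z²` this is a Gaussian bound, whence the
integrability of `F`. -/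
lemma gammaInc_le {s z : ℝ} (hs : 0 < s) (hz : 0 ≤ z) :
    GammaInc s z ≤ 2 ^ s * Real.Gamma s * Real.exp (-(z / 2)) := by
  have h1 := Real.integral_rpow_mul_exp_neg_mul_Ioi hs (show (0 : ℝ) < 1 / 2 by norm_num)
  have hΓ := Real.Gamma_pos_of_pos hs
  have hint : IntegrableOn (fun t : ℝ => t ^ (s - 1) * Real.exp (-(1 / 2 * t))) (Set.Ioi 0) :=
    Integrable.of_integral_ne_zero (by rw [h1]; positivity)
  have h2 : GammaInc s z ≤
      ∫ t in Set.Ioi z, t ^ (s - 1) * Real.exp (-(1 / 2 * t)) * Real.exp (-(z / 2)) := by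
    refine setIntegral_mono_on (integrableOn_gammaInc hs hz)
      ((hint.mono_set (Set.Ioi_subset_Ioi hz)).mul_const _) measurableSet_Ioi fun t ht => ?_
    have ht' : z < t := ht
    have ht0 : 0 < t := hz.trans_lt ht
    rw [mul_assoc, ← Real.exp_add]
    refine mul_le_mul_of_nonneg_left (Real.exp_le_exp.2 (by linarith)) (by positivity)
  refine h2.trans ?_
  rw [integral_mul_const]
  refine mul_le_mul_of_nonneg_right ?_ (Real.exp_nonneg _)
  refine (setIntegral_mono_set hint ?_ (Set.Ioi_subset_Ioi hz).eventuallyLE).trans_eq ?_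
  · filter_upwards [ae_restrict_mem measurableSet_Ioi] with t ht
    have : 0 < t := ht
    show 0 ≤ t ^ (s - 1) * Real.exp (-(1 / 2 * t))
    positivity
  · rw [h1]; norm_num

lemma antitoneOn_gammaInc {s : ℝ} (hs : 0 < s) : AntitoneOn (GammaInc s) (Set.Ici 0) := by
  intro a ha b hb hab
  exact setIntegral_mono_set (integrableOn_gammaInc hs ha) (gammaInc_integrand_nonneg ha)
    (Set.Ioi_subset_Ioi hab).eventuallyLE

lemma integrableOn_gammaInc_sq {s : ℝ} (hs : 0 < s) :
    IntegrableOn (fun z => GammaInc s (z ^ 2)) (Set.Ioi 0) := by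
  have hanti : AntitoneOn (fun z => GammaInc s (z ^ 2)) (Set.Ioi (0 : ℝ)) := fun a ha b hb hab =>
    antitoneOn_gammaInc hs (sq_nonneg a) (sq_nonneg b)
      (pow_le_pow_left₀ (le_of_lt ha) hab 2)
  have hm : AEStronglyMeasurable (fun z => GammaInc s (z ^ 2)) (volume.restrict (Set.Ioi 0)) :=
    (aemeasurable_restrict_of_antitoneOn measurableSet_Ioi hanti).aestronglyMeasurable
  have hg : Integrable fun z : ℝ => 2 ^ s * Real.Gamma s * Real.exp (-(1 / 2) * z ^ 2) :=
    (integrable_exp_neg_mul_sq (by norm_num)).const_mul _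
  refine (hg.integrableOn (s := Set.Ioi 0)).mono' hm (Eventually.of_forall fun z => ?_)
  rw [Real.norm_of_nonneg (gammaInc_nonneg (sq_nonneg z))]
  refine (gammaInc_le hs (sq_nonneg z)).trans_eq ?_
  congr 2
  ring

lemma integrableOn_F (L : ℕ) : IntegrableOn (F L) (Set.Ioi 0) := by
  unfold F IntegrableOn
  refine integrable_finsetSum _ fun i _ => integrable_finsetSum _ fun k hk => ?_
  have hk' : (k : ℝ) ≤ i := by
    have : k ≤ i := by simpa [Nat.lt_succ_iff] using hk
    exact_mod_cast this
  exact ((integrableOn_gammaInc_sq (by linarith)).const_mul _).div_const _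

lemma HIntegrand_nonneg {α β p : ℝ} (hα : 2 < α) (hβ : 0 < β) (hp₀ : 0 < p) (hp₁ : p < 1)
    (L : ℕ) (z : ℝ) : 0 ≤ HIntegrand α β p L z := by
  have h1 := Delta_pos hα
  have h2 := F_nonneg L z
  have h3 : 0 ≤ (1 - p) / p := div_nonneg (by linarith) hp₀.le
  have : 0 ≤ (1 - p) / p * (F L z / (β ^ (2 / α) * Delta α)) := by positivity
  rw [HIntegrand, sub_nonneg, Real.exp_le_one_iff]
  linarith

/-- Dominated by a multiple of `F`, since `1 - exp(-u) ≤ u`. -/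
theorem integrableOn_HIntegrand {α β p : ℝ} (hα : 2 < α) (hβ : 0 < β) (hp₀ : 0 < p) (hp₁ : p < 1)
    (L : ℕ) : IntegrableOn (HIntegrand α β p L) (Set.Ioi 0) := by
  have hg := ((integrableOn_F L).div_const (β ^ (2 / α) * Delta α)).const_mul ((1 - p) / p)
  refine hg.mono' ?_ (Eventually.of_forall fun z => ?_)
  · exact aestronglyMeasurable_const.sub
      (Real.continuous_exp.comp_aestronglyMeasurable hg.aestronglyMeasurable.neg)
  · rw [Real.norm_of_nonneg (HIntegrand_nonneg hα hβ hp₀ hp₁ L z), HIntegrand]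
    linarith [Real.one_sub_le_exp_neg ((1 - p) / p * (F L z / (β ^ (2 / α) * Delta α)))]

/-! ### Jensen's inequality for the negative exponential -/

lemma expNeg_lintegral_le {E : Type*} [MeasurableSpace E] {μ : Measure E} [IsProbabilityMeasure μ]
    {f : E → ℝ≥0∞} (hf : Measurable f) : expNeg (∫⁻ x, f x ∂μ) ≤ ∫⁻ x, expNeg (f x) ∂μ := by
  by_cases htop : ∫⁻ x, f x ∂μ = ⊤
  · rw [htop]
    simp [expNeg]
  have hfin := ae_lt_top hf htop
  set m := (∫⁻ x, f x ∂μ).toReal with hm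
  have hint : Integrable (fun x => (f x).toReal) μ := integrable_toReal_of_lintegral_ne_top
    hf.aemeasurable htop
  have hm' : ∫ x, (f x).toReal ∂μ = m := by
    rw [integral_toReal hf.aemeasurable hfin]
  have h1 : ∀ᵐ x ∂μ, ENNReal.ofReal (Real.exp (-(f x).toReal)) = expNeg (f x) := by
    filter_upwards [hfin] with x hx
    rw [← expNeg_ofReal ENNReal.toReal_nonneg, ENNReal.ofReal_toReal hx.ne]
  have hexp : Integrable (fun x => Real.exp (-(f x).toReal)) μ := by
    refine (integrable_const (1 : ℝ)).mono'
      (Real.measurable_exp.comp hf.ennreal_toReal.neg).aestronglyMeasurable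
      (Eventually.of_forall fun x => ?_)
    rw [Real.norm_of_nonneg (Real.exp_nonneg _)]
    simp
  rw [← lintegral_congr_ae h1, ← ofReal_integral_eq_lintegral_ofReal hexp
    (Eventually.of_forall fun x => Real.exp_nonneg _), ← ENNReal.ofReal_toReal htop,
    expNeg_ofReal ENNReal.toReal_nonneg]
  refine ENNReal.ofReal_le_ofReal ?_
  -- Integral of the tangent line to `exp(-x)` at the mean `m`, which lies below the curve.
  have h2 : ∫ x, Real.exp (-m) * (1 + m - (f x).toReal) ∂μ = Real.exp (-m) := by
    rw [integral_const_mul, integral_sub (integrable_const _) hint, hm']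
    simp
  rw [← hm, ← h2]
  refine integral_mono (((integrable_const _).sub hint).const_mul _) hexp fun x => ?_
  have h3 := Real.add_one_le_exp (m - (f x).toReal)
  calc Real.exp (-m) * (1 + m - (f x).toReal) ≤ Real.exp (-m) * Real.exp (m - (f x).toReal) :=
        mul_le_mul_of_nonneg_left (by linarith) (Real.exp_nonneg _)
    _ = Real.exp (-(f x).toReal) := by rw [← Real.exp_add]; congr 1; ring

/-! ### The joint law of positions and channels -/

lemma infinitePi_pi_univ_eq_iInf {V : Type*} [MeasurableSpace V] (γ : Measure V)
    [IsProbabilityMeasure γ] {S : ℕ → Set V} (hS : ∀ k, MeasurableSet (S k)) :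
    Measure.infinitePi (fun _ : ℕ => γ) (Set.univ.pi S) =
      ⨅ N, ∏ k ∈ Finset.range N, γ (S k) := by
  have h1 : Set.univ.pi S = ⋂ N : ℕ, Set.pi (Finset.range N : Finset ℕ) S := by
    ext g
    simp only [Set.mem_iInter, Set.mem_pi, Finset.coe_range, Set.mem_Iio]
    exact ⟨fun h N k _ => h k trivial, fun h k _ => h (k + 1) k (Nat.lt_succ_self k)⟩
  have h2 : Antitone fun N : ℕ => Set.pi ((Finset.range N : Finset ℕ) : Set ℕ) S :=
    fun M N hMN => Set.pi_mono' (fun _ _ => subset_rfl) (by simpa using Set.Iio_subset_Iio hMN)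
  rw [h1, h2.measure_iInter (fun N => (MeasurableSet.pi (Finset.countable_toSet _)
    fun k _ => hS k).nullMeasurableSet) ⟨0, by simp⟩]
  exact iInf_congr fun N => Measure.infinitePi_pi _ fun k _ => hS k

namespace IsNetwork

variable {lam p : ℝ} {L : ℕ}
  {X Y : ℕ → Ω → Plane} {h : Option ℕ → ℕ → Ω → Fin L → ℂ}

lemma aemeasurable_fading (hN : IsNetwork P lam p L X Y h) :
    AEMeasurable (fun ω (k : ℕ) (i : Option ℕ) => h i k ω) P :=
  aemeasurable_pi_iff.2 fun k => aemeasurable_pi_iff.2 fun i => (hN.fading_law i k).aemeasurable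

lemma measurable_emitters (hN : IsNetwork P lam p L X Y h) : Measurable fun ω i => X i ω :=
  measurable_pi_lambda _ hN.emitters.measurable

lemma measurable_receivers (hN : IsNetwork P lam p L X Y h) : Measurable fun ω k => Y k ω :=
  measurable_pi_lambda _ hN.receivers.measurable

/-- Grouping the channels by receiver shows that distinct receivers see independent, identically
distributed families of channel vectors. -/
lemma map_fading [IsProbabilityMeasure P] (hN : IsNetwork P lam p L X Y h) :
    P.map (fun ω (k : ℕ) (i : Option ℕ) => h i k ω) =
      Measure.infinitePi fun _ : ℕ => Measure.infinitePi fun _ : Option ℕ =>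
        complexNormalVec L := by
  have hind : iIndepFun (fun (j : ℕ × Option ℕ) ω => h j.2 j.1 ω) P :=
    hN.fading_indep.precomp (g := Prod.swap) Prod.swap_injective
  have h1 := hind.map_fun_eq_infinitePi_map₀' fun (j : ℕ × Option ℕ) => (hN.fading_law j.2 j.1).aemeasurable
  simp_rw [fun i k => (hN.fading_law i k).map_eq] at h1
  have h2 := Measure.infinitePi_map_curry (ι := ℕ) (κ := Option ℕ)
    (μ := fun _ _ => complexNormalVec L)
  rw [← h1, AEMeasurable.map_map_of_aemeasurable (by fun_prop) (aemeasurable_pi_iff.2 fun (j : ℕ × Option ℕ) =>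
    (hN.fading_law j.2 j.1).aemeasurable)] at h2
  exact h2

lemma map_nodes_fading [IsProbabilityMeasure P] (hN : IsNetwork P lam p L X Y h) :
    P.map (fun ω => (((fun i => X i ω), (fun k => Y k ω)), fun (k : ℕ) (i : Option ℕ) => h i k ω)) =
      ((P.map fun ω i => X i ω).prod (P.map fun ω k => Y k ω)).prod
        (Measure.infinitePi fun _ : ℕ => Measure.infinitePi fun _ : Option ℕ =>
          complexNormalVec L) := by
  have hXY := (indepFun_iff_map_prod_eq_prod_map_map hN.measurable_emitters.aemeasurable
    hN.measurable_receivers.aemeasurable).1 hN.emitters_indep_receivers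
  have hind : IndepFun (fun ω : Ω => ((fun i : ℕ => X i ω), (fun k : ℕ => Y k ω)))
      (fun ω (k : ℕ) (i : Option ℕ) => h i k ω) P :=
    hN.nodes_indep_fading.comp (φ := id)
      (ψ := fun (g : Option ℕ × ℕ → Fin L → ℂ) (k : ℕ) (i : Option ℕ) => g (i, k))
      measurable_id (by fun_prop)
  rw [(indepFun_iff_map_prod_eq_prod_map_map
    (hN.measurable_emitters.prodMk hN.measurable_receivers).aemeasurable
    hN.aemeasurable_fading).1 hind, hXY, hN.map_fading]

lemma aemeasurable_nodes_fading (hN : IsNetwork P lam p L X Y h) : AEMeasurable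
    (fun ω => (((fun i => X i ω), (fun k => Y k ω)), fun (k : ℕ) (i : Option ℕ) => h i k ω)) P :=
  (hN.measurable_emitters.prodMk hN.measurable_receivers).aemeasurable.prodMk
    hN.aemeasurable_fading

end IsNetwork

/-! ### Receivers that decode, as an independent thinning given the emitters -/

/-- The realizations for which the `k`-th receiver lies in `B` and decodes the packet. -/
def decodingSet (L : ℕ) (α β : ℝ) (B : Set Plane) (k : ℕ) :
    Set (((ℕ → Plane) × (ℕ → Plane)) × (ℕ → Option ℕ → Fin L → ℂ)) :=
  {w | w.1.2 k ∈ B ∧ β ≤ sir α w.1.1 (w.2 k none) (fun i => w.2 k (some i)) (w.1.2 k)}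

lemma measurableSet_decodingSet {L : ℕ} {α β : ℝ} {B : Set Plane} (hB : MeasurableSet B) (k : ℕ) :
    MeasurableSet (decodingSet L α β B k) := by
  have hk : Measurable fun w : ((ℕ → Plane) × (ℕ → Plane)) × (ℕ → Option ℕ → Fin L → ℂ) =>
      w.1.2 k := by fun_prop
  have hg : Measurable fun w : ((ℕ → Plane) × (ℕ → Plane)) × (ℕ → Option ℕ → Fin L → ℂ) =>
      ((w.1.1, w.1.2 k), w.2 k) := by fun_prop
  exact (hk hB).inter (hg (measurableSet_success (L := L) α β))

lemma successProb_le_one {L : ℕ} {α β : ℝ} (x : ℕ → Plane) (y : Plane) :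
    successProb (L := L) α β x y ≤ 1 := prob_le_one

lemma infinitePi_decodingSet {L : ℕ} {α β : ℝ} {B : Set Plane}
    (x y : ℕ → Plane) (k : ℕ) :
    (Measure.infinitePi fun _ : Option ℕ => complexNormalVec L)
      {g | y k ∈ B ∧ β ≤ sir α x (g none) (fun i => g (some i)) (y k)} =
      B.indicator (successProb (L := L) α β x) (y k) := by
  by_cases hy : y k ∈ B
  · rw [Set.indicator_of_mem hy, successProb]
    simp only [hy, true_and]
  · simp [hy]

lemma measurableSet_success_section {L : ℕ} {α β : ℝ} {B : Set Plane} (x y : ℕ → Plane) (k : ℕ) :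
    MeasurableSet {g : Option ℕ → Fin L → ℂ |
      y k ∈ B ∧ β ≤ sir α x (g none) (fun i => g (some i)) (y k)} := by
  by_cases hy : y k ∈ B
  · simp only [hy, true_and]
    exact measurable_prodMk_left (x := (x, y k)) (measurableSet_success (L := L) α β)
  · simp [hy]

lemma measurable_indicator_successProb {L : ℕ} {α β : ℝ} {B : Set Plane} (hB : MeasurableSet B) :
    Measurable fun q : (ℕ → Plane) × Plane =>
      B.indicator (successProb (L := L) α β q.1) q.2 := by
  have : (fun q : (ℕ → Plane) × Plane => B.indicator (successProb (L := L) α β q.1) q.2) =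
      (Prod.snd ⁻¹' B).indicator fun q => successProb (L := L) α β q.1 q.2 := by
    ext q; rfl
  rw [this]
  exact (measurable_successProb α β).indicator (measurable_snd hB)

lemma measurable_lintegral_successProb {L : ℕ} {α β : ℝ} {B : Set Plane} (hB : MeasurableSet B) :
    Measurable fun x : ℕ → Plane =>
      ∫⁻ z, B.indicator (successProb (L := L) α β x) z :=
  (measurable_indicator_successProb hB).lintegral_prod_right'

lemma indicator_successProb_le_one {L : ℕ} {α β : ℝ} {B : Set Plane} (x : ℕ → Plane) (z : Plane) :
    B.indicator (successProb (L := L) α β x) z ≤ 1 :=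
  Set.indicator_apply_le' (fun _ => successProb_le_one x z) (fun _ => zero_le_one)

namespace IsNetwork

variable {lam p : ℝ} {L : ℕ}
  {X Y : ℕ → Ω → Plane} {h : Option ℕ → ℕ → Ω → Fin L → ℂ}

/-- The integral over `B` of the mean success probability. -/
lemma lintegral_lintegral_successProb [SFinite P] (hN : IsNetwork P lam p L X Y h) {α β : ℝ}
    {B : Set Plane} (hB : MeasurableSet B) :
    ∫⁻ x, ∫⁻ z, B.indicator (successProb (L := L) α β x) z ∂volume ∂(P.map fun ω i => X i ω) =
      ∫⁻ z in B, ∫⁻ ω, successProb (L := L) α β (fun i => X i ω) z ∂P := by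
  rw [lintegral_map (measurable_lintegral_successProb hB) hN.measurable_emitters,
    lintegral_lintegral_swap, ← lintegral_indicator hB]
  · refine lintegral_congr fun z => ?_
    by_cases hz : z ∈ B <;> simp [hz]
  · exact ((measurable_indicator_successProb hB).comp
      (f := fun q : Ω × Plane => ((fun i => X i q.1), q.2))
      ((hN.measurable_emitters.comp measurable_fst).prodMk measurable_snd)).aemeasurable

/-- The probability that no receiver in `B` decodes the packet. -/
theorem expNeg_le_measure_forall_notMem [IsProbabilityMeasure P] (hN : IsNetwork P lam p L X Y h)
    (hρ : 0 ≤ lam * (1 - p)) (α β : ℝ) {B : Set Plane} (hB : MeasurableSet B) :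
    expNeg (ENNReal.ofReal (lam * (1 - p)) *
      ∫⁻ z in B, ∫⁻ ω, successProb (L := L) α β (fun i => X i ω) z ∂P) ≤
    P {ω | ∀ k, ¬ (Y k ω ∈ B ∧
      β ≤ sir α (fun i => X i ω) (h none k ω) (fun i => h (some i) k ω) (Y k ω))} := by
  have hS : MeasurableSet (⋂ k, (decodingSet L α β B k)ᶜ) :=
    MeasurableSet.iInter fun k => (measurableSet_decodingSet hB k).compl
  have h1 : P {ω | ∀ k, ¬ (Y k ω ∈ B ∧
      β ≤ sir α (fun i => X i ω) (h none k ω) (fun i => h (some i) k ω) (Y k ω))} =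
      P.map (fun ω => (((fun i => X i ω), (fun k => Y k ω)),
        fun (k : ℕ) (i : Option ℕ) => h i k ω)) (⋂ k, (decodingSet L α β B k)ᶜ) := by
    rw [Measure.map_apply_of_aemeasurable hN.aemeasurable_nodes_fading hS]
    congr 1
    ext ω
    simp [decodingSet]
  have := Measure.isProbabilityMeasure_map (μ := P) hN.measurable_emitters.aemeasurable
  have := Measure.isProbabilityMeasure_map (μ := P) hN.measurable_receivers.aemeasurable
  -- Once the positions are fixed, the receivers decode independently, so the event is a product set
  -- indexed by `k`.
  have h2 : ∀ q : (ℕ → Plane) × (ℕ → Plane),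
      (Measure.infinitePi fun _ : ℕ => Measure.infinitePi fun _ : Option ℕ => complexNormalVec L)
        (Prod.mk q ⁻¹' ⋂ k, (decodingSet L α β B k)ᶜ) =
      ⨅ N, ∏ k ∈ Finset.range N, (1 - B.indicator (successProb (L := L) α β q.1) (q.2 k)) := by
    rintro ⟨x, y⟩
    have : (Prod.mk (x, y) ⁻¹' ⋂ k, (decodingSet L α β B k)ᶜ) = Set.univ.pi fun k =>
        {g : Option ℕ → Fin L → ℂ |
          y k ∈ B ∧ β ≤ sir α x (g none) (fun i => g (some i)) (y k)}ᶜ := by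
      ext g
      simp [decodingSet]
    rw [this, infinitePi_pi_univ_eq_iInf _ fun k => (measurableSet_success_section x y k).compl]
    refine iInf_congr fun N => Finset.prod_congr rfl fun k _ => ?_
    rw [prob_compl_eq_one_sub (measurableSet_success_section x y k), infinitePi_decodingSet]
  have hv : ∀ k, Measurable fun q : (ℕ → Plane) × (ℕ → Plane) =>
      (1 - B.indicator (successProb (L := L) α β q.1) (q.2 k)) := fun k =>
    measurable_const.sub ((measurable_indicator_successProb hB).comp
      (f := fun q : (ℕ → Plane) × (ℕ → Plane) => (q.1, q.2 k)) (by fun_prop))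
  have hprod : Measurable fun q : (ℕ → Plane) × (ℕ → Plane) =>
      ⨅ N, ∏ k ∈ Finset.range N, (1 - B.indicator (successProb (L := L) α β q.1) (q.2 k)) :=
    Measurable.iInf fun N => Finset.measurable_prod _ fun k _ => hv k
  have hx : ∀ x : ℕ → Plane, Measurable fun z => B.indicator (successProb (L := L) α β x) z :=
    fun x => (measurable_indicator_successProb hB).comp (f := fun z : Plane => (x, z)) (by fun_prop)
  have h3 : ∀ x : ℕ → Plane, ∫⁻ y, ⨅ N, ∏ k ∈ Finset.range N,
      (1 - B.indicator (successProb (L := L) α β x) (y k)) ∂(P.map fun ω k => Y k ω) =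
      expNeg (ENNReal.ofReal (lam * (1 - p)) *
        ∫⁻ z, B.indicator (successProb (L := L) α β x) z) := by
    intro x
    have hxk : ∀ k, Measurable fun y : ℕ → Plane =>
        1 - B.indicator (successProb (L := L) α β x) (y k) := fun k =>
      measurable_const.sub ((hx x).comp (measurable_pi_apply k))
    have hxN : Measurable fun y : ℕ → Plane => ⨅ N, ∏ k ∈ Finset.range N,
        (1 - B.indicator (successProb (L := L) α β x) (y k)) :=
      Measurable.iInf fun N => Finset.measurable_prod _ fun k _ => hxk k
    rw [lintegral_map hxN hN.measurable_receivers,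
      hN.receivers.lintegral_iInf_prod hρ
        (v := fun z => 1 - B.indicator (successProb (L := L) α β x) z)
        (measurable_const.sub (hx x)) fun z => tsub_le_self]
    congr 2
    refine lintegral_congr fun z => ?_
    exact ENNReal.sub_sub_cancel ENNReal.one_ne_top (indicator_successProb_le_one x z)
  rw [h1, hN.map_nodes_fading, Measure.prod_apply hS]
  simp_rw [h2]
  rw [lintegral_prod _ hprod.aemeasurable]
  simp_rw [h3]
  -- Jensen over the emitters, which are common to all receivers and make their outcomes dependent;
  -- this is where equality is lost.
  refine le_trans (le_of_eq ?_) (expNeg_lintegral_le ((measurable_lintegral_successProb hB).const_mul _))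
  rw [lintegral_const_mul _ (measurable_lintegral_successProb hB),
    hN.lintegral_lintegral_successProb hB]

/-- The mean number of receivers in `B` that decode the packet. -/
theorem tsum_measure_decoding [IsProbabilityMeasure P] (hN : IsNetwork P lam p L X Y h)
    (hρ : 0 ≤ lam * (1 - p)) (α β : ℝ) {B : Set Plane} (hB : MeasurableSet B) :
    ∑' k, P {ω | Y k ω ∈ B ∧
      β ≤ sir α (fun i => X i ω) (h none k ω) (fun i => h (some i) k ω) (Y k ω)} =
    ENNReal.ofReal (lam * (1 - p)) *
      ∫⁻ z in B, ∫⁻ ω, successProb (L := L) α β (fun i => X i ω) z ∂P := by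
  have := Measure.isProbabilityMeasure_map (μ := P) hN.measurable_emitters.aemeasurable
  have := Measure.isProbabilityMeasure_map (μ := P) hN.measurable_receivers.aemeasurable
  have hv : ∀ k, Measurable fun q : (ℕ → Plane) × (ℕ → Plane) =>
      B.indicator (successProb (L := L) α β q.1) (q.2 k) := fun k =>
    (measurable_indicator_successProb hB).comp
      (f := fun q : (ℕ → Plane) × (ℕ → Plane) => (q.1, q.2 k)) (by fun_prop)
  have hx : ∀ x : ℕ → Plane, Measurable fun z => B.indicator (successProb (L := L) α β x) z :=
    fun x => (measurable_indicator_successProb hB).comp (f := fun z : Plane => (x, z)) (by fun_prop)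
  have h1 : ∀ k, P {ω | Y k ω ∈ B ∧
      β ≤ sir α (fun i => X i ω) (h none k ω) (fun i => h (some i) k ω) (Y k ω)} =
      ∫⁻ q, B.indicator (successProb (L := L) α β q.1) (q.2 k)
        ∂((P.map fun ω i => X i ω).prod (P.map fun ω k => Y k ω)) := by
    intro k
    have hS := measurableSet_decodingSet (L := L) (α := α) (β := β) hB k
    have e1 : P {ω | Y k ω ∈ B ∧
        β ≤ sir α (fun i => X i ω) (h none k ω) (fun i => h (some i) k ω) (Y k ω)} =
        P.map (fun ω => (((fun i => X i ω), (fun k => Y k ω)),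
          fun (k : ℕ) (i : Option ℕ) => h i k ω)) (decodingSet L α β B k) := by
      rw [Measure.map_apply_of_aemeasurable hN.aemeasurable_nodes_fading hS]
      rfl
    rw [e1, hN.map_nodes_fading, Measure.prod_apply hS]
    refine lintegral_congr fun q => ?_
    rw [← infinitePi_decodingSet q.1 q.2 k, ← (measurePreserving_eval_infinitePi
      (fun _ : ℕ => Measure.infinitePi fun _ : Option ℕ => complexNormalVec L) k).measure_preimage
      (measurableSet_success_section q.1 q.2 k).nullMeasurableSet]
    rfl
  simp_rw [h1]
  rw [← lintegral_tsum fun k => (hv k).aemeasurable,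
    lintegral_prod _ (Measurable.tsum hv).aemeasurable]
  have h3 : ∀ x : ℕ → Plane, ∫⁻ y, ∑' k, B.indicator (successProb (L := L) α β x) (y k)
      ∂(P.map fun ω k => Y k ω) = ENNReal.ofReal (lam * (1 - p)) *
        ∫⁻ z, B.indicator (successProb (L := L) α β x) z := by
    intro x
    rw [lintegral_map (f := fun y => ∑' k, B.indicator (successProb (L := L) α β x) (y k))
      ((Measurable.tsum hv).comp (f := fun y : ℕ → Plane => (x, y))
      (by fun_prop)) hN.measurable_receivers, hN.receivers.lintegral_tsum hρ (hx x)]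
  simp_rw [h3]
  rw [lintegral_const_mul _ (measurable_lintegral_successProb hB),
    hN.lintegral_lintegral_successProb hB]

end IsNetwork

/-! ### Tail of the maximal progress -/

/-- The inverse length scale `β^{1/α} √(λ p Δ)` of the network. -/
noncomputable def invScale (α β lam p : ℝ) : ℝ := β ^ (1 / α) * √(lam * p * Delta α)

lemma invScale_pos {α β lam p : ℝ} (hα : 2 < α) (hβ : 0 < β) (hlam : 0 < lam) (hp : 0 < p) :
    0 < invScale α β lam p := by
  have := Delta_pos hα
  unfold invScale
  positivity

lemma invScale_sq {α β lam p : ℝ} (hα : 2 < α) (hβ : 0 < β) (hlam : 0 < lam) (hp : 0 < p) :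
    invScale α β lam p ^ 2 = lam * p * (β ^ (2 / α) * Delta α) := by
  have := Delta_pos hα
  rw [invScale, mul_pow, Real.sq_sqrt (by positivity), ← Real.rpow_natCast, ← Real.rpow_mul hβ.le]
  rw [show 1 / α * ((2 : ℕ) : ℝ) = 2 / α by push_cast; ring]
  ring

/-- The mean success probability at a fixed location is at most the probability that a Poisson
variable is less than the number of antennas. -/
theorem IsPoissonProcess.lintegral_successProb_le {Ω : Type*} [MeasurableSpace Ω] {P : Measure Ω}
    [IsProbabilityMeasure P] {α β lam p : ℝ} (hα : 2 < α) (hβ : 0 < β) (hlam : 0 < lam)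
    (hp : 0 < p) {X : ℕ → Ω → Plane} (hX : IsPoissonProcess P (lam * p) X) {L : ℕ}
    {y : Plane} (hy : y ≠ 0) :
    ∫⁻ ω, successProb (L := L + 1) α β (fun i => X i ω) y ∂P ≤
      ENNReal.ofReal (∑ i ∈ Finset.range (L + 1),
        Real.exp (-(invScale α β lam p ^ 2 * ‖y‖ ^ 2)) *
          (invScale α β lam p ^ 2 * ‖y‖ ^ 2) ^ i / i.factorial) := by
  have hy0 : 0 < ‖y‖ := norm_pos_iff.2 hy
  have hα0 : 0 < α := by linarith
  set κ := β * ‖y‖ ^ α with hκdef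
  have hκ : 0 < κ := by positivity
  have hw0 : ∀ z : Plane, 0 ≤ ‖z - y‖ ^ (-α) := fun z => by positivity
  have h1 : ∀ ω, successProb (L := L + 1) α β (fun i => X i ω) y ≤
      ∑ m ∈ Finset.range (L + 1),
        ENNReal.ofReal (trialsMass (fun i => ‖X i ω - y‖ ^ (-α)) κ m) := by
    intro ω
    rw [← ENNReal.ofReal_sum_of_nonneg fun m _ => trialsMass_nonneg (fun i => hw0 _) hκ.le m,
      ← trialsLimit_eq_sum]
    exact ge_of_tendsto' ((ENNReal.continuous_ofReal.tendsto _).comp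
      (tendsto_trialsCDF (fun i => hw0 _) hκ.le (L + 1)))
      fun N => successProb_le_trialsCDF hβ (fun i => X i ω) hy N
  -- The Poisson mean is quadratic in the distance, since `κ^{2/α} = β^{2/α} |y|²`.
  have hμ : ENNReal.ofReal (lam * p) *
      ∫⁻ z : Plane, ENNReal.ofReal (‖z - y‖ ^ (-α) * κ * (1 + ‖z - y‖ ^ (-α) * κ)⁻¹) =
      ENNReal.ofReal (invScale α β lam p ^ 2 * ‖y‖ ^ 2) := by
    rw [lintegral_pathLoss_div_one_add hα hκ, ← ENNReal.ofReal_mul (by positivity),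
      invScale_sq hα hβ hlam hp, hκdef, Real.mul_rpow hβ.le (by positivity),
      ← Real.rpow_mul hy0.le, mul_div_cancel₀ _ hα0.ne', Real.rpow_two]
    congr 1
    ring
  have hw : Measurable fun z : Plane => ‖z - y‖ ^ (-α) := by fun_prop
  have hwX : Measurable fun ω => (fun i => ‖X i ω - y‖ ^ (-α)) :=
    measurable_pi_lambda _ fun i => hw.comp (hX.measurable i)
  have hmm : ∀ m, Measurable fun ω =>
      ENNReal.ofReal (trialsMass (fun i => ‖X i ω - y‖ ^ (-α)) κ m) :=
    fun m => ((measurable_trialsMass κ m).comp hwX).ennreal_ofReal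
  refine (lintegral_mono h1).trans_eq ?_
  rw [lintegral_finsetSum _ fun m _ => hmm m,
    ENNReal.ofReal_sum_of_nonneg fun i _ => by positivity]
  exact Finset.sum_congr rfl fun m _ =>
    hX.lintegral_trialsMass (by positivity) hw hw0 hκ.le (by positivity) hμ m

namespace IsNetwork

variable {lam p : ℝ} {L : ℕ}
  {X Y : ℕ → Ω → Plane}

lemma nullMeasurableSet_decoding {h : Option ℕ → ℕ → Ω → Fin L → ℂ}
    (hN : IsNetwork P lam p L X Y h) (α β : ℝ) {B : Set Plane} (hB : MeasurableSet B) (k : ℕ) :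
    NullMeasurableSet {ω | Y k ω ∈ B ∧
      β ≤ sir α (fun i => X i ω) (h none k ω) (fun i => h (some i) k ω) (Y k ω)} P :=
  hN.aemeasurable_nodes_fading.nullMeasurable (measurableSet_decodingSet hB k)

variable {h : Option ℕ → ℕ → Ω → Fin (L + 1) → ℂ}

lemma setLIntegral_successProb_le [IsProbabilityMeasure P] (hN : IsNetwork P lam p (L + 1) X Y h)
    {α β : ℝ} (hα : 2 < α) (hβ : 0 < β) (hlam : 0 < lam) (hp : 0 < p) {d : Plane} (hd : d ≠ 0)
    {z : ℝ} (hz : 0 ≤ z) :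
    ∫⁻ y in {y | z < progress d y},
        ∫⁻ ω, successProb (L := L + 1) α β (fun i => X i ω) y ∂P ≤
      ENNReal.ofReal (F (L + 1) (invScale α β lam p * z) / invScale α β lam p ^ 2) := by
  rw [← setLIntegral_progress hd (invScale_pos hα hβ hlam hp) hz]
  refine lintegral_mono_ae (ae_restrict_of_ae ?_)
  filter_upwards [Measure.ae_ne volume (0 : Plane)] with y hy
  exact hN.emitters.lintegral_successProb_le hα hβ hlam hp hy

lemma measurableSet_lt_progress (d : Plane) (z : ℝ) : MeasurableSet {y | z < progress d y} :=
  measurableSet_lt measurable_const (continuous_progress d).measurable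

/-- The tail of the largest progress among the receivers that decode the packet. -/
theorem measure_exists_decoding_le [IsProbabilityMeasure P]
    (hN : IsNetwork P lam p (L + 1) X Y h) {α β : ℝ} (hα : 2 < α) (hβ : 0 < β) (hlam : 0 < lam)
    (hp₀ : 0 < p) (hp₁ : p < 1) {d : Plane} (hd : d ≠ 0) {z : ℝ} (hz : 0 ≤ z) :
    P {ω | ∃ k, z < progress d (Y k ω) ∧
      β ≤ sir α (fun i => X i ω) (h none k ω) (fun i => h (some i) k ω) (Y k ω)} ≤
      ENNReal.ofReal (HIntegrand α β p (L + 1) (invScale α β lam p * z)) := by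
  have hρ : 0 ≤ lam * (1 - p) := mul_nonneg hlam.le (by linarith)
  have hq := invScale_pos hα hβ hlam hp₀
  have hB := measurableSet_lt_progress d z
  set E : Set Ω := {ω | ∀ k, ¬ (Y k ω ∈ {y | z < progress d y} ∧
      β ≤ sir α (fun i => X i ω) (h none k ω) (fun i => h (some i) k ω) (Y k ω))} with hE
  have hEm : NullMeasurableSet E P := by
    have : E = ⋂ k, {ω | Y k ω ∈ {y | z < progress d y} ∧
        β ≤ sir α (fun i => X i ω) (h none k ω) (fun i => h (some i) k ω) (Y k ω)}ᶜ := by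
      ext ω
      simp [hE]
    rw [this]
    exact NullMeasurableSet.iInter fun k => (hN.nullMeasurableSet_decoding α β hB k).compl
  have h1 : {ω | ∃ k, z < progress d (Y k ω) ∧
      β ≤ sir α (fun i => X i ω) (h none k ω) (fun i => h (some i) k ω) (Y k ω)} = Eᶜ := by
    ext ω
    simp [hE]
  have hF := F_nonneg (L + 1) (invScale α β lam p * z)
  have hnn : 0 ≤ lam * (1 - p) *
      (F (L + 1) (invScale α β lam p * z) / invScale α β lam p ^ 2) := by positivity
  rw [h1, prob_compl_eq_one_sub₀ hEm]
  have h2 : ENNReal.ofReal (Real.exp (-(lam * (1 - p) *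
      (F (L + 1) (invScale α β lam p * z) / invScale α β lam p ^ 2)))) ≤ P E := by
    rw [← expNeg_ofReal hnn, ENNReal.ofReal_mul hρ]
    refine le_trans (antitone_expNeg ?_) (hN.expNeg_le_measure_forall_notMem hρ α β hB)
    exact mul_le_mul_right (hN.setLIntegral_successProb_le hα hβ hlam hp₀ hd hz) _
  refine (tsub_le_tsub_left h2 _).trans_eq ?_
  -- The density cancels here: `λ(1-p) / q² = ((1-p)/p) / (β^{2/α} Δ)`.
  rw [← ENNReal.ofReal_one, ← ENNReal.ofReal_sub _ (Real.exp_nonneg _), HIntegrand,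
    invScale_sq hα hβ hlam hp₀]
  congr 4
  have := Delta_pos hα
  field_simp

/-- Almost surely finitely many receivers with positive progress decode the packet. -/
theorem ae_finite_decoding [IsProbabilityMeasure P]
    (hN : IsNetwork P lam p (L + 1) X Y h) {α β : ℝ} (hα : 2 < α) (hβ : 0 < β) (hlam : 0 < lam)
    (hp₀ : 0 < p) (hp₁ : p < 1) {d : Plane} (hd : d ≠ 0) :
    ∀ᵐ ω ∂P, {k | 0 < progress d (Y k ω) ∧
      β ≤ sir α (fun i => X i ω) (h none k ω) (fun i => h (some i) k ω) (Y k ω)}.Finite := by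
  have hρ : 0 ≤ lam * (1 - p) := mul_nonneg hlam.le (by linarith)
  have h1 := hN.tsum_measure_decoding hρ α β (measurableSet_lt_progress d 0)
  -- Borel–Cantelli: the expected number of such receivers is finite by Campbell's formula.
  refine ae_finite_setOfPred_mem (s := fun k => {ω | Y k ω ∈ {y | 0 < progress d y} ∧
      β ≤ sir α (fun i => X i ω) (h none k ω) (fun i => h (some i) k ω) (Y k ω)}) ?_
  rw [h1]
  exact ENNReal.mul_ne_top ENNReal.ofReal_ne_top
    ((hN.setLIntegral_successProb_le hα hβ hlam hp₀ hd le_rfl).trans_lt ENNReal.ofReal_lt_top).ne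

end IsNetwork

/-! ### The relay of maximal progress -/

lemma progress_zero (d : Plane) : progress d 0 = 0 := by simp [progress]

lemma IsRelay.progress_nonneg {L : ℕ} {α β : ℝ} {d : Plane} {x y : ℕ → Plane}
    {h : Option ℕ → ℕ → Fin L → ℂ} {v : Plane} (hv : IsRelay α β d x y h v) : 0 ≤ progress d v := by
  have := hv.2 0 (Or.inr rfl)
  rwa [progress_zero] at this

/-- The emitter has progress 0, so only the finitely many decoding receivers with positive progress
compete with it. -/
lemma exists_isRelay_of_finite {L : ℕ} {α β : ℝ} {d : Plane} {x y : ℕ → Plane}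
    {h : Option ℕ → ℕ → Fin L → ℂ}
    (hfin : {k | 0 < progress d (y k) ∧
      β ≤ sir α x (h none k) (fun i => h (some i) k) (y k)}.Finite) :
    ∃ v, IsRelay α β d x y h v := by
  by_cases hne : {k | 0 < progress d (y k) ∧
      β ≤ sir α x (h none k) (fun i => h (some i) k) (y k)}.Nonempty
  · obtain ⟨k, hk, hmax⟩ := Set.exists_max_image _ (fun k => progress d (y k)) hfin hne
    refine ⟨y k, Or.inl ⟨k, hk.2, rfl⟩, ?_⟩
    rintro w (⟨l, hl, rfl⟩ | hw)
    · by_cases hl0 : 0 < progress d (y l)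
      · exact hmax l ⟨hl0, hl⟩
      · exact (not_lt.1 hl0).trans hk.1.le
    · rw [Set.mem_singleton_iff.1 hw, progress_zero]
      exact hk.1.le
  · refine ⟨0, Or.inr rfl, ?_⟩
    rintro w (⟨l, hl, rfl⟩ | hw)
    · rw [progress_zero]
      by_contra hl0
      exact hne ⟨l, not_le.1 hl0, hl⟩
    · rw [Set.mem_singleton_iff.1 hw]

lemma IsRelay.progress_eq {L : ℕ} {α β : ℝ} {d : Plane} {x y : ℕ → Plane}
    {h : Option ℕ → ℕ → Fin L → ℂ} {v w : Plane} (hv : IsRelay α β d x y h v)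
    (hw : IsRelay α β d x y h w) : progress d v = progress d w :=
  le_antisymm (hw.2 v hv.1) (hv.2 w hw.1)

section RandomRelay

variable {lam p : ℝ} {L : ℕ}
  {X Y : ℕ → Ω → Plane}

/-- `V` is an arbitrary selection, perhaps not measurable, but its progress is almost surely a
countable supremum of the positive parts of the progress of decoding receivers. -/
lemma IsRandomRelay.aemeasurable_progress {h : Option ℕ → ℕ → Ω → Fin L → ℂ} {α β : ℝ}
    {d : Plane} {V : Ω → Plane}
    (hN : IsNetwork P lam p L X Y h) (hV : IsRandomRelay P α β d X Y h V) :
    AEMeasurable (fun ω => progress d (V ω)) P := by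
  let A : ℕ → Set Ω := fun k => {ω | Y k ω ∈ Set.univ ∧
    β ≤ sir α (fun i => X i ω) (h none k ω) (fun i => h (some i) k ω) (Y k ω)}
  have hA : ∀ k, NullMeasurableSet (A k) P := fun k =>
    hN.nullMeasurableSet_decoding α β MeasurableSet.univ k
  have hM : AEMeasurable (fun ω => ⨆ k, (A k).indicator
      (fun ω => ENNReal.ofReal (progress d (Y k ω))) ω) P :=
    AEMeasurable.iSup fun k => AEMeasurable.indicator₀
      (((continuous_progress d).measurable.comp (hN.receivers.measurable k)).ennreal_ofReal).aemeasurable (hA k)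
  refine hM.ennreal_toReal.congr ?_
  filter_upwards [hV] with ω hω
  have key : ⨆ k, (A k).indicator (fun ω => ENNReal.ofReal (progress d (Y k ω))) ω =
      ENNReal.ofReal (progress d (V ω)) := by
    refine le_antisymm (iSup_le fun k => ?_) ?_
    · refine Set.indicator_apply_le' (fun hk => ENNReal.ofReal_le_ofReal ?_) fun _ => zero_le
      exact hω.2 _ (Or.inl ⟨k, hk.2, rfl⟩)
    · rcases hω.1 with ⟨k, hk, hVk⟩ | h0
      · refine le_iSup_of_le k ?_
        rw [Set.indicator_of_mem (show ω ∈ A k from ⟨trivial, hk⟩), hVk]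
      · rw [Set.mem_singleton_iff.1 h0, progress_zero]
        simp
  rw [key, ENNReal.toReal_ofReal hω.progress_nonneg]

variable {h : Option ℕ → ℕ → Ω → Fin (L + 1) → ℂ}

lemma IsNetwork.exists_isRandomRelay [IsProbabilityMeasure P]
    (hN : IsNetwork P lam p (L + 1) X Y h) {α β : ℝ} (hα : 2 < α) (hβ : 0 < β) (hlam : 0 < lam)
    (hp₀ : 0 < p) (hp₁ : p < 1) {d : Plane} (hd : d ≠ 0) :
    ∃ V : Ω → Plane, IsRandomRelay P α β d X Y h V := by
  have h1 : ∀ᵐ ω ∂P, ∃ v, IsRelay α β d (fun i => X i ω) (fun k => Y k ω)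
      (fun i k => h i k ω) v := by
    filter_upwards [hN.ae_finite_decoding hα hβ hlam hp₀ hp₁ hd] with ω hω
    exact exists_isRelay_of_finite hω
  exact h1.choice

lemma lintegral_HIntegrand_comp_mul {α β : ℝ} (hα : 2 < α) (hβ : 0 < β)
    (hp₀ : 0 < p) (hp₁ : p < 1) {q : ℝ} (hq : 0 < q) :
    ∫⁻ t in Set.Ioi (0 : ℝ), ENNReal.ofReal (HIntegrand α β p L (q * t)) =
      ENNReal.ofReal (1 / q * H α β p L) := by
  have hint := integrableOn_HIntegrand hα hβ hp₀ hp₁ L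
  have hint' : IntegrableOn (fun t => HIntegrand α β p L (q * t)) (Set.Ioi 0) := by
    rw [integrableOn_Ioi_comp_mul_left_iff _ _ hq]
    simpa using hint
  rw [← ofReal_integral_eq_lintegral_ofReal hint' (Eventually.of_forall fun t =>
    HIntegrand_nonneg hα hβ hp₀ hp₁ L _), integral_comp_mul_left_Ioi _ _ hq]
  simp [H]

/-- Layer-cake formula: a relay with progress above `t > 0` is not the emitter, so some receiver
beyond `t` decodes. -/
theorem IsRandomRelay.integrable_progress [IsProbabilityMeasure P]
    (hN : IsNetwork P lam p (L + 1) X Y h) {α β : ℝ} (hα : 2 < α) (hβ : 0 < β) (hlam : 0 < lam)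
    (hp₀ : 0 < p) (hp₁ : p < 1) {d : Plane} (hd : d ≠ 0) {V : Ω → Plane}
    (hV : IsRandomRelay P α β d X Y h V) :
    Integrable (fun ω => progress d (V ω)) P ∧
      meanProgress P d V ≤ 1 / invScale α β lam p * H α β p (L + 1) := by
  have hnn : 0 ≤ᵐ[P] fun ω => progress d (V ω) := by
    filter_upwards [hV] with ω hω using hω.progress_nonneg
  have hm := hV.aemeasurable_progress hN
  have hH : 0 ≤ H α β p (L + 1) :=
    integral_nonneg fun z => HIntegrand_nonneg hα hβ hp₀ hp₁ (L + 1) z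
  have hq := invScale_pos hα hβ hlam hp₀
  have hle : ∫⁻ ω, ENNReal.ofReal (progress d (V ω)) ∂P ≤
      ENNReal.ofReal (1 / invScale α β lam p * H α β p (L + 1)) := by
    rw [lintegral_eq_lintegral_meas_lt P hnn hm,
      ← lintegral_HIntegrand_comp_mul hα hβ hp₀ hp₁ hq]
    refine setLIntegral_mono' measurableSet_Ioi fun t ht => ?_
    have ht' : 0 < t := ht
    refine le_trans (measure_mono_ae ?_)
      (hN.measure_exists_decoding_le hα hβ hlam hp₀ hp₁ hd ht'.le)
    filter_upwards [hV] with ω hω htω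
    have htω' : t < progress d (V ω) := htω
    rcases hω.1 with ⟨k, hk, hVk⟩ | h0
    · rw [hVk] at htω'
      exact ⟨k, htω', hk⟩
    · rw [Set.mem_singleton_iff.1 h0, progress_zero] at htω'
      exact absurd htω' (not_lt.2 ht'.le)
  refine ⟨⟨hm.aestronglyMeasurable, ?_⟩, ?_⟩
  · rw [hasFiniteIntegral_iff_ofReal hnn]
    exact hle.trans_lt ENNReal.ofReal_lt_top
  · rw [meanProgress, integral_eq_lintegral_of_nonneg_ae hnn hm.aestronglyMeasurable]
    exact ENNReal.toReal_le_of_le_ofReal (by positivity) hle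

end RandomRelay

/-! ### Rescaling the network -/

lemma pointCount_smul (c : ℝ) (x : ℕ → Plane) {A : Set Plane} (hA : MeasurableSet A) :
    pointCount (fun i => c • x i) A = pointCount x ((fun v => c • v) ⁻¹' A) := by
  have hA' : MeasurableSet ((fun v : Plane => c • v) ⁻¹' A) := measurable_const_smul c hA
  rw [pointCount, pointCount, Measure.sum_apply _ hA, Measure.sum_apply _ hA']
  refine tsum_congr fun i => ?_
  rw [Measure.dirac_apply' _ hA, Measure.dirac_apply' _ hA']
  rfl

lemma IsPoissonProcess.smul {Ω : Type*} [MeasurableSpace Ω] {P : Measure Ω} {ρ ρ' c : ℝ}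
    (hc : 0 < c) (hρ : ρ = c ^ 2 * ρ') {X : ℕ → Ω → Plane} (hX : IsPoissonProcess P ρ X) :
    IsPoissonProcess P ρ' (fun i ω => c • X i ω) where
  measurable i := (hX.measurable i).const_smul c
  count_law A hA hfin := by
    have hvol : volume ((fun v : Plane => c • v) ⁻¹' A) = ENNReal.ofReal (c ^ 2)⁻¹ * volume A := by
      rw [Measure.addHaar_preimage_smul _ hc.ne', finrank_euclideanSpace, Fintype.card_fin,
        abs_of_nonneg (by positivity)]
    have h := hX.count_law _ (measurable_const_smul c hA) (by
      rw [hvol]; exact ENNReal.mul_lt_top ENNReal.ofReal_lt_top hfin)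
    have e : ρ * (volume ((fun v : Plane => c • v) ⁻¹' A)).toReal = ρ' * (volume A).toReal := by
      rw [hvol, ENNReal.toReal_mul, ENNReal.toReal_ofReal (by positivity), hρ]
      field_simp
    rw [e] at h
    simp_rw [pointCount_smul c _ hA]
    exact h
  count_indep n A hA hdisj := by
    simp_rw [pointCount_smul c _ (hA _)]
    exact hX.count_indep n _ (fun j => measurable_const_smul c (hA j))
      fun j l hjl => (hdisj hjl).preimage _

lemma IsNetwork.smul {Ω : Type*} [MeasurableSpace Ω] {P : Measure Ω} {lam lam' p c : ℝ} {L : ℕ}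
    (hc : 0 < c) (hlam : lam = c ^ 2 * lam') {X Y : ℕ → Ω → Plane}
    {h : Option ℕ → ℕ → Ω → Fin L → ℂ} (hN : IsNetwork P lam p L X Y h) :
    IsNetwork P lam' p L (fun i ω => c • X i ω) (fun k ω => c • Y k ω) h where
  emitters := hN.emitters.smul hc (by rw [hlam]; ring)
  receivers := hN.receivers.smul hc (by rw [hlam]; ring)
  fading_law := hN.fading_law
  fading_indep := hN.fading_indep
  emitters_indep_receivers :=
    hN.emitters_indep_receivers.comp (φ := fun (x : ℕ → Plane) i => c • x i)
      (ψ := fun (y : ℕ → Plane) k => c • y k) (by fun_prop) (by fun_prop)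
  nodes_indep_fading :=
    hN.nodes_indep_fading.comp
      (φ := fun q : (ℕ → Plane) × (ℕ → Plane) => ((fun i => c • q.1 i), fun k => c • q.2 k))
      (ψ := id) (by fun_prop) measurable_id

lemma matrix_inv_smul {n : Type*} [Fintype n] [DecidableEq n] {k : ℂ} (hk : k ≠ 0)
    (A : Matrix n n ℂ) : (k • A)⁻¹ = k⁻¹ • A⁻¹ := by
  by_cases hA : IsUnit A.det
  · exact Matrix.inv_smul' A (Units.mk0 k hk) hA
  · have hA' : ¬ IsUnit (k • A).det := by
      rw [Matrix.det_smul]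
      simp only [isUnit_iff_ne_zero, not_not] at hA ⊢
      rw [hA, mul_zero]
    rw [Matrix.nonsing_inv_apply_not_isUnit _ hA, Matrix.nonsing_inv_apply_not_isUnit _ hA',
      smul_zero]

lemma interferenceCov_smul {L : ℕ} {α c : ℝ} (hc : 0 < c) (x : ℕ → Plane) (g : ℕ → Fin L → ℂ)
    (y : Plane) : interferenceCov α (fun i => c • x i) g (c • y) =
      ((c ^ (-α) : ℝ) : ℂ) • interferenceCov α x g y := by
  unfold interferenceCov
  rw [← tsum_const_smul'']
  refine tsum_congr fun i => ?_
  rw [← smul_sub, norm_smul, Real.norm_of_nonneg hc.le, Real.mul_rpow hc.le (norm_nonneg _),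
    mul_smul]
  rfl

/-- The factor `c^{-α}` appears in both signal and interference and cancels; this holds also for
singular or divergent covariances, given the conventions for `⁻¹` and `tsum`. -/
lemma sir_smul {L : ℕ} {α c : ℝ} (hc : 0 < c) (x : ℕ → Plane) (g₀ : Fin L → ℂ)
    (g : ℕ → Fin L → ℂ) (y : Plane) :
    sir α (fun i => c • x i) g₀ g (c • y) = sir α x g₀ g y := by
  have hk : 0 < c ^ (-α) := Real.rpow_pos_of_pos hc _
  have hk' : ((c ^ (-α) : ℝ) : ℂ) ≠ 0 := by exact_mod_cast hk.ne'
  unfold sir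
  rw [interferenceCov_smul hc, matrix_inv_smul hk', Matrix.smul_mulVec, dotProduct_smul,
    smul_eq_mul, ← Complex.ofReal_inv, Complex.re_ofReal_mul, norm_smul,
    Real.norm_of_nonneg hc.le, Real.mul_rpow hc.le (norm_nonneg _)]
  field_simp

lemma IsRelay.smul {L : ℕ} {α β c : ℝ} (hc : 0 < c) {d : Plane} {x y : ℕ → Plane}
    {h : Option ℕ → ℕ → Fin L → ℂ} {v : Plane} (hv : IsRelay α β d x y h v) :
    IsRelay α β d (fun i => c • x i) (fun k => c • y k) h (c • v) := by
  constructor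
  · rcases hv.1 with ⟨k, hk, rfl⟩ | h0
    · exact Or.inl ⟨k, by rwa [sir_smul hc], rfl⟩
    · rw [Set.mem_singleton_iff.1 h0, smul_zero]
      exact Or.inr rfl
  · rintro w (⟨k, hk, rfl⟩ | h0)
    · rw [sir_smul hc] at hk
      rw [progress_smul, progress_smul]
      exact mul_le_mul_of_nonneg_left (hv.2 _ (Or.inl ⟨k, hk, rfl⟩)) hc.le
    · rw [Set.mem_singleton_iff.1 h0, progress_zero, progress_smul]
      exact mul_nonneg hc.le hv.progress_nonneg

/-- `V'` need not be `c • V` when maximizers are not unique, but all maximizers have the same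
progress. -/
lemma meanProgress_smul {Ω : Type*} [MeasurableSpace Ω] {P : Measure Ω} {L : ℕ} {α β c : ℝ}
    (hc : 0 < c) {d : Plane} {X Y : ℕ → Ω → Plane} {h : Option ℕ → ℕ → Ω → Fin L → ℂ}
    {V V' : Ω → Plane} (hV : IsRandomRelay P α β d X Y h V)
    (hV' : IsRandomRelay P α β d (fun i ω => c • X i ω) (fun k ω => c • Y k ω) h V') :
    meanProgress P d V' = c * meanProgress P d V := by
  unfold meanProgress
  rw [← integral_const_mul]
  refine integral_congr_ae ?_
  filter_upwards [hV, hV'] with ω hω hω'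
  rw [← progress_smul]
  exact hω'.progress_eq (hω.smul hc)

end MSRAloha

/-! ### Main theorem -/

theorem theorem2 {Ω : Type*} [MeasurableSpace Ω] (P : Measure Ω) [IsProbabilityMeasure P]
    (L : ℕ) (hL : 1 ≤ L) (α β lam p : ℝ) (hα : 2 < α) (hβ : 0 < β) (hlam : 0 < lam)
    (hp₀ : 0 < p) (hp₁ : p < 1)
    (X Y : ℕ → Ω → MSRAloha.Plane) (h : Option ℕ → ℕ → Ω → Fin L → ℂ)
    (hN : MSRAloha.IsNetwork P lam p L X Y h)
    (d : MSRAloha.Plane) (hd : d ≠ 0) :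
    -- almost surely the selection rule has a maximizer
    (∃ V : Ω → MSRAloha.Plane, MSRAloha.IsRandomRelay P α β d X Y h V) ∧
    -- the integral defining `H` converges
    IntegrableOn (MSRAloha.HIntegrand α β p L) (Set.Ioi 0) ∧
    -- the bound on the mean progress
    (∀ V : Ω → MSRAloha.Plane, MSRAloha.IsRandomRelay P α β d X Y h V →
      Integrable (fun ω => MSRAloha.progress d (V ω)) P ∧
      MSRAloha.meanProgress P d V ≤
        1 / (β ^ (1 / α) * √(lam * p * MSRAloha.Delta α)) * MSRAloha.H α β p L) ∧
    -- scaling: rescaling the network by `√(lam / lam')` gives a network of density `lam'`,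
    -- whose spatial density of progress is `√(lam' / lam)` times the original one
    (∀ lam' : ℝ, 0 < lam' →
      MSRAloha.IsNetwork P lam' p L (fun i ω => √(lam / lam') • X i ω)
        (fun k ω => √(lam / lam') • Y k ω) h ∧
      ∀ V V' : Ω → MSRAloha.Plane, MSRAloha.IsRandomRelay P α β d X Y h V →
        MSRAloha.IsRandomRelay P α β d (fun i ω => √(lam / lam') • X i ω)
          (fun k ω => √(lam / lam') • Y k ω) h V' →
        lam' * p * MSRAloha.meanProgress P d V' =
          √(lam' / lam) * (lam * p * MSRAloha.meanProgress P d V)) := by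
  obtain ⟨M, rfl⟩ : ∃ M, L = M + 1 := ⟨L - 1, by omega⟩
  refine ⟨hN.exists_isRandomRelay hα hβ hlam hp₀ hp₁ hd,
    MSRAloha.integrableOn_HIntegrand hα hβ hp₀ hp₁ _,
    fun V hV => hV.integrable_progress hN hα hβ hlam hp₀ hp₁ hd, fun lam' hlam' => ?_⟩
  have hc : 0 < √(lam / lam') := by positivity
  refine ⟨hN.smul hc ?_, fun V V' hV hV' => ?_⟩
  · rw [Real.sq_sqrt (by positivity), div_mul_cancel₀ _ hlam'.ne']
  -- What remains is `λ' √(λ/λ') = √(λ'/λ) λ`.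
  · rw [MSRAloha.meanProgress_smul hc hV hV', Real.sqrt_div hlam.le, Real.sqrt_div hlam'.le]
    have h1 : 0 < √lam := Real.sqrt_pos.2 hlam
    have h2 : 0 < √lam' := Real.sqrt_pos.2 hlam'
    field_simp
    rw [Real.sq_sqrt hlam.le, Real.sq_sqrt hlam'.le]
    ring
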